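/- **Setting.** Let $\Omega\subset\mathbb R^2$ be a convex polygon (compact, with non-empty interior) of diameter $D$, with coordinates chosen so that $0\in\Omega$. Let $\hexagon_0$ be the closed regular hexagon with centre $0$, circumradius $1$ and two vertices on the $y$-axis, let $\Lambda=\{m(\sqrt3,0)+n(\tfrac{\sqrt3}{2},\tfrac32): m,n\in\mathbb Z\}$, and for $x\in\Lambda$ let $\hexagon_x=x+\hexagon_0$; these are the cells of the hexagonal tiling. A placement is a pair $p=(u,\theta)\in\mathbb R^2\times\mathbb R$; the placed polygon is $p\cdot\Omega=R(\theta)\Omega+u$, where $R(\theta)$ is the rotation by $\theta$. The polygon $p\cdot\Omega$ is said to *meet* the cell $\hexagon_x$ if it contains an interior point of $\hexagon_x$. Let $\Lambda_\Delta=\Lambda\cap[-D-3,D+3]^2$, $T_x(\theta)=R(\pi+\theta)\Omega+\hexagon_x$, and let $P_0=\hexagon_0\times[0,\frac\pi3]$. The *surfaces* are the eight faces of the prism $P_0$ together with, for each $x\in\Lambda_\Delta$, the faces of the lateral boundary of the body $\{(u,\theta): \theta\in[0,\frac\pi3],\ u\in T_x(\theta)\}$: each is obtained from an edge of $\Omega$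 and a vertex of $\hexagon_x$, or from a vertex of $\Omega$ and an edge of $\hexagon_x$, as the union, over those $\theta\in[0,\frac\pi3]$ for which the Minkowski sum of the two (the part of $\Omega$ being rotated by $\pi+\theta$) is contained in $\partial T_x(\theta)$, of these sums at height $\theta$. A *triple intersection* is a set $X=S_1\cap S_2\cap S_3\cap P_0$ with three different surfaces $S_1,S_2,S_3$. Let $\mathcal C$ be the union of all triple intersections, and let $\mathcal V\subseteq\mathcal C$ be the set of those points that, for some triple intersection $X$ containing them, are not inner points of an arc contained in $X$ (so they are isolated points of $X$ or end points of curves in $X$). **Algorithm.** (1) If the minimum enclosing circle of $\Omega$ has diameter at most $1$, return its centre $c$ as the only disc centre, $\Omega$ being placed by the translation by $-c$, so that $c$ becomes the lattice point $0$. (2) Otherwise, inspect a set $\mathcal P$ of points with $\mathcal V\subseteq\mathcal P\subseteq\mathcal C$; for $(u,\theta)\in\mathcal P$ compute the index, i.e. the number of $x\in\Lambda_\Delta$ with $u\in\operatorname{Int}T_x(\theta)$; choose any $p=(u,\theta)\in\mathcal P$ of least index, and return $p$ together with the list of the $x\in\Lambda_\Delta$ with $u\in\operatorname{Int}T_x(\theta)$.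 **Theorem.** The set $\mathcal V$ is finite. For every choice of $\mathcal P$ with $\mathcal V\subseteq\mathcal P\subseteq\mathcal C$ the algorithm has an output, and every output, consisting of a placement $p$ and a set $L$ of centres, is optimal: * $L$ is finite, and it is the set of all $x\in\Lambda$ such that $p\cdot\Omega$ meets $\hexagon_x$; * $p\cdot\Omega\subseteq\bigcup_{x\in L}\hexagon_x$, and the closed unit discs with centres in $L$ cover $p\cdot\Omega$; * $p$ minimizes, over all placements in $\mathbb R^2\times\mathbb R$ (all combinations of a rotation and a translation), the number of cells that are met by the placed polygon; * if $q$ is any placement and $C\subseteq\Lambda$ satisfies $q\cdot\Omega\subseteq\bigcup_{x\in C}\hexagon_x$, then $|L|\le|C|$. -/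

import Mathlib

open Set
open scoped Pointwise

namespace HexCover

noncomputable section

/-! The plane is identified with `ℂ`; a placement is a pair `(u, θ)`, location and orientation. -/

/-- The factor of the rotation about the origin by the angle `θ`. -/
def rot (θ : ℝ) : ℂ := Complex.exp (θ * Complex.I)

/-- `Ω` is a (nondegenerate, closed, filled) convex polygon. -/
def IsConvexPolygon (Ω : Set ℂ) : Prop :=
  (∃ V : Finset ℂ, Ω = convexHull ℝ (V : Set ℂ)) ∧ (interior Ω).Nonempty

/-- The segment `[a, b]` is an edge of the polygon `Ω`. -/
def IsEdge (Ω : Set ℂ) (a b : ℂ) : Prop :=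
  a ≠ b ∧ a ∈ extremePoints ℝ Ω ∧ b ∈ extremePoints ℝ Ω ∧ IsExposed ℝ Ω (segment ℝ a b)

/-- The lattice point `m (√3, 0) + n (√3/2, 3/2)`. -/
def latticePoint (m n : ℤ) : ℂ :=
  (m : ℂ) * ⟨Real.sqrt 3, 0⟩ + (n : ℂ) * ⟨Real.sqrt 3 / 2, 3 / 2⟩

/-- The hexagonal lattice. -/
def lattice : Set ℂ := {x | ∃ m n : ℤ, x = latticePoint m n}

/-- The vertices of the canonical hexagon, in cyclic order (with period 6 in `k`);
two of them are on the imaginary axis. -/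
def hexVertex (k : ℤ) : ℂ := rot (Real.pi / 2 + k * (Real.pi / 3))

/-- The edges of the canonical hexagon. -/
def hexEdge (k : ℤ) : Set ℂ := segment ℝ (hexVertex k) (hexVertex (k + 1))

/-- The canonical (closed, filled) hexagon, centred at the origin and with circumradius `1`. -/
def hexagon : Set ℂ := convexHull ℝ (range hexVertex)

/-- The closed cell of the hexagonal tiling centred at `x`. -/
def hexCell (x : ℂ) : Set ℂ := {x} + hexagon

/-- The set `Ω` in the placement `p = (u, θ)`: rotated by `θ` and then translated by `u`. -/
def place (p : ℂ × ℝ) (z : ℂ) : ℂ := rot p.2 * z + p.1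

/-- The centres of the cells that are met (in their interior) by `Ω` in the placement `p`. -/
def metCells (Ω : Set ℂ) (p : ℂ × ℝ) : Set ℂ :=
  {x ∈ lattice | (place p '' Ω ∩ interior (hexCell x)).Nonempty}

/-! ### The algorithm -/

/-- `closedBall c r` is the minimum enclosing disc of `Ω`. -/
def IsMinEnclosingDisc (Ω : Set ℂ) (c : ℂ) (r : ℝ) : Prop :=
  Ω ⊆ Metric.closedBall c r ∧ ∀ c' r', Ω ⊆ Metric.closedBall c' r' → r ≤ r'

/-- The lattice points in the square `[-D-3, D+3] × [-D-3, D+3]`, where `D` is the diameter. -/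
def gridPoints (Ω : Set ℂ) : Set ℂ :=
  {x ∈ lattice | |x.re| ≤ Metric.diam Ω + 3 ∧ |x.im| ≤ Metric.diam Ω + 3}

/-- The Minkowski sum of `Ω` rotated by `π + θ` and of the cell centred at `x`, that is, the slice
at height `θ` of the body of `x`. -/
def minkowski (Ω : Set ℂ) (x : ℂ) (θ : ℝ) : Set ℂ :=
  (fun z => rot (Real.pi + θ) * z) '' Ω + hexCell x

/-- The range of the angles. -/
def angles : Set ℝ := Icc 0 (Real.pi / 3)

/-- The hexagonal prism. -/
def prism : Set (ℂ × ℝ) := hexagon ×ˢ angles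

/-- The surface swept by a moving segment `s θ` during the time that it lies on the boundary of
the Minkowski sum. -/
def sweptSurface (Ω : Set ℂ) (x : ℂ) (s : ℝ → Set ℂ) : Set (ℂ × ℝ) :=
  {p | p.2 ∈ angles ∧ p.1 ∈ s p.2 ∧ s p.2 ⊆ frontier (minkowski Ω x p.2)}

/-- The surfaces that bound the bodies of the lattice points in the square, and the prism. -/
inductive IsSurface (Ω : Set ℂ) : Set (ℂ × ℝ) → Prop
  /-- An edge of the rotated polygon plus a vertex of the cell. -/
  | edgeVertex (x : ℂ) (hx : x ∈ gridPoints Ω) (a b : ℂ) (hab : IsEdge Ω a b) (k : ℤ) :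
      IsSurface Ω (sweptSurface Ω x fun θ =>
        (fun z => rot (Real.pi + θ) * z) '' segment ℝ a b + {x + hexVertex k})
  /-- A vertex of the rotated polygon plus an edge of the cell. -/
  | vertexEdge (x : ℂ) (hx : x ∈ gridPoints Ω) (v : ℂ) (hv : v ∈ extremePoints ℝ Ω) (k : ℤ) :
      IsSurface Ω (sweptSurface Ω x fun θ =>
        {rot (Real.pi + θ) * v} + ({x} + hexEdge k))
  /-- A lateral face of the prism. -/
  | prismSide (k : ℤ) : IsSurface Ω (hexEdge k ×ˢ angles)
  /-- The bottom of the prism. -/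
  | prismBottom : IsSurface Ω (hexagon ×ˢ {0})
  /-- The top of the prism. -/
  | prismTop : IsSurface Ω (hexagon ×ˢ {Real.pi / 3})

/-- `X` is the part in the prism of the intersection of three different surfaces. -/
def IsTripleIntersection (Ω : Set ℂ) (X : Set (ℂ × ℝ)) : Prop :=
  ∃ S₁ S₂ S₃, IsSurface Ω S₁ ∧ IsSurface Ω S₂ ∧ IsSurface Ω S₃ ∧
    S₁ ≠ S₂ ∧ S₁ ≠ S₃ ∧ S₂ ≠ S₃ ∧ X = S₁ ∩ S₂ ∩ S₃ ∩ prism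

/-- `p` is an inner point of an arc contained in `X`. -/
def IsInnerPointOfArc (X : Set (ℂ × ℝ)) (p : ℂ × ℝ) : Prop :=
  ∃ γ : ℝ → ℂ × ℝ, ContinuousOn γ (Ioo (-1) 1) ∧ InjOn γ (Ioo (-1) 1) ∧
    MapsTo γ (Ioo (-1) 1) X ∧ γ 0 = p

/-- All points of the prism that are common to three different surfaces. -/
def commonPoints (Ω : Set ℂ) : Set (ℂ × ℝ) :=
  {p | ∃ X, IsTripleIntersection Ω X ∧ p ∈ X}

/-- The points that the algorithm must inspect: where three surfaces meet in isolated points,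
these points, and where they have a curve in common, its end points. -/
def vertexPoints (Ω : Set ℂ) : Set (ℂ × ℝ) :=
  {p | ∃ X, IsTripleIntersection Ω X ∧ p ∈ X ∧ ¬ IsInnerPointOfArc X p}

/-- The lattice points in the square whose Minkowski sum has the point `p` in its interior. -/
def hitPoints (Ω : Set ℂ) (p : ℂ × ℝ) : Set ℂ :=
  {x ∈ gridPoints Ω | p.1 ∈ interior (minkowski Ω x p.2)}

/-- The index of a point: how many Minkowski sums have it in their interior. -/
def index (Ω : Set ℂ) (p : ℂ × ℝ) : ℕ∞ := (hitPoints Ω p).encard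

/-- The first test of the algorithm, with the disc found. -/
def IsSmallWith (Ω : Set ℂ) (c : ℂ) : Prop :=
  ∃ r, IsMinEnclosingDisc Ω c r ∧ 2 * r ≤ 1

/-- What the algorithm returns: a placement, and the centres of the unit discs (in the frame of
the placed polygon). -/
structure Output where
  placement : ℂ × ℝ
  centres : Set ℂ

/-- `out` is a possible output of the algorithm on the input `Ω` if `points` is the list of points
that are inspected. (Ties in the search for the minimum may be broken in any way.)
* If the minimum enclosing circle has diameter at most `1`, then its centre `c` is returned, and
  `Ω` is placed with `c` at the origin.
* Otherwise some `p` in `points` of the least index is selected, and all the lattice points whose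
  Minkowski sum has `p` in its interior are returned. -/
inductive IsOutput (Ω : Set ℂ) (points : Set (ℂ × ℝ)) : Output → Prop
  | small (c : ℂ) (hc : IsSmallWith Ω c) :
      IsOutput Ω points ⟨(-c, 0), {place (-c, 0) c}⟩
  | search (hbig : ¬ ∃ c, IsSmallWith Ω c) (p : ℂ × ℝ) (hp : p ∈ points)
      (hmin : ∀ q ∈ points, index Ω p ≤ index Ω q) :
      IsOutput Ω points ⟨p, hitPoints Ω p⟩

end

end HexCover

/-!
A placement `q` is encoded by a point of `ℂ × ℝ`, and the placed polygon meets the cell of `x` iff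
`q` is in the interior of the body of `x`, whose slices are the sets `minkowski Ω x θ`
(`mem_interior_minkowski_iff_meets`). The lattice and the hexagon are invariant under rotations by
`π / 3`, and the cells cover the plane, so every placement may be replaced by one in the prism
(`exists_mem_prism_encard_le`). There the index is the number of cells met
(`hitPoints_eq_metCells`). The cells that are met cover the placed polygon, which is the closure of
its interior (`image_place_subset`), and as the interior of a cell meets no other cell, every
covering by cells contains all of them (`metCells_subset_of_cover`). It remains to see that there
are only finitely many vertex points, and that one of them has an index that is least in the prism.

*The least index.* Given `q` in the prism, consider the free region: all points of the prism that
are not in the interior of a body that `q` avoids. It is compact and contains `q`; let `p` be a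
point of the free region with the least angle and, among those, farthest from the axis of the prism.
It hits no body that `q` avoids. The claim is that `p` is a vertex point
(`IsLowest.mem_vertexPoints`).
* Two lateral surfaces with different directions pass through `p`. Otherwise `p` could be moved in
  two opposite directions within its slice of the free region, and one of them increases the
  distance from the axis (`IsLowest.exists_transversal`).
* If the angle of `p` is `0`, these two surfaces and the bottom of the prism have only `p` in
  common.
* If the angle is positive, only surfaces that reach `p` from below are used; the walls of a body
  that do this suffice, as every boundary point of the body is a limit of boundary points at lower
  angles (`exists_wall_mem_surfacesAt`). Several bodies may share a wall, but then they lie on the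
  same side of it (`not_opposite_sides`). Hence, if only two surfaces passed through `p`, the bodies
  near `p` would be confined to two half-planes, and some point near `p` would be free at a lower
  angle. So there is a third surface (`IsLowest.exists_third`).
* If `p` were an inner point of an arc in every triple intersection of the two transversal surfaces
  and a third one, then all these arcs would follow the curve in which the first two surfaces meet,
  and this curve passes from lower to higher angles. A point of it just below `p` would then be on
  the boundary of all the bodies near by, hence free, against the choice of `p`
  (`IsLowest.mem_vertexPoints_of_third`).

*Finiteness.* Every surface is given by finitely many linear inequalities in the location, with
coefficients that are analytic in the angle, and so is every triple intersection. At all but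
finitely many angles no minor of the extended coefficient matrix has an isolated zero, and Cramer's
rule then yields an arc through any given point on which the active inequalities stay active. In
each of the remaining slices, a point on no arc is determined by its active inequalities
(`IsAnalyticPolyhedral.finite_not_inner`).
-/

namespace HexCover

/-! ### Support lines and segments in the plane -/

/-- The cross product of two plane vectors. Every linear functional on the plane is `cross c` for
some `c`; the line through `u` with direction `c` is the zero set of `w ↦ cross c (w - u)`. -/
def cross (z w : ℂ) : ℝ := z.re * w.im - z.im * w.re

lemma cross_add_right (c z w : ℂ) : cross c (z + w) = cross c z + cross c w := by
  simp only [cross, Complex.add_re, Complex.add_im]; ring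

lemma cross_sub_right (c z w : ℂ) : cross c (z - w) = cross c z - cross c w := by
  simp only [cross, Complex.sub_re, Complex.sub_im]; ring

lemma cross_smul_right (c z : ℂ) (t : ℝ) : cross c (t • z) = t * cross c z := by
  simp only [cross, Complex.real_smul, Complex.re_ofReal_mul, Complex.im_ofReal_mul]; ring

lemma cross_smul_left (c z : ℂ) (t : ℝ) : cross (t • c) z = t * cross c z := by
  simp only [cross, Complex.real_smul, Complex.re_ofReal_mul, Complex.im_ofReal_mul]; ring

lemma cross_neg_left (c z : ℂ) : cross (-c) z = -cross c z := by
  simp only [cross, Complex.neg_re, Complex.neg_im]; ring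

lemma cross_neg_right (c z : ℂ) : cross c (-z) = -cross c z := by
  simp only [cross, Complex.neg_re, Complex.neg_im]; ring

lemma cross_zero_right (c : ℂ) : cross c 0 = 0 := by simp [cross]

lemma cross_self (c : ℂ) : cross c c = 0 := by simp only [cross]; ring

lemma cross_comm (z w : ℂ) : cross w z = -cross z w := by simp only [cross]; ring

lemma cross_mul_left_mul_left (r z w : ℂ) : cross (r * z) (r * w) = Complex.normSq r * cross z w := by
  simp only [cross, Complex.mul_re, Complex.mul_im, Complex.normSq_apply]; ring

lemma normSq_pos_of_ne {c : ℂ} (hc : c ≠ 0) : 0 < c.re * c.re + c.im * c.im := by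
  have := Complex.normSq_pos.2 hc
  rwa [Complex.normSq_apply] at this

lemma cross_I_mul_pos {c : ℂ} (hc : c ≠ 0) : 0 < cross c (Complex.I * c) := by
  have := normSq_pos_of_ne hc
  simp only [cross, Complex.mul_re, Complex.mul_im, Complex.I_re, Complex.I_im]
  linarith

@[fun_prop]
lemma continuous_cross {X : Type*} [TopologicalSpace X] {f g : X → ℂ} (hf : Continuous f)
    (hg : Continuous g) : Continuous fun x => cross (f x) (g x) := by
  unfold cross; fun_prop

/-- The functional `cross c` as a continuous linear map. -/
noncomputable def crossL (c : ℂ) : StrongDual ℝ ℂ := c.re • Complex.imCLM - c.im • Complex.reCLM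

lemma crossL_apply (c w : ℂ) : crossL c w = cross c w := by
  simp [crossL, cross]

lemma exists_eq_cross (f : StrongDual ℝ ℂ) : ∃ c, ∀ w, f w = cross c w := by
  refine ⟨⟨f Complex.I, -f 1⟩, fun w => ?_⟩
  have h : w = w.re • (1 : ℂ) + w.im • Complex.I := by
    apply Complex.ext <;> simp
  conv_lhs => rw [h]
  rw [map_add, map_smul, map_smul]
  simp only [cross, smul_eq_mul]; ring

lemma eq_smul_of_cross_eq_zero {c d : ℂ} (hd : d ≠ 0) (h : cross c d = 0) : ∃ l : ℝ, c = l • d := by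
  have hn := normSq_pos_of_ne hd
  refine ⟨(c.re * d.re + c.im * d.im) / (d.re * d.re + d.im * d.im), ?_⟩
  simp only [cross] at h
  apply Complex.ext
  · simp only [Complex.real_smul, Complex.re_ofReal_mul]
    rw [div_mul_eq_mul_div, eq_div_iff hn.ne']
    linear_combination d.im * h
  · simp only [Complex.real_smul, Complex.im_ofReal_mul]
    rw [div_mul_eq_mul_div, eq_div_iff hn.ne']
    linear_combination (-d.re) * h

/-- A convex set with interior points has a support line through every point that is not an
interior point. -/
lemma exists_support {T : Set ℂ} (hT : Convex ℝ T) (hi : (interior T).Nonempty) {u : ℂ}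
    (hu : u ∉ interior T) : ∃ c ≠ 0, ∀ w ∈ T, 0 ≤ cross c (w - u) := by
  obtain ⟨f, hf⟩ := geometric_hahn_banach_point_open hT.interior isOpen_interior hu
  obtain ⟨c, hc⟩ := exists_eq_cross f
  refine ⟨c, ?_, fun w hw => ?_⟩
  · rintro rfl
    obtain ⟨w, hw⟩ := hi
    have := hf w hw
    simp [hc, cross] at this
  · have hcl : w ∈ closure (interior T) := by
      rw [hT.closure_interior_eq_closure_of_nonempty_interior hi]
      exact subset_closure hw
    have hclosed : IsClosed {w | 0 ≤ cross c (w - u)} :=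
      isClosed_le continuous_const (by fun_prop)
    refine closure_minimal (fun w hw => ?_) hclosed hcl
    have := hf w hw
    rw [hc, hc] at this
    simp only [mem_ofPred_eq, cross_sub_right]
    linarith

/-- A point on or beyond a support line is not an interior point. -/
lemma notMem_interior_of_support {T : Set ℂ} {c u v : ℂ} (hc : c ≠ 0)
    (h : ∀ w ∈ T, 0 ≤ cross c (w - u)) (hv : cross c (v - u) ≤ 0) : v ∉ interior T := by
  intro hvi
  have hcont : Filter.Tendsto (fun s : ℝ => v - s • (Complex.I * c)) (nhdsWithin 0 (Ioi 0))
      (nhds v) := by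
    have : Continuous fun s : ℝ => v - s • (Complex.I * c) := by fun_prop
    have h2 := this.tendsto 0
    simp only [zero_smul, sub_zero] at h2
    exact h2.mono_left nhdsWithin_le_nhds
  obtain ⟨s, hs, hs0⟩ := ((hcont.eventually (mem_interior_iff_mem_nhds.1 hvi)).and
    eventually_mem_nhdsWithin).exists
  have h1 := h _ hs
  have h2 := cross_I_mul_pos hc
  rw [show v - s • (Complex.I * c) - u = (v - u) - s • (Complex.I * c) by ring, cross_sub_right,
    cross_smul_right] at h1
  have h3 : 0 < s := hs0
  nlinarith [mul_pos h3 h2]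

lemma mem_segment_iff_smul {P Q u : ℂ} :
    u ∈ segment ℝ P Q ↔ ∃ t : ℝ, 0 ≤ t ∧ t ≤ 1 ∧ u = P + t • (Q - P) := by
  rw [segment_eq_image']
  constructor
  · rintro ⟨t, ht, rfl⟩; exact ⟨t, ht.1, ht.2, rfl⟩
  · rintro ⟨t, h0, h1, rfl⟩; exact ⟨t, ⟨h0, h1⟩, rfl⟩

lemma cross_eq_zero_of_mem_segment {P Q u v : ℂ} (hu : u ∈ segment ℝ P Q) (hv : v ∈ segment ℝ P Q) :
    cross (Q - P) (u - v) = 0 := by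
  obtain ⟨s, -, -, rfl⟩ := mem_segment_iff_smul.1 hu
  obtain ⟨t, -, -, rfl⟩ := mem_segment_iff_smul.1 hv
  rw [show P + s • (Q - P) - (P + t • (Q - P)) = (s - t) • (Q - P) by module, cross_smul_right,
    cross_self, mul_zero]

/-- A convex set lies on one side of a segment on its boundary. -/
lemma side_of_segment {T : Set ℂ} (hT : Convex ℝ T) (hi : (interior T).Nonempty) {P Q u : ℂ}
    (hPQ : P ≠ Q) (hsub : segment ℝ P Q ⊆ T) (hdisj : ∀ v ∈ segment ℝ P Q, v ∉ interior T)
    (hu : u ∈ segment ℝ P Q) :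
    (∀ w ∈ T, 0 ≤ cross (Q - P) (w - u)) ∨ ∀ w ∈ T, cross (Q - P) (w - u) ≤ 0 := by
  have hm : P + (1 / 2 : ℝ) • (Q - P) ∈ segment ℝ P Q :=
    mem_segment_iff_smul.2 ⟨1 / 2, by norm_num, by norm_num, rfl⟩
  obtain ⟨c, hc, h⟩ := exists_support hT hi (hdisj _ hm)
  have h1 := h P (hsub (left_mem_segment ℝ P Q))
  have h2 := h Q (hsub (right_mem_segment ℝ P Q))
  rw [show P - (P + (1 / 2 : ℝ) • (Q - P)) = (-(1 / 2) : ℝ) • (Q - P) by module,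
    cross_smul_right] at h1
  rw [show Q - (P + (1 / 2 : ℝ) • (Q - P)) = ((1 / 2) : ℝ) • (Q - P) by module,
    cross_smul_right] at h2
  have h0 : cross c (Q - P) = 0 := by linarith
  obtain ⟨l, rfl⟩ := eq_smul_of_cross_eq_zero (sub_ne_zero.2 hPQ.symm) h0
  have hl : l ≠ 0 := by rintro rfl; simp at hc
  have key : ∀ w ∈ T, 0 ≤ l * cross (Q - P) (w - u) := fun w hw => by
    have := h w hw
    rw [cross_smul_left] at this
    have h3 := cross_eq_zero_of_mem_segment hm hu
    rw [show w - u = (w - (P + (1 / 2 : ℝ) • (Q - P))) + ((P + (1 / 2 : ℝ) • (Q - P)) - u) by ring,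
      cross_add_right, h3, add_zero]
    exact this
  rcases lt_or_gt_of_ne hl with hl | hl
  · right; intro w hw; have := key w hw; nlinarith
  · left; intro w hw; have := key w hw; exact nonneg_of_mul_nonneg_right this hl

/-- A segment is described by four linear inequalities. -/
lemma mem_segment_iff_ineq {P Q u : ℂ} (hPQ : P ≠ Q) :
    u ∈ segment ℝ P Q ↔ cross (Q - P) (u - P) = 0 ∧
      0 ≤ (Q - P).re * (u - P).re + (Q - P).im * (u - P).im ∧
      (Q - P).re * (u - P).re + (Q - P).im * (u - P).im ≤
        (Q - P).re * (Q - P).re + (Q - P).im * (Q - P).im := by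
  have hd : Q - P ≠ 0 := sub_ne_zero.2 hPQ.symm
  have hn := normSq_pos_of_ne hd
  constructor
  · intro hu
    refine ⟨cross_eq_zero_of_mem_segment hu (left_mem_segment ℝ P Q), ?_⟩
    obtain ⟨t, h0, h1, rfl⟩ := mem_segment_iff_smul.1 hu
    rw [add_sub_cancel_left]
    simp only [Complex.real_smul, Complex.re_ofReal_mul, Complex.im_ofReal_mul]
    constructor <;> nlinarith
  · rintro ⟨h0, h1, h2⟩
    rw [cross_comm, neg_eq_zero] at h0
    obtain ⟨t, ht⟩ := eq_smul_of_cross_eq_zero hd (by rw [cross_comm] at h0; rw [cross_comm, h0])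
    refine mem_segment_iff_smul.2 ⟨t, ?_, ?_, by rw [← ht]; ring⟩
    · rw [ht] at h1
      simp only [Complex.real_smul, Complex.re_ofReal_mul, Complex.im_ofReal_mul] at h1
      by_contra hneg
      push Not at hneg
      nlinarith
    · rw [ht] at h2
      simp only [Complex.real_smul, Complex.re_ofReal_mul, Complex.im_ofReal_mul] at h2
      by_contra hneg
      push Not at hneg
      nlinarith

lemma eq_or_eq_of_segment_eq {P Q P' Q' : ℂ} (h : segment ℝ P Q = segment ℝ P' Q') :
    P = P' ∨ P = Q' := by
  have hP : P ∈ segment ℝ P' Q' := h ▸ left_mem_segment ℝ P Q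
  have hP' : P' ∈ segment ℝ P Q := h ▸ left_mem_segment ℝ P' Q'
  have hQ' : Q' ∈ segment ℝ P Q := h ▸ right_mem_segment ℝ P' Q'
  rcases eq_or_ne P Q with rfl | hPQ
  · left; rw [segment_same] at hP'; exact (mem_singleton_iff.1 hP').symm
  obtain ⟨t, ht0, ht1, ht⟩ := mem_segment_iff_smul.1 hP
  obtain ⟨s, hs0, hs1, rfl⟩ := mem_segment_iff_smul.1 hP'
  obtain ⟨r, hr0, hr1, rfl⟩ := mem_segment_iff_smul.1 hQ'
  have h1 : ((1 - t) * s + t * r) • (Q - P) = 0 := by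
    rw [← sub_eq_zero] at ht
    rw [← neg_eq_zero, ← ht]
    module
  have h2 : (1 - t) * s + t * r = 0 :=
    (smul_eq_zero.1 h1).resolve_right (sub_ne_zero.2 hPQ.symm)
  have h3 : (1 - t) * s = 0 := by nlinarith [mul_nonneg (sub_nonneg.2 ht1) hs0, mul_nonneg ht0 hr0]
  have h4 : t * r = 0 := by linarith
  rcases mul_eq_zero.1 h4 with h4 | h4
  · left; subst h4; have : s = 0 := by linarith
    simp [this]
  · right; simp [h4]

/-- Two segments with different directions have at most one point in common. -/
lemma eq_of_mem_segments {P Q P' Q' u v : ℂ} (hc : cross (Q - P) (Q' - P') ≠ 0)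
    (hu : u ∈ segment ℝ P Q) (hv : v ∈ segment ℝ P Q)
    (hu' : u ∈ segment ℝ P' Q') (hv' : v ∈ segment ℝ P' Q') : u = v := by
  have h1 := cross_eq_zero_of_mem_segment hu hv
  have h2 := cross_eq_zero_of_mem_segment hu' hv'
  have hd : Q' - P' ≠ 0 := by rintro h; rw [h, cross_zero_right] at hc; exact hc rfl
  obtain ⟨l, hl⟩ := eq_smul_of_cross_eq_zero hd (by rw [cross_comm, h2, neg_zero])
  rw [hl, cross_smul_right] at h1
  rw [(mul_eq_zero.1 h1).resolve_right hc, zero_smul] at hl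
  exact sub_eq_zero.1 hl

/-! ### Faces of plane convex sets and of Minkowski sums -/

/-- The face of a compact convex set in the plane in a given direction is a segment (possibly a
single point), the ends of which are extreme points. -/
lemma exists_face_eq_segment {Ω : Set ℂ} (hc : IsCompact Ω) (hconv : Convex ℝ Ω) (hne : Ω.Nonempty)
    {c : ℂ} (h0 : c ≠ 0) :
    ∃ a ∈ extremePoints ℝ Ω, ∃ b ∈ extremePoints ℝ Ω, IsExposed ℝ Ω (segment ℝ a b) ∧
      ∀ z, z ∈ segment ℝ a b ↔ z ∈ Ω ∧ ∀ y ∈ Ω, 0 ≤ cross c (y - z) := by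
  set F := {z ∈ Ω | ∀ y ∈ Ω, -crossL c y ≤ -crossL c z} with hF
  have hFiff : ∀ z, z ∈ F ↔ z ∈ Ω ∧ ∀ y ∈ Ω, 0 ≤ cross c (y - z) := fun z => by
    simp only [hF, mem_ofPred_eq, crossL_apply, cross_sub_right, sub_nonneg, neg_le_neg_iff]
  have hexp : IsExposed ℝ Ω F := fun _ => ⟨-crossL c, rfl⟩
  have hFc : IsCompact F := hexp.isCompact hc
  have hFconv : Convex ℝ F := hexp.convex hconv
  have hFne : F.Nonempty := by
    obtain ⟨z, hz, hzmin⟩ := hc.exists_isMinOn hne (crossL c).continuous.continuousOn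
    exact ⟨z, hz, fun y hy => neg_le_neg (hzmin hy)⟩
  have hline : ∀ z ∈ F, ∀ w ∈ F, ∃ l : ℝ, w - z = l • c := fun z hz w hw => by
    apply eq_smul_of_cross_eq_zero h0
    have h1 := ((hFiff z).1 hz).2 w hw.1
    have h2 := ((hFiff w).1 hw).2 z hz.1
    rw [cross_sub_right] at h1 h2
    rw [cross_comm, cross_sub_right]
    linarith
  have hpos := cross_I_mul_pos h0
  set g := crossL (-(Complex.I * c)) with hg
  have hgc : 0 < g c := by
    rw [hg, crossL_apply, cross_neg_left, cross_comm, neg_neg]; exact hpos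
  obtain ⟨a, ha, hamin⟩ := hFc.exists_isMinOn hFne g.continuous.continuousOn
  obtain ⟨b, hb, hbmax⟩ := hFc.exists_isMaxOn hFne g.continuous.continuousOn
  have hinj : ∀ z ∈ F, ∀ w ∈ F, g z = g w → z = w := fun z hz w hw h => by
    obtain ⟨l, hl⟩ := hline z hz w hw
    have : g (w - z) = 0 := by rw [map_sub, h, sub_self]
    rw [hl, map_smul, smul_eq_mul] at this
    rw [(mul_eq_zero.1 this).resolve_right hgc.ne', zero_smul] at hl
    exact (sub_eq_zero.1 hl).symm
  have hext : ∀ e ∈ F, ((∀ y ∈ F, g y ≤ g e) ∨ ∀ y ∈ F, g e ≤ g y) → e ∈ extremePoints ℝ F := by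
    intro e he h
    rw [mem_extremePoints_iff_left]
    refine ⟨he, fun z hz w hw hew => ?_⟩
    obtain ⟨s, t, hs, ht, hst, rfl⟩ := hew
    apply hinj _ hz _ he
    rw [map_add, map_smul, map_smul, smul_eq_mul, smul_eq_mul] at *
    rcases h with h | h
    · have h1 := h z hz
      have h2 := h w hw
      have : s = 1 - t := by linarith
      subst this
      nlinarith
    · have h1 := h z hz
      have h2 := h w hw
      have : s = 1 - t := by linarith
      subst this
      nlinarith
  have hFseg : F = segment ℝ a b := by
    apply Subset.antisymm
    · intro z hz
      obtain ⟨l, hl⟩ := hline a ha z hz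
      obtain ⟨m, hm⟩ := hline a ha b hb
      have h1 : g (z - a) = l * g c := by rw [hl, map_smul, smul_eq_mul]
      have h2 : g (b - a) = m * g c := by rw [hm, map_smul, smul_eq_mul]
      rw [map_sub] at h1 h2
      have h3 : g a ≤ g z := hamin hz
      have h4 : g z ≤ g b := hbmax hz
      have hl0 : 0 ≤ l := by by_contra hneg; push Not at hneg; nlinarith
      have hlm : l ≤ m := by by_contra hneg; push Not at hneg; nlinarith
      rcases eq_or_lt_of_le (hl0.trans hlm) with hm0 | hm0
      · have : l = 0 := by linarith
        rw [this, zero_smul] at hl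
        rw [sub_eq_zero.1 hl]
        exact left_mem_segment ℝ a b
      · refine mem_segment_iff_smul.2 ⟨l / m, by positivity, (div_le_one hm0).2 hlm, ?_⟩
        rw [hm, smul_smul, div_mul_cancel₀ _ hm0.ne', ← hl]; ring
    · exact hFconv.segment_subset ha hb
  refine ⟨a, hexp.isExtreme.extremePoints_subset_extremePoints (hext a ha (Or.inr fun y hy => hamin hy)),
    b, hexp.isExtreme.extremePoints_subset_extremePoints (hext b hb (Or.inl fun y hy => hbmax hy)),
    hFseg ▸ hexp, fun z => by rw [← hFseg, hFiff]⟩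

/-- An interior point `u` of `A + B` lies between a point `a + b` with `b` interior to `B` and a
point of `A + B` slightly beyond `u`. -/
lemma interior_add_of_convex {A B : Set ℂ} (hA : Convex ℝ A) (hB : Convex ℝ B)
    (hAne : A.Nonempty) (hBi : (interior B).Nonempty) : interior (A + B) = A + interior B := by
  apply Subset.antisymm _ subset_interior_add_right
  intro u hu
  obtain ⟨a, ha⟩ := hAne
  obtain ⟨b, hb⟩ := hBi
  have hcont : Filter.Tendsto (fun s : ℝ => u + s • (u - (a + b))) (nhdsWithin 0 (Ioi 0))
      (nhds u) := by
    have : Continuous fun s : ℝ => u + s • (u - (a + b)) := by fun_prop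
    have h2 := this.tendsto 0
    simp only [zero_smul, add_zero] at h2
    exact h2.mono_left nhdsWithin_le_nhds
  obtain ⟨s, hs, hs0⟩ := ((hcont.eventually (mem_interior_iff_mem_nhds.1 hu)).and
    eventually_mem_nhdsWithin).exists
  have hs0 : 0 < s := hs0
  obtain ⟨a', ha', b', hb', hab⟩ := mem_add.1 hs
  have h1 : 0 < 1 + s := by linarith
  have e1 : 1 / (1 + s) + s / (1 + s) = 1 := by field_simp
  have hA' : (1 / (1 + s)) • a' + (s / (1 + s)) • a ∈ A := hA ha' ha (by positivity) (by positivity) e1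
  have hB' : (1 / (1 + s)) • b' + (s / (1 + s)) • b ∈ interior B :=
    hB.combo_self_interior_mem_interior hb' hb (by positivity) (by positivity) e1
  refine mem_add.2 ⟨_, hA', _, hB', ?_⟩
  have h2 : (1 + s) • u = (a' + b') + s • (a + b) := by rw [hab]; module
  have h3 : u = (1 / (1 + s)) • ((1 + s) • u) := by
    rw [smul_smul, one_div, inv_mul_cancel₀ h1.ne', one_smul]
  rw [h3, h2]
  module

/-! ### The hexagonal tiling -/

lemma rot_re (θ : ℝ) : (rot θ).re = Real.cos θ := by
  rw [rot, Complex.exp_ofReal_mul_I_re]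

lemma rot_im (θ : ℝ) : (rot θ).im = Real.sin θ := by
  rw [rot, Complex.exp_ofReal_mul_I_im]

lemma rot_add (θ φ : ℝ) : rot (θ + φ) = rot θ * rot φ := by
  rw [rot, rot, rot, ← Complex.exp_add]; push_cast; ring_nf

lemma rot_zero : rot 0 = 1 := by simp [rot]

lemma rot_ne_zero (θ : ℝ) : rot θ ≠ 0 := Complex.exp_ne_zero _

lemma norm_rot (θ : ℝ) : ‖rot θ‖ = 1 := Complex.norm_exp_ofReal_mul_I θ

lemma normSq_rot (θ : ℝ) : Complex.normSq (rot θ) = 1 := by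
  rw [Complex.normSq_eq_norm_sq, norm_rot, one_pow]

lemma rot_pi_add (θ : ℝ) : rot (Real.pi + θ) = -rot θ := by
  rw [rot_add]
  simp [rot, Complex.exp_pi_mul_I]

@[fun_prop]
lemma continuous_rot : Continuous rot := by unfold rot; fun_prop

lemma rot_pi_div_three : rot (Real.pi / 3) = ⟨1 / 2, Real.sqrt 3 / 2⟩ := by
  apply Complex.ext
  · rw [rot_re, Real.cos_pi_div_three]
  · rw [rot_im, Real.sin_pi_div_three]

lemma sqrt_three_mul_self : Real.sqrt 3 * Real.sqrt 3 = 3 := Real.mul_self_sqrt (by norm_num)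

lemma sqrt_three_pos : 0 < Real.sqrt 3 := Real.sqrt_pos.2 (by norm_num)

lemma hexVertex_succ (k : ℤ) : hexVertex (k + 1) = rot (Real.pi / 3) * hexVertex k := by
  rw [hexVertex, hexVertex, ← rot_add]; push_cast; ring_nf

lemma hexVertex_add_two (k : ℤ) : hexVertex k + hexVertex (k + 2) = hexVertex (k + 1) := by
  rw [show k + 2 = k + 1 + 1 by ring, hexVertex_succ, hexVertex_succ, rot_pi_div_three]
  have := sqrt_three_mul_self
  apply Complex.ext
  · simp only [Complex.add_re, Complex.mul_re, Complex.mul_im]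
    linear_combination (-(hexVertex k).re / 4) * this
  · simp only [Complex.add_im, Complex.mul_re, Complex.mul_im]
    linear_combination (-(hexVertex k).im / 4) * this

lemma hexVertex_add_three (k : ℤ) : hexVertex (k + 3) = -hexVertex k := by
  have h1 := hexVertex_add_two k
  have h2 := hexVertex_add_two (k + 1)
  rw [show k + 1 + 2 = k + 3 by ring, show k + 1 + 1 = k + 2 by ring, ← h1] at h2
  linear_combination h2

lemma hexVertex_add_six (k : ℤ) : hexVertex (k + 6) = hexVertex k := by
  rw [show k + 6 = k + 3 + 3 by ring, hexVertex_add_three, hexVertex_add_three, neg_neg]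

lemma hexVertex_add_mul_six (k q : ℤ) : hexVertex (k + q * 6) = hexVertex k := by
  induction q using Int.induction_on with
  | zero => simp
  | succ i ih => rw [← ih, show k + ((i : ℤ) + 1) * 6 = k + i * 6 + 6 by ring, hexVertex_add_six]
  | pred i ih =>
    rw [← ih, show k + -(i : ℤ) * 6 = k + (-(i : ℤ) - 1) * 6 + 6 by ring, hexVertex_add_six]

lemma hexVertex_emod_six (k : ℤ) : hexVertex (k % 6) = hexVertex k := by
  conv_rhs => rw [← Int.emod_add_mul_ediv k 6, mul_comm, hexVertex_add_mul_six]

lemma hexVertex_zero : hexVertex 0 = Complex.I := by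
  simp [hexVertex, rot, Complex.exp_pi_div_two_mul_I]

lemma hexVertex_one : hexVertex 1 = ⟨-(Real.sqrt 3 / 2), 1 / 2⟩ := by
  have := hexVertex_succ 0
  rw [zero_add, hexVertex_zero, rot_pi_div_three] at this
  rw [this]; apply Complex.ext <;> simp

lemma hexVertex_two : hexVertex 2 = ⟨-(Real.sqrt 3 / 2), -(1 / 2)⟩ := by
  have := hexVertex_add_two 0
  simp only [zero_add] at this
  rw [← eq_sub_iff_add_eq', hexVertex_zero, hexVertex_one] at this
  rw [this]; apply Complex.ext <;> simp; norm_num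

lemma hexVertex_three : hexVertex 3 = -Complex.I := by
  have := hexVertex_add_three 0
  rwa [zero_add, hexVertex_zero] at this

lemma hexVertex_ne_succ (k : ℤ) : hexVertex k ≠ hexVertex (k + 1) := by
  intro h
  have h1 := hexVertex_add_two k
  rw [h, add_eq_left] at h1
  exact rot_ne_zero _ h1

lemma hexVertex_mem_hexagon (k : ℤ) : hexVertex k ∈ hexagon :=
  subset_convexHull ℝ _ (mem_range_self k)

lemma convex_hexagon : Convex ℝ hexagon := convex_convexHull ℝ _

lemma neg_mem_hexagon {z : ℂ} (hz : z ∈ hexagon) : -z ∈ hexagon := by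
  have : -range hexVertex = range hexVertex := by
    ext w
    simp only [mem_neg, mem_range]
    constructor
    · rintro ⟨k, hk⟩; exact ⟨k + 3, by rw [hexVertex_add_three, hk, neg_neg]⟩
    · rintro ⟨k, hk⟩; exact ⟨k + 3, by rw [hexVertex_add_three, hk]⟩
  rw [hexagon, ← this, convexHull_neg]
  simpa [hexagon] using hz

lemma zero_mem_hexagon : (0 : ℂ) ∈ hexagon := by
  have h := convex_hexagon (hexVertex_mem_hexagon 0) (neg_mem_hexagon (hexVertex_mem_hexagon 0))
    (by norm_num : (0 : ℝ) ≤ 1 / 2) (by norm_num : (0 : ℝ) ≤ 1 / 2) (by norm_num)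
  simpa using h

/-- The hexagon contains the six triangles that join its edges to the centre. -/
lemma smul_add_smul_mem_hexagon (k : ℤ) {s t : ℝ} (hs : 0 ≤ s) (ht : 0 ≤ t) (hst : s + t ≤ 1) :
    s • hexVertex k + t • hexVertex (k + 1) ∈ hexagon := by
  have := convex_hexagon.sum_mem (t := Finset.univ) (w := ![s, t, 1 - s - t])
    (z := ![hexVertex k, hexVertex (k + 1), 0])
    (by
      intro i _
      fin_cases i
      · exact hs
      · exact ht
      · simp; linarith)
    (by simp [Fin.sum_univ_three])
    (by
      intro i _
      fin_cases i
      · exact hexVertex_mem_hexagon k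
      · exact hexVertex_mem_hexagon (k + 1)
      · exact zero_mem_hexagon)
  simpa [Fin.sum_univ_three] using this

/-- The hexagon is the intersection of three strips. -/
lemma mem_hexagon_iff {z : ℂ} : z ∈ hexagon ↔
    |z.re| ≤ Real.sqrt 3 / 2 ∧ |z.re + Real.sqrt 3 * z.im| ≤ Real.sqrt 3 ∧
      |z.re - Real.sqrt 3 * z.im| ≤ Real.sqrt 3 := by
  have h3 := sqrt_three_mul_self
  have hp := sqrt_three_pos
  set r := Real.sqrt 3 with hr
  constructor
  · intro hz
    have hconv : Convex ℝ {z : ℂ | |z.re| ≤ r / 2 ∧ |z.re + r * z.im| ≤ r ∧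
        |z.re - r * z.im| ≤ r} := by
      intro z hz w hw s t hs ht hst
      simp only [mem_ofPred_eq, abs_le, Complex.add_re, Complex.add_im, Complex.real_smul,
        Complex.re_ofReal_mul, Complex.im_ofReal_mul] at *
      obtain rfl : s = 1 - t := by linarith
      refine ⟨⟨?_, ?_⟩, ⟨?_, ?_⟩, ?_, ?_⟩ <;> nlinarith
    refine convexHull_min ?_ hconv hz
    have hneg : ∀ z : ℂ, (|z.re| ≤ r / 2 ∧ |z.re + r * z.im| ≤ r ∧ |z.re - r * z.im| ≤ r) →
        (|(-z).re| ≤ r / 2 ∧ |(-z).re + r * (-z).im| ≤ r ∧ |(-z).re - r * (-z).im| ≤ r) := by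
      intro z hz
      simp only [abs_le, Complex.neg_re, Complex.neg_im] at *
      refine ⟨⟨?_, ?_⟩, ⟨?_, ?_⟩, ?_, ?_⟩ <;> linarith [hz.1.1, hz.1.2, hz.2.1.1, hz.2.1.2, hz.2.2.1, hz.2.2.2]
    have hzero : |(hexVertex 0).re| ≤ r / 2 ∧ |(hexVertex 0).re + r * (hexVertex 0).im| ≤ r ∧
        |(hexVertex 0).re - r * (hexVertex 0).im| ≤ r := by
      simp only [hexVertex_zero, abs_le, Complex.I_re, Complex.I_im]
      refine ⟨⟨?_, ?_⟩, ⟨?_, ?_⟩, ?_, ?_⟩ <;> linarith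
    have hone : |(hexVertex 1).re| ≤ r / 2 ∧ |(hexVertex 1).re + r * (hexVertex 1).im| ≤ r ∧
        |(hexVertex 1).re - r * (hexVertex 1).im| ≤ r := by
      simp only [hexVertex_one, abs_le]
      refine ⟨⟨?_, ?_⟩, ⟨?_, ?_⟩, ?_, ?_⟩ <;> linarith
    have htwo : |(hexVertex 2).re| ≤ r / 2 ∧ |(hexVertex 2).re + r * (hexVertex 2).im| ≤ r ∧
        |(hexVertex 2).re - r * (hexVertex 2).im| ≤ r := by
      simp only [hexVertex_two, abs_le]
      refine ⟨⟨?_, ?_⟩, ⟨?_, ?_⟩, ?_, ?_⟩ <;> linarith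
    rintro _ ⟨k, rfl⟩
    simp only [mem_ofPred_eq]
    rw [← hexVertex_emod_six k]
    have hk0 := Int.emod_nonneg k (by norm_num : (6 : ℤ) ≠ 0)
    have hk6 := Int.emod_lt_of_pos k (by norm_num : (0 : ℤ) < 6)
    generalize k % 6 = j at hk0 hk6
    interval_cases j
    · exact hzero
    · exact hone
    · exact htwo
    · exact hexVertex_add_three 0 ▸ hneg _ hzero
    · exact hexVertex_add_three 1 ▸ hneg _ hone
    · exact hexVertex_add_three 2 ▸ hneg _ htwo
  · -- the half with `re z ≤ 0` consists of three of the six triangles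
    have main : ∀ z : ℂ, z.re ≤ 0 → (|z.re| ≤ r / 2 ∧ |z.re + r * z.im| ≤ r ∧
        |z.re - r * z.im| ≤ r) → z ∈ hexagon := by
      rintro ⟨x, y⟩ hx ⟨h1, h2, h4⟩
      simp only [abs_le] at hx h1 h2 h4
      by_cases c1 : 0 ≤ y + r * x / 3
      · have := smul_add_smul_mem_hexagon 0 (s := y + r * x / 3) (t := -(2 * r * x / 3)) c1
          (by nlinarith) (by nlinarith [h4.1])
        convert this using 1
        rw [zero_add, hexVertex_zero, hexVertex_one]
        apply Complex.ext
        · simp [← hr]; linear_combination (-x / 3) * h3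
        · simp; ring
      · by_cases c2 : y - r * x / 3 ≤ 0
        · have := smul_add_smul_mem_hexagon 2 (s := -(2 * r * x / 3)) (t := -y + r * x / 3)
            (by nlinarith) (by linarith) (by nlinarith [h2.1])
          convert this using 1
          rw [show (2 : ℤ) + 1 = 3 by norm_num, hexVertex_three, hexVertex_two]
          apply Complex.ext
          · simp [← hr]; linear_combination (-x / 3) * h3
          · simp; ring
        · have := smul_add_smul_mem_hexagon 1 (s := y - r * x / 3) (t := -y - r * x / 3)
            (by linarith) (by linarith) (by nlinarith [h1.1])
          convert this using 1
          rw [show (1 : ℤ) + 1 = 2 by norm_num, hexVertex_one, hexVertex_two]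
          apply Complex.ext
          · simp [← hr]; linear_combination (-x / 3) * h3
          · simp; ring
    rintro ⟨h1, h2, h4⟩
    rcases le_total z.re 0 with hx | hx
    · exact main z hx ⟨h1, h2, h4⟩
    · rw [← neg_neg z]
      apply neg_mem_hexagon
      apply main
      · simpa using hx
      · simp only [abs_le, Complex.neg_re, Complex.neg_im] at *
        refine ⟨⟨?_, ?_⟩, ⟨?_, ?_⟩, ?_, ?_⟩ <;> linarith [h1.1, h1.2, h2.1, h2.2, h4.1, h4.2]

lemma isClosed_hexagon : IsClosed hexagon := by
  have : hexagon = {z : ℂ | |z.re| ≤ Real.sqrt 3 / 2 ∧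
      |z.re + Real.sqrt 3 * z.im| ≤ Real.sqrt 3 ∧ |z.re - Real.sqrt 3 * z.im| ≤ Real.sqrt 3} := by
    ext z; exact mem_hexagon_iff
  rw [this]
  have h1 : IsClosed {z : ℂ | |z.re| ≤ Real.sqrt 3 / 2} := isClosed_le (by fun_prop) (by fun_prop)
  have h2 : IsClosed {z : ℂ | |z.re + Real.sqrt 3 * z.im| ≤ Real.sqrt 3} :=
    isClosed_le (by fun_prop) (by fun_prop)
  have h3 : IsClosed {z : ℂ | |z.re - Real.sqrt 3 * z.im| ≤ Real.sqrt 3} :=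
    isClosed_le (by fun_prop) (by fun_prop)
  exact h1.inter (h2.inter h3)

lemma mem_interior_hexagon_iff {z : ℂ} : z ∈ interior hexagon ↔
    |z.re| < Real.sqrt 3 / 2 ∧ |z.re + Real.sqrt 3 * z.im| < Real.sqrt 3 ∧
      |z.re - Real.sqrt 3 * z.im| < Real.sqrt 3 := by
  have hp := sqrt_three_pos
  constructor
  · intro hz
    have hcont : Filter.Tendsto (fun s : ℝ => (1 + s) • z) (nhdsWithin 0 (Ioi 0)) (nhds z) := by
      have : Continuous fun s : ℝ => (1 + s) • z := by fun_prop
      have h2 := this.tendsto 0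
      simp only [add_zero, one_smul] at h2
      exact h2.mono_left nhdsWithin_le_nhds
    obtain ⟨s, hs, hs0⟩ := ((hcont.eventually (mem_interior_iff_mem_nhds.1 hz)).and
      eventually_mem_nhdsWithin).exists
    have hs0 : 0 < s := hs0
    obtain ⟨h1, h2, h3⟩ := mem_hexagon_iff.1 hs
    simp only [Complex.real_smul, Complex.re_ofReal_mul, Complex.im_ofReal_mul] at h1 h2 h3
    rw [show (1 + s) * z.re + Real.sqrt 3 * ((1 + s) * z.im) =
      (1 + s) * (z.re + Real.sqrt 3 * z.im) by ring] at h2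
    rw [show (1 + s) * z.re - Real.sqrt 3 * ((1 + s) * z.im) =
      (1 + s) * (z.re - Real.sqrt 3 * z.im) by ring] at h3
    have key : ∀ a b : ℝ, 0 < b → |(1 + s) * a| ≤ b → |a| < b := fun a b hb h => by
      rw [abs_mul, abs_of_pos (by linarith : 0 < 1 + s)] at h
      by_contra hc
      push Not at hc
      nlinarith
    exact ⟨key _ _ (by linarith) h1, key _ _ hp h2, key _ _ hp h3⟩
  · rintro ⟨h1, h2, h3⟩
    have o1 : IsOpen {z : ℂ | |z.re| < Real.sqrt 3 / 2} := isOpen_lt (by fun_prop) (by fun_prop)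
    have o2 : IsOpen {z : ℂ | |z.re + Real.sqrt 3 * z.im| < Real.sqrt 3} :=
      isOpen_lt (by fun_prop) (by fun_prop)
    have o3 : IsOpen {z : ℂ | |z.re - Real.sqrt 3 * z.im| < Real.sqrt 3} :=
      isOpen_lt (by fun_prop) (by fun_prop)
    refine mem_interior.2 ⟨_, fun w hw => ?_, o1.inter (o2.inter o3), ⟨h1, h2, h3⟩⟩
    exact mem_hexagon_iff.2 ⟨le_of_lt hw.1, le_of_lt hw.2.1, le_of_lt hw.2.2⟩

/-- The inradius of the hexagon is `√3 / 2`, which is more than `1 / 2`. -/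
lemma mem_interior_hexagon_of_norm {z : ℂ} (hz : ‖z‖ ≤ 1 / 2) : z ∈ interior hexagon := by
  have h3 := sqrt_three_mul_self
  have hp := sqrt_three_pos
  have h1 : 1 < Real.sqrt 3 := by nlinarith
  have h2 : Real.sqrt 3 < 2 := by nlinarith
  have hn : z.re * z.re + z.im * z.im ≤ 1 / 4 := by
    rw [← Complex.normSq_apply, Complex.normSq_eq_norm_sq]
    nlinarith [norm_nonneg z]
  rw [mem_interior_hexagon_iff]
  simp only [abs_lt]
  have a1 : |z.re| ≤ 1 / 2 := (Complex.abs_re_le_norm z).trans hz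
  rw [abs_le] at a1
  have b1 : |z.re + Real.sqrt 3 * z.im| ≤ 1 := by
    apply abs_le_of_sq_le_sq _ zero_le_one
    nlinarith [sq_nonneg (Real.sqrt 3 * z.re - z.im)]
  have b2 : |z.re - Real.sqrt 3 * z.im| ≤ 1 := by
    apply abs_le_of_sq_le_sq _ zero_le_one
    nlinarith [sq_nonneg (Real.sqrt 3 * z.re + z.im)]
  rw [abs_le] at b1 b2
  refine ⟨⟨?_, ?_⟩, ⟨?_, ?_⟩, ?_, ?_⟩ <;> linarith [b1.1, b1.2, b2.1, b2.2, a1.1, a1.2]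

lemma zero_mem_interior_hexagon : (0 : ℂ) ∈ interior hexagon :=
  mem_interior_hexagon_of_norm (by simp)

lemma interior_hexagon_nonempty : (interior hexagon).Nonempty := ⟨0, zero_mem_interior_hexagon⟩

lemma hexagon_subset_closedBall : hexagon ⊆ Metric.closedBall 0 1 := by
  refine convexHull_min ?_ (convex_closedBall 0 1)
  rintro _ ⟨k, rfl⟩
  simp [hexVertex, norm_rot]

lemma isCompact_hexagon : IsCompact hexagon :=
  (isCompact_closedBall (0 : ℂ) 1).of_isClosed_subset isClosed_hexagon hexagon_subset_closedBall

/-- The faces of the hexagon are its vertices and its edges. -/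
lemma exists_hexagon_face {c : ℂ} (hc : c ≠ 0) : ∃ i j : ℤ, (j = i ∨ j = i + 1) ∧
    ∀ z, z ∈ segment ℝ (hexVertex i) (hexVertex j) ↔
      z ∈ hexagon ∧ ∀ y ∈ hexagon, 0 ≤ cross c (y - z) := by
  obtain ⟨a, ha, b, hb, -, hF⟩ := exists_face_eq_segment isCompact_hexagon convex_hexagon
    ⟨0, zero_mem_hexagon⟩ hc
  obtain ⟨i, rfl⟩ := extremePoints_convexHull_subset ha
  obtain ⟨j, rfl⟩ := extremePoints_convexHull_subset hb
  have hi := (hF _).1 (left_mem_segment ℝ _ _)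
  have hj := (hF _).1 (right_mem_segment ℝ _ _)
  simp only [cross_sub_right, sub_nonneg] at hi hj
  have hij : cross c (hexVertex i) = cross c (hexVertex j) := le_antisymm (hi.2 _ hj.1) (hj.2 _ hi.1)
  -- the interior point `0` is not on the face
  have hneg : cross c (hexVertex i) < 0 := by
    by_contra hcon
    push Not at hcon
    refine notMem_interior_of_support (u := 0) (v := 0) hc (fun w hw => ?_)
      (by simp [cross]) zero_mem_interior_hexagon
    rw [sub_zero]; exact hcon.trans (hi.2 w hw)
  -- nor can it contain two vertices at distance two, as their sum is the vertex between them
  have hno : ∀ k : ℤ, cross c (hexVertex k) = cross c (hexVertex i) →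
      cross c (hexVertex (k + 2)) = cross c (hexVertex i) → False := fun k h1 h2 => by
    have h3 := hi.2 _ (hexVertex_mem_hexagon (k + 1))
    rw [← hexVertex_add_two, cross_add_right] at h3
    linarith
  have hr : hexVertex j = hexVertex (i + (j - i) % 6) := by
    rw [← hexVertex_add_mul_six (i + (j - i) % 6) ((j - i) / 6)]
    congr 1
    have := Int.emod_add_mul_ediv (j - i) 6
    linarith
  have hk0 := Int.emod_nonneg (j - i) (by norm_num : (6 : ℤ) ≠ 0)
  have hk6 := Int.emod_lt_of_pos (j - i) (by norm_num : (0 : ℤ) < 6)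
  generalize (j - i) % 6 = r at hr hk0 hk6
  rw [hr] at hij hF
  interval_cases r
  · exact ⟨i, i, Or.inl rfl, by simpa using hF⟩
  · exact ⟨i, i + 1, Or.inr rfl, hF⟩
  · exact (hno i rfl hij.symm).elim
  · rw [hexVertex_add_three, cross_neg_right] at hij
    linarith
  · refine (hno (i + 4) hij.symm ?_).elim
    rw [show i + 4 + 2 = i + 6 by ring, hexVertex_add_six]
  · refine ⟨i + 5, i + 5 + 1, Or.inr rfl, ?_⟩
    rw [show i + 5 + 1 = i + 6 by ring, hexVertex_add_six]
    simpa only [segment_symm] using hF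

lemma exists_mem_hexEdge {u : ℂ} (hu : u ∈ hexagon) (hi : u ∉ interior hexagon) :
    ∃ k, u ∈ hexEdge k := by
  obtain ⟨c, hc, h⟩ := exists_support convex_hexagon interior_hexagon_nonempty hi
  obtain ⟨i, j, hij, hF⟩ := exists_hexagon_face hc
  have := (hF u).2 ⟨hu, h⟩
  rcases hij with rfl | rfl
  · rw [segment_same] at this
    exact ⟨j, (mem_singleton_iff.1 this) ▸ left_mem_segment ℝ _ _⟩
  · exact ⟨i, this⟩

lemma hexEdge_subset_hexagon (k : ℤ) : hexEdge k ⊆ hexagon :=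
  convex_hexagon.segment_subset (hexVertex_mem_hexagon _) (hexVertex_mem_hexagon _)

/-- Adjacent edges of the hexagon are not parallel. -/
lemma cross_hexEdge_ne_zero (k : ℤ) :
    cross (hexVertex (k + 1) - hexVertex k) (hexVertex (k + 1 + 1) - hexVertex (k + 1)) ≠ 0 := by
  have h : hexVertex (k + 1 + 1) - hexVertex (k + 1) =
      rot (Real.pi / 3) * (hexVertex (k + 1) - hexVertex k) := by
    rw [hexVertex_succ (k + 1), hexVertex_succ k]; ring
  have hn := normSq_pos_of_ne (sub_ne_zero.2 (hexVertex_ne_succ k).symm)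
  have hp := sqrt_three_pos
  rw [h, rot_pi_div_three]
  simp only [cross, Complex.mul_re, Complex.mul_im]
  nlinarith [mul_pos hp hn]

lemma mem_hexCell {x z : ℂ} : z ∈ hexCell x ↔ z - x ∈ hexagon := by
  rw [hexCell, singleton_add]
  constructor
  · rintro ⟨w, hw, rfl⟩; simpa using hw
  · intro h; exact ⟨z - x, h, by simp⟩

lemma mem_interior_hexCell {x z : ℂ} : z ∈ interior (hexCell x) ↔ z - x ∈ interior hexagon := by
  have h : hexCell x = (Homeomorph.subRight x) ⁻¹' hexagon := by
    ext w; rw [mem_hexCell]; rfl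
  rw [h, ← Homeomorph.preimage_interior]; rfl

lemma isClosed_hexCell (x : ℂ) : IsClosed (hexCell x) := by
  have h : hexCell x = (fun z => z - x) ⁻¹' hexagon := by
    ext w; rw [mem_hexCell]; rfl
  rw [h]; exact isClosed_hexagon.preimage (by fun_prop)

lemma convex_hexCell (x : ℂ) : Convex ℝ (hexCell x) := (convex_singleton x).add convex_hexagon

lemma interior_hexCell_nonempty (x : ℂ) : (interior (hexCell x)).Nonempty :=
  ⟨x, by rw [mem_interior_hexCell, sub_self]; exact zero_mem_interior_hexagon⟩

/-- The point with coordinates `s, t` with respect to the basis of the lattice. -/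
noncomputable def latticeCoord (s t : ℝ) : ℂ := ⟨Real.sqrt 3 * (s + t / 2), 3 / 2 * t⟩

lemma latticePoint_eq (m n : ℤ) : latticePoint m n = latticeCoord m n := by
  apply Complex.ext
  · simp [latticePoint, latticeCoord]; ring
  · simp [latticePoint, latticeCoord]; ring

lemma exists_eq_latticeCoord (z : ℂ) : ∃ s t, z = latticeCoord s t := by
  have hp := sqrt_three_pos
  refine ⟨z.re / Real.sqrt 3 - z.im / 3, 2 * z.im / 3, ?_⟩
  apply Complex.ext
  · simp only [latticeCoord]; field_simp; ring
  · simp only [latticeCoord]; ring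

lemma latticeCoord_sub (s t s' t' : ℝ) :
    latticeCoord s t - latticeCoord s' t' = latticeCoord (s - s') (t - t') := by
  apply Complex.ext <;> simp [latticeCoord] <;> ring

/-- The rotation by `π / 3` in lattice coordinates. -/
lemma rot_mul_latticeCoord (s t : ℝ) :
    rot (Real.pi / 3) * latticeCoord s t = latticeCoord (-t) (s + t) := by
  have h3 := sqrt_three_mul_self
  rw [rot_pi_div_three]
  apply Complex.ext
  · simp [latticeCoord]; ring
  · simp [latticeCoord]; linear_combination ((s + t / 2) / 2) * h3

lemma latticeCoord_mem_hexagon {s t : ℝ} :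
    latticeCoord s t ∈ hexagon ↔ |2 * s + t| ≤ 1 ∧ |s + 2 * t| ≤ 1 ∧ |s - t| ≤ 1 := by
  have hp := sqrt_three_pos
  rw [mem_hexagon_iff]
  simp only [latticeCoord]
  rw [show Real.sqrt 3 * (s + t / 2) = Real.sqrt 3 / 2 * (2 * s + t) by ring,
    show Real.sqrt 3 / 2 * (2 * s + t) + Real.sqrt 3 * (3 / 2 * t) = Real.sqrt 3 * (s + 2 * t) by ring,
    show Real.sqrt 3 / 2 * (2 * s + t) - Real.sqrt 3 * (3 / 2 * t) = Real.sqrt 3 * (s - t) by ring,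
    abs_mul, abs_mul, abs_mul, abs_of_pos hp, abs_of_pos (half_pos hp),
    mul_le_iff_le_one_right hp, mul_le_iff_le_one_right hp, mul_le_iff_le_one_right (half_pos hp)]

lemma latticeCoord_mem_interior_hexagon {s t : ℝ} : latticeCoord s t ∈ interior hexagon ↔
    |2 * s + t| < 1 ∧ |s + 2 * t| < 1 ∧ |s - t| < 1 := by
  have hp := sqrt_three_pos
  rw [mem_interior_hexagon_iff]
  simp only [latticeCoord]
  rw [show Real.sqrt 3 * (s + t / 2) = Real.sqrt 3 / 2 * (2 * s + t) by ring,
    show Real.sqrt 3 / 2 * (2 * s + t) + Real.sqrt 3 * (3 / 2 * t) = Real.sqrt 3 * (s + 2 * t) by ring,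
    show Real.sqrt 3 / 2 * (2 * s + t) - Real.sqrt 3 * (3 / 2 * t) = Real.sqrt 3 * (s - t) by ring,
    abs_mul, abs_mul, abs_mul, abs_of_pos hp, abs_of_pos (half_pos hp),
    mul_lt_iff_lt_one_right hp, mul_lt_iff_lt_one_right hp, mul_lt_iff_lt_one_right (half_pos hp)]

/-- The cells cover the plane. -/
lemma exists_lattice_sub_mem_hexagon (u : ℂ) : ∃ x ∈ lattice, u - x ∈ hexagon := by
  obtain ⟨s, t, rfl⟩ := exists_eq_latticeCoord u
  -- the four corners of the fundamental parallelogram of `u`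
  suffices h : ∃ m n : ℤ, |2 * (s - m) + (t - n)| ≤ 1 ∧ |(s - m) + 2 * (t - n)| ≤ 1 ∧
      |(s - m) - (t - n)| ≤ 1 by
    obtain ⟨m, n, h⟩ := h
    refine ⟨latticePoint m n, ⟨m, n, rfl⟩, ?_⟩
    rw [latticePoint_eq, latticeCoord_sub, latticeCoord_mem_hexagon]
    exact h
  have s0 := Int.floor_le s
  have s1 := Int.lt_floor_add_one s
  have t0 := Int.floor_le t
  have t1 := Int.lt_floor_add_one t
  set m := ⌊s⌋
  set n := ⌊t⌋
  simp only [abs_le]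
  rcases le_total (t - n) (s - m) with hst | hst
  · by_cases c1 : 2 * (s - m) + (t - n) ≤ 1
    · exact ⟨m, n, ⟨by linarith, by linarith⟩, ⟨by linarith, by linarith⟩, by linarith, by linarith⟩
    · push Not at c1
      by_cases c2 : (s - m) + 2 * (t - n) ≤ 2
      · refine ⟨m + 1, n, ?_⟩
        push_cast
        exact ⟨⟨by linarith, by linarith⟩, ⟨by linarith, by linarith⟩, by linarith, by linarith⟩
      · push Not at c2
        refine ⟨m + 1, n + 1, ?_⟩
        push_cast
        exact ⟨⟨by linarith, by linarith⟩, ⟨by linarith, by linarith⟩, by linarith, by linarith⟩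
  · by_cases c1 : (s - m) + 2 * (t - n) ≤ 1
    · exact ⟨m, n, ⟨by linarith, by linarith⟩, ⟨by linarith, by linarith⟩, by linarith, by linarith⟩
    · push Not at c1
      by_cases c2 : 2 * (s - m) + (t - n) ≤ 2
      · refine ⟨m, n + 1, ?_⟩
        push_cast
        exact ⟨⟨by linarith, by linarith⟩, ⟨by linarith, by linarith⟩, by linarith, by linarith⟩
      · push Not at c2
        refine ⟨m + 1, n + 1, ?_⟩
        push_cast
        exact ⟨⟨by linarith, by linarith⟩, ⟨by linarith, by linarith⟩, by linarith, by linarith⟩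

lemma sub_mem_lattice {x y : ℂ} (hx : x ∈ lattice) (hy : y ∈ lattice) : x - y ∈ lattice := by
  obtain ⟨m, n, rfl⟩ := hx
  obtain ⟨m', n', rfl⟩ := hy
  refine ⟨m - m', n - n', ?_⟩
  simp only [latticePoint]; push_cast; ring

lemma zero_mem_lattice : (0 : ℂ) ∈ lattice := ⟨0, 0, by simp [latticePoint]⟩

lemma add_mem_lattice {x y : ℂ} (hx : x ∈ lattice) (hy : y ∈ lattice) : x + y ∈ lattice := by
  have := sub_mem_lattice hx (sub_mem_lattice zero_mem_lattice hy)
  simpa using this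

/-- The interior of a cell does not meet any other cell: if `(m, n)` are the lattice coordinates of the
difference of the centres then `2m + n`, `m + 2n` and `m - n` are less than `2` in absolute value,
so that `m = n = 0`. -/
lemma eq_of_mem_hexCell {x y z : ℂ} (hx : x ∈ lattice) (hy : y ∈ lattice)
    (hzx : z ∈ interior (hexCell x)) (hzy : z ∈ hexCell y) : x = y := by
  rw [mem_interior_hexCell] at hzx
  rw [mem_hexCell] at hzy
  obtain ⟨m, n, hmn⟩ := sub_mem_lattice hy hx
  obtain ⟨s, t, hst⟩ := exists_eq_latticeCoord (z - x)
  rw [show z - y = (z - x) - (y - x) by ring, hst, hmn, latticePoint_eq, latticeCoord_sub,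
    latticeCoord_mem_hexagon] at hzy
  rw [hst, latticeCoord_mem_interior_hexagon] at hzx
  simp only [abs_le] at hzy
  simp only [abs_lt] at hzx
  obtain ⟨⟨a1, a2⟩, ⟨b1, b2⟩, c1, c2⟩ := hzx
  obtain ⟨⟨a1', a2'⟩, ⟨b1', b2'⟩, c1', c2'⟩ := hzy
  have e1 : 2 * m + n < 2 := by exact_mod_cast (by linarith : (2 * m + n : ℝ) < 2)
  have e2 : -2 < 2 * m + n := by exact_mod_cast (by linarith : (-2 : ℝ) < 2 * m + n)
  have e3 : m + 2 * n < 2 := by exact_mod_cast (by linarith : (m + 2 * n : ℝ) < 2)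
  have e4 : -2 < m + 2 * n := by exact_mod_cast (by linarith : (-2 : ℝ) < m + 2 * n)
  have e5 : m - n < 2 := by exact_mod_cast (by linarith : (m - n : ℝ) < 2)
  have e6 : -2 < m - n := by exact_mod_cast (by linarith : (-2 : ℝ) < m - n)
  obtain ⟨rfl, rfl⟩ : m = 0 ∧ n = 0 := by omega
  simp only [latticePoint, Int.cast_zero, zero_mul, add_zero] at hmn
  exact (sub_eq_zero.1 hmn).symm

lemma finite_lattice_inter (C : ℝ) : {x ∈ lattice | |x.re| ≤ C ∧ |x.im| ≤ C}.Finite := by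
  have hfin : ((fun p : ℤ × ℤ => latticePoint p.1 p.2) ''
      (Icc (-⌈2 * C⌉) ⌈2 * C⌉ ×ˢ Icc (-⌈C⌉) ⌈C⌉)).Finite :=
    ((finite_Icc _ _).prod (finite_Icc _ _)).image _
  refine hfin.subset ?_
  rintro _ ⟨⟨m, n, rfl⟩, h1, h2⟩
  refine ⟨(m, n), ?_, rfl⟩
  have h3 := sqrt_three_mul_self
  have hp := sqrt_three_pos
  rw [latticePoint_eq] at h1 h2
  simp only [latticeCoord] at h1 h2
  have hC : 0 ≤ C := (abs_nonneg _).trans h1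
  have hs : 1 ≤ Real.sqrt 3 := by nlinarith
  rw [abs_le] at h2
  have hn : |(n : ℝ)| ≤ C := by rw [abs_le]; constructor <;> nlinarith [h2.1, h2.2]
  have hmn : |(m + n / 2 : ℝ)| ≤ C := by
    rw [abs_mul, abs_of_pos hp] at h1
    nlinarith [abs_nonneg (m + n / 2 : ℝ)]
  rw [abs_le] at hn hmn
  have k1 := Int.le_ceil (2 * C)
  have k2 := Int.le_ceil C
  refine ⟨⟨?_, ?_⟩, ?_, ?_⟩
  · exact_mod_cast (by push_cast; linarith [hmn.1, hn.2] : ((-⌈2 * C⌉ : ℤ) : ℝ) ≤ m)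
  · exact_mod_cast (by linarith [hmn.2, hn.1] : (m : ℝ) ≤ ⌈2 * C⌉)
  · exact_mod_cast (by push_cast; linarith [hn.1] : ((-⌈C⌉ : ℤ) : ℝ) ≤ n)
  · exact_mod_cast (by linarith [hn.2] : (n : ℝ) ≤ ⌈C⌉)

lemma rot_mul_mem_lattice {x : ℂ} : rot (Real.pi / 3) * x ∈ lattice ↔ x ∈ lattice := by
  constructor
  · rintro ⟨m, n, h⟩
    refine ⟨m + n, -m, ?_⟩
    apply mul_left_cancel₀ (rot_ne_zero (Real.pi / 3))
    rw [h, latticePoint_eq, latticePoint_eq, rot_mul_latticeCoord]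
    push_cast; ring_nf
  · rintro ⟨m, n, rfl⟩
    refine ⟨-n, m + n, ?_⟩
    rw [latticePoint_eq, latticePoint_eq, rot_mul_latticeCoord]
    push_cast; ring_nf

lemma rot_mul_mem_interior_hexagon {z : ℂ} :
    rot (Real.pi / 3) * z ∈ interior hexagon ↔ z ∈ interior hexagon := by
  obtain ⟨s, t, rfl⟩ := exists_eq_latticeCoord z
  rw [rot_mul_latticeCoord, latticeCoord_mem_interior_hexagon, latticeCoord_mem_interior_hexagon,
    show 2 * -t + (s + t) = s - t by ring, show -t + 2 * (s + t) = 2 * s + t by ring,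
    show -t - (s + t) = -(s + 2 * t) by ring, abs_neg]
  tauto

/-- The tiling is invariant under rotations by multiples of `π / 3`. -/
lemma rot_int_mul_invariance (j : ℤ) : ∀ z : ℂ, (rot (j * (Real.pi / 3)) * z ∈ lattice ↔ z ∈ lattice) ∧
    (rot (j * (Real.pi / 3)) * z ∈ interior hexagon ↔ z ∈ interior hexagon) := by
  have hstep : ∀ (r : ℝ) (z : ℂ), rot (r + Real.pi / 3) * z = rot (Real.pi / 3) * (rot r * z) :=
    fun r z => by rw [rot_add]; ring
  induction j using Int.induction_on with
  | zero => intro z; simp [rot_zero]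
  | succ i ih =>
    intro z
    rw [show ((i : ℤ) + 1 : ℤ) * (Real.pi / 3) = ((i : ℤ) : ℝ) * (Real.pi / 3) + Real.pi / 3 by
      push_cast; ring, hstep, rot_mul_mem_lattice, rot_mul_mem_interior_hexagon]
    exact ih z
  | pred i ih =>
    intro z
    rw [← ih z |>.1, ← ih z |>.2, show ((-(i : ℤ) : ℤ) : ℝ) * (Real.pi / 3) =
      ((-(i : ℤ) - 1 : ℤ) : ℝ) * (Real.pi / 3) + Real.pi / 3 by push_cast; ring, hstep,
      rot_mul_mem_lattice, rot_mul_mem_interior_hexagon]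
    exact ⟨Iff.rfl, Iff.rfl⟩

/-! ### The bodies of the lattice points -/

variable {Ω : Set ℂ}

lemma IsConvexPolygon.convex (h : IsConvexPolygon Ω) : Convex ℝ Ω := by
  obtain ⟨⟨V, rfl⟩, -⟩ := h; exact convex_convexHull ℝ _

lemma IsConvexPolygon.isCompact (h : IsConvexPolygon Ω) : IsCompact Ω := by
  obtain ⟨⟨V, rfl⟩, -⟩ := h; exact V.finite_toSet.isCompact_convexHull ℝ

lemma IsConvexPolygon.nonempty (h : IsConvexPolygon Ω) : Ω.Nonempty := h.2.mono interior_subset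

lemma IsConvexPolygon.finite_extremePoints (h : IsConvexPolygon Ω) :
    (extremePoints ℝ Ω).Finite := by
  obtain ⟨⟨V, rfl⟩, -⟩ := h
  exact V.finite_toSet.subset extremePoints_convexHull_subset

/-- The slice of the body of `x` consists of the locations in which the polygon, rotated by `θ`,
has a point in the cell of `x`. -/
lemma mem_minkowski {x u : ℂ} {θ : ℝ} :
    u ∈ minkowski Ω x θ ↔ ∃ z ∈ Ω, rot θ * z + u ∈ hexCell x := by
  simp only [minkowski, mem_add, mem_image, rot_pi_add]
  constructor
  · rintro ⟨_, ⟨z, hz, rfl⟩, y, hy, rfl⟩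
    exact ⟨z, hz, by convert hy using 1; ring⟩
  · rintro ⟨z, hz, hy⟩
    exact ⟨_, ⟨z, hz, rfl⟩, _, hy, by ring⟩

lemma image_neg_rot_convex (h : Convex ℝ Ω) (θ : ℝ) :
    Convex ℝ ((fun z => rot (Real.pi + θ) * z) '' Ω) := by
  have := h.linear_image (LinearMap.mulLeft ℝ (rot (Real.pi + θ)))
  exact this

lemma mem_interior_minkowski (h : IsConvexPolygon Ω) {x u : ℂ} {θ : ℝ} :
    u ∈ interior (minkowski Ω x θ) ↔ ∃ z ∈ Ω, rot θ * z + u ∈ interior (hexCell x) := by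
  rw [minkowski, interior_add_of_convex (image_neg_rot_convex h.convex θ) (convex_hexCell x)
    (h.nonempty.image _) (interior_hexCell_nonempty x)]
  simp only [mem_add, mem_image, rot_pi_add]
  constructor
  · rintro ⟨_, ⟨z, hz, rfl⟩, y, hy, rfl⟩
    exact ⟨z, hz, by convert hy using 1; ring⟩
  · rintro ⟨z, hz, hy⟩
    exact ⟨_, ⟨z, hz, rfl⟩, _, hy, by ring⟩

lemma mem_interior_minkowski_iff_meets (h : IsConvexPolygon Ω) {x : ℂ} {p : ℂ × ℝ} :
    p.1 ∈ interior (minkowski Ω x p.2) ↔ (place p '' Ω ∩ interior (hexCell x)).Nonempty := by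
  rw [mem_interior_minkowski h]
  constructor
  · rintro ⟨z, hz, hy⟩
    exact ⟨_, ⟨z, hz, rfl⟩, hy⟩
  · rintro ⟨_, ⟨z, hz, rfl⟩, hy⟩
    exact ⟨z, hz, hy⟩

lemma convex_minkowski (h : IsConvexPolygon Ω) (x : ℂ) (θ : ℝ) : Convex ℝ (minkowski Ω x θ) :=
  (image_neg_rot_convex h.convex θ).add (convex_hexCell x)

lemma interior_minkowski_nonempty (h : IsConvexPolygon Ω) (x : ℂ) (θ : ℝ) :
    (interior (minkowski Ω x θ)).Nonempty := by
  obtain ⟨z, hz⟩ := h.nonempty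
  obtain ⟨y, hy⟩ := interior_hexCell_nonempty x
  exact ⟨y - rot θ * z, (mem_interior_minkowski h).2 ⟨z, hz, by simpa using hy⟩⟩

lemma isOpen_setOf_mem_interior_minkowski (h : IsConvexPolygon Ω) (x : ℂ) :
    IsOpen {q : ℂ × ℝ | q.1 ∈ interior (minkowski Ω x q.2)} := by
  have : {q : ℂ × ℝ | q.1 ∈ interior (minkowski Ω x q.2)} =
      ⋃ z ∈ Ω, (fun q : ℂ × ℝ => rot q.2 * z + q.1) ⁻¹' interior (hexCell x) := by
    ext q
    simp only [mem_ofPred_eq, mem_interior_minkowski h, mem_iUnion, mem_preimage, exists_prop]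
  rw [this]
  exact isOpen_biUnion fun z _ => isOpen_interior.preimage (by fun_prop)

lemma isClosed_setOf_mem_minkowski (h : IsConvexPolygon Ω) (x : ℂ) :
    IsClosed {q : ℂ × ℝ | q.1 ∈ minkowski Ω x q.2} := by
  rw [← isOpen_compl_iff, isOpen_iff_mem_nhds]
  intro q hq
  have hq' : ∀ z ∈ Ω, rot q.2 * z + q.1 ∉ hexCell x := fun z hz hc =>
    hq (mem_minkowski.2 ⟨z, hz, hc⟩)
  have hcont : Continuous fun r : (ℂ × ℝ) × ℂ => rot r.1.2 * r.2 + r.1.1 := by fun_prop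
  have := h.isCompact.eventually_forall_of_forall_eventually (x₀ := q)
    (P := fun q z => rot q.2 * z + q.1 ∉ hexCell x)
    (fun z hz => ((isClosed_hexCell x).isOpen_compl.preimage hcont).mem_nhds (hq' z hz))
  filter_upwards [this] with r hr hc
  obtain ⟨z, hz, hz'⟩ := mem_minkowski.1 hc
  exact hr z hz hz'

lemma isClosed_minkowski (h : IsConvexPolygon Ω) (x : ℂ) (θ : ℝ) : IsClosed (minkowski Ω x θ) :=
  (isClosed_setOf_mem_minkowski h x).preimage (f := fun u : ℂ => (u, θ)) (by fun_prop)

lemma mem_frontier_minkowski (h : IsConvexPolygon Ω) {x u : ℂ} {θ : ℝ} :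
    u ∈ frontier (minkowski Ω x θ) ↔ u ∈ minkowski Ω x θ ∧ u ∉ interior (minkowski Ω x θ) := by
  rw [(isClosed_minkowski h x θ).frontier_eq]; rfl

lemma isClosed_setOf_mem_frontier_minkowski (h : IsConvexPolygon Ω) (x : ℂ) :
    IsClosed {q : ℂ × ℝ | q.1 ∈ frontier (minkowski Ω x q.2)} := by
  have : {q : ℂ × ℝ | q.1 ∈ frontier (minkowski Ω x q.2)} =
      {q | q.1 ∈ minkowski Ω x q.2} ∩ {q | q.1 ∈ interior (minkowski Ω x q.2)}ᶜ := by
    ext q; exact mem_frontier_minkowski h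
  rw [this]
  exact (isClosed_setOf_mem_minkowski h x).inter (isOpen_setOf_mem_interior_minkowski h x).isClosed_compl

/-! ### The lateral walls of the bodies -/

/-- The sum of the point `a` of the polygon, rotated by `π + θ`, and the vertex number `i` of the
cell centred at `x`. -/
noncomputable def corner (x a : ℂ) (i : ℤ) (θ : ℝ) : ℂ := x + hexVertex i - rot θ * a

lemma corner_sub_corner_vertex (x a : ℂ) (i j : ℤ) (θ : ℝ) :
    corner x a j θ - corner x a i θ = hexVertex j - hexVertex i := by
  simp only [corner]; ring

lemma corner_sub_corner_point (x a b : ℂ) (i : ℤ) (θ : ℝ) :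
    corner x b i θ - corner x a i θ = -rot θ * (b - a) := by
  simp only [corner]; ring

lemma corner_mem_minkowski {x a : ℂ} (ha : a ∈ Ω) (i : ℤ) (θ : ℝ) :
    corner x a i θ ∈ minkowski Ω x θ := by
  refine mem_minkowski.2 ⟨a, ha, ?_⟩
  rw [mem_hexCell, corner, show rot θ * a + (x + hexVertex i - rot θ * a) - x = hexVertex i by ring]
  exact hexVertex_mem_hexagon i

@[fun_prop]
lemma continuous_corner (x a : ℂ) (i : ℤ) : Continuous (corner x a i) := by
  unfold corner; fun_prop

/-- The index pairs of the walls: an edge `[a, b]` of the polygon with a vertex of the cell, or a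
vertex of the polygon with an edge of the cell. -/
def IsWallIndex (Ω : Set ℂ) (a b : ℂ) (i j : ℤ) : Prop :=
  (IsEdge Ω a b ∧ j = i) ∨ (a = b ∧ a ∈ extremePoints ℝ Ω ∧ j = i + 1)

/-- A wall of the body of `x`, in a form common to both kinds: it is swept by a segment that joins
two corners. -/
def wall (Ω : Set ℂ) (x a b : ℂ) (i j : ℤ) : Set (ℂ × ℝ) :=
  sweptSurface Ω x fun θ => segment ℝ (corner x a i θ) (corner x b j θ)

/-- `S` is one of the walls of the body of `x`. -/
def IsWall (Ω : Set ℂ) (x : ℂ) (S : Set (ℂ × ℝ)) : Prop :=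
  ∃ a b i j, IsWallIndex Ω a b i j ∧ S = wall Ω x a b i j

lemma IsWallIndex.left_mem {a b : ℂ} {i j : ℤ} (h : IsWallIndex Ω a b i j) : a ∈ Ω := by
  rcases h with ⟨h, -⟩ | ⟨-, h, -⟩
  · exact h.2.1.1
  · exact h.1

lemma IsWallIndex.right_mem {a b : ℂ} {i j : ℤ} (h : IsWallIndex Ω a b i j) : b ∈ Ω := by
  rcases h with ⟨h, -⟩ | ⟨rfl, h, -⟩
  · exact h.2.2.1.1
  · exact h.1

lemma IsWallIndex.corner_ne {a b : ℂ} {i j : ℤ} (h : IsWallIndex Ω a b i j) (x : ℂ) (θ : ℝ) :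
    corner x a i θ ≠ corner x b j θ := by
  intro heq
  have h0 := sub_eq_zero.2 heq.symm
  rcases h with ⟨h, rfl⟩ | ⟨rfl, -, rfl⟩
  · rw [corner_sub_corner_point] at h0
    rcases mul_eq_zero.1 h0 with h1 | h1
    · exact rot_ne_zero θ (neg_eq_zero.1 h1)
    · exact h.1 (sub_eq_zero.1 h1).symm
  · rw [corner_sub_corner_vertex] at h0
    exact hexVertex_ne_succ i (sub_eq_zero.1 h0).symm

lemma segment_edgeVertex (x a b : ℂ) (k : ℤ) (θ : ℝ) :
    (fun z => rot (Real.pi + θ) * z) '' segment ℝ a b + {x + hexVertex k} =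
      segment ℝ (corner x a k θ) (corner x b k θ) := by
  ext u
  simp only [add_singleton, mem_image, exists_exists_and_eq_and, mem_segment_iff_smul]
  constructor
  · rintro ⟨_, ⟨t, h0, h1, rfl⟩, rfl⟩
    refine ⟨t, h0, h1, ?_⟩
    simp only [corner, rot_pi_add, Complex.real_smul]; ring
  · rintro ⟨t, h0, h1, rfl⟩
    refine ⟨_, ⟨t, h0, h1, rfl⟩, ?_⟩
    simp only [corner, rot_pi_add, Complex.real_smul]; ring

lemma segment_vertexEdge (x v : ℂ) (k : ℤ) (θ : ℝ) :
    {rot (Real.pi + θ) * v} + ({x} + hexEdge k) =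
      segment ℝ (corner x v k θ) (corner x v (k + 1) θ) := by
  ext u
  simp only [singleton_add, mem_image, exists_exists_and_eq_and, hexEdge, mem_segment_iff_smul]
  constructor
  · rintro ⟨_, ⟨t, h0, h1, rfl⟩, rfl⟩
    refine ⟨t, h0, h1, ?_⟩
    simp only [corner, rot_pi_add, Complex.real_smul]; ring
  · rintro ⟨t, h0, h1, rfl⟩
    refine ⟨_, ⟨t, h0, h1, rfl⟩, ?_⟩
    simp only [corner, rot_pi_add, Complex.real_smul]; ring

lemma IsWall.isSurface {x : ℂ} (hx : x ∈ gridPoints Ω) {S : Set (ℂ × ℝ)} (h : IsWall Ω x S) :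
    IsSurface Ω S := by
  obtain ⟨a, b, i, j, ⟨hab, rfl⟩ | ⟨rfl, hv, rfl⟩, rfl⟩ := h
  · have := IsSurface.edgeVertex x hx a b hab j
    simpa only [segment_edgeVertex, wall] using this
  · have := IsSurface.vertexEdge x hx a hv i
    simpa only [segment_vertexEdge, wall] using this

lemma IsSurface.cases {S : Set (ℂ × ℝ)} (h : IsSurface Ω S) :
    (∃ x ∈ gridPoints Ω, IsWall Ω x S) ∨ (∃ k, S = hexEdge k ×ˢ angles) ∨
      S = hexagon ×ˢ {0} ∨ S = hexagon ×ˢ {Real.pi / 3} := by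
  rcases h with ⟨x, hx, a, b, hab, k⟩ | ⟨x, hx, v, hv, k⟩ | k | _ | _
  · refine Or.inl ⟨x, hx, a, b, k, k, Or.inl ⟨hab, rfl⟩, ?_⟩
    simp only [segment_edgeVertex, wall]
  · refine Or.inl ⟨x, hx, v, v, k, k + 1, Or.inr ⟨rfl, hv, rfl⟩, ?_⟩
    simp only [segment_vertexEdge, wall]
  · exact Or.inr (Or.inl ⟨k, rfl⟩)
  · exact Or.inr (Or.inr (Or.inl rfl))
  · exact Or.inr (Or.inr (Or.inr rfl))

lemma mem_wall {x a b : ℂ} {i j : ℤ} {q : ℂ × ℝ} : q ∈ wall Ω x a b i j ↔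
    q.2 ∈ angles ∧ q.1 ∈ segment ℝ (corner x a i q.2) (corner x b j q.2) ∧
      segment ℝ (corner x a i q.2) (corner x b j q.2) ⊆ frontier (minkowski Ω x q.2) := Iff.rfl

lemma isClosed_angles : IsClosed angles := isClosed_Icc

lemma IsWall.isClosed (h : IsConvexPolygon Ω) {x : ℂ} {S : Set (ℂ × ℝ)} (hS : IsWall Ω x S) :
    IsClosed S := by
  obtain ⟨a, b, i, j, hI, rfl⟩ := hS
  have hP := continuous_corner x a i
  have hQ := continuous_corner x b j
  set P := corner x a i
  set Q := corner x b j
  have : wall Ω x a b i j = {q : ℂ × ℝ | q.2 ∈ angles} ∩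
      ({q | cross (Q q.2 - P q.2) (q.1 - P q.2) = 0} ∩
      ({q | 0 ≤ (Q q.2 - P q.2).re * (q.1 - P q.2).re + (Q q.2 - P q.2).im * (q.1 - P q.2).im} ∩
      {q | (Q q.2 - P q.2).re * (q.1 - P q.2).re + (Q q.2 - P q.2).im * (q.1 - P q.2).im ≤
        (Q q.2 - P q.2).re * (Q q.2 - P q.2).re + (Q q.2 - P q.2).im * (Q q.2 - P q.2).im})) ∩
      ⋂ t ∈ Icc (0 : ℝ) 1, (fun q : ℂ × ℝ => (P q.2 + t • (Q q.2 - P q.2), q.2)) ⁻¹'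
        {q : ℂ × ℝ | q.1 ∈ frontier (minkowski Ω x q.2)} := by
    ext q
    rw [mem_wall, mem_segment_iff_ineq (hI.corner_ne x q.2)]
    have : segment ℝ (P q.2) (Q q.2) ⊆ frontier (minkowski Ω x q.2) ↔
        ∀ t ∈ Icc (0 : ℝ) 1, P q.2 + t • (Q q.2 - P q.2) ∈ frontier (minkowski Ω x q.2) := by
      constructor
      · exact fun hs t ht => hs (mem_segment_iff_smul.2 ⟨t, ht.1, ht.2, rfl⟩)
      · intro hs u hu
        obtain ⟨t, h0, h1, rfl⟩ := mem_segment_iff_smul.1 hu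
        exact hs t ⟨h0, h1⟩
    rw [this]
    simp only [mem_inter_iff, mem_ofPred_eq, mem_iInter, mem_preimage, and_assoc]
    exact Iff.rfl
  rw [this]
  refine ((isClosed_angles.preimage continuous_snd).inter ((isClosed_eq ?_ ?_).inter
    ((isClosed_le ?_ ?_).inter (isClosed_le ?_ ?_)))).inter
    (isClosed_biInter fun t _ => (isClosed_setOf_mem_frontier_minkowski h x).preimage ?_)
  all_goals fun_prop

lemma finite_range_hexVertex : (range hexVertex).Finite := by
  refine ((finite_Icc (0 : ℤ) 6).image hexVertex).subset ?_
  rintro _ ⟨k, rfl⟩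
  exact ⟨k % 6, ⟨Int.emod_nonneg k (by norm_num), (Int.emod_lt_of_pos k (by norm_num)).le⟩,
    hexVertex_emod_six k⟩

lemma IsEdge.symm {a b : ℂ} (h : IsEdge Ω a b) : IsEdge Ω b a :=
  ⟨h.1.symm, h.2.2.1, h.2.1, segment_symm ℝ a b ▸ h.2.2.2⟩

/-- Whether a line supports a slice of a body can be tested at the corners. -/
lemma forall_minkowski_cross_iff {V : Set ℂ} (hV : Ω = convexHull ℝ V) {x c u : ℂ} {θ : ℝ} :
    (∀ w ∈ minkowski Ω x θ, 0 ≤ cross c (w - u)) ↔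
      ∀ v ∈ V, ∀ k, 0 ≤ cross c (corner x v k θ - u) := by
  constructor
  · intro h v hv k
    exact h _ (corner_mem_minkowski (hV ▸ subset_convexHull ℝ V hv) k θ)
  · intro h w hw
    obtain ⟨z, hz, hw⟩ := mem_minkowski.1 hw
    rw [mem_hexCell] at hw
    have h1 : ∀ k, 0 ≤ cross c (corner x z k θ - u) := by
      have hconv : Convex ℝ {z | ∀ k, 0 ≤ cross c (corner x z k θ - u)} := by
        intro z hz w hw s t hs ht hst k
        have := hz k
        have := hw k
        have e : corner x (s • z + t • w) k θ - u =
            s • (corner x z k θ - u) + t • (corner x w k θ - u) := by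
          have : (s : ℂ) = 1 - t := by
            rw [eq_sub_iff_add_eq]; exact_mod_cast hst
          simp only [corner, Complex.real_smul, this]; ring
        rw [e, cross_add_right, cross_smul_right, cross_smul_right]
        positivity
      have : Ω ⊆ {z | ∀ k, 0 ≤ cross c (corner x z k θ - u)} := by
        rw [hV]; exact convexHull_min h hconv
      exact this hz
    have hconv : Convex ℝ {y | 0 ≤ cross c (x + y - rot θ * z - u)} := by
      intro y hy w hw s t hs ht hst
      rw [mem_ofPred_eq] at *
      have e : x + (s • y + t • w) - rot θ * z - u =
          s • (x + y - rot θ * z - u) + t • (x + w - rot θ * z - u) := by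
        have : (s : ℂ) = 1 - t := by
          rw [eq_sub_iff_add_eq]; exact_mod_cast hst
        simp only [Complex.real_smul, this]; ring
      rw [e, cross_add_right, cross_smul_right, cross_smul_right]
      positivity
    have : hexagon ⊆ {y | 0 ≤ cross c (x + y - rot θ * z - u)} :=
      convexHull_min (by rintro _ ⟨k, rfl⟩; exact h1 k) hconv
    have := this hw
    rw [mem_ofPred_eq] at this
    convert this using 2
    ring

lemma norm_mul_cross_rot_arg (z d : ℂ) : ‖z‖ * cross (rot z.arg) d = cross z d := by
  conv_rhs => rw [← Complex.norm_mul_exp_arg_mul_I z]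
  rw [← cross_smul_left, Complex.real_smul, rot]

/-- At every boundary point of a slice of a body there is a support line that contains a further
corner: turn a support line about the point until it hits one. -/
lemma exists_support_through_corner (h : IsConvexPolygon Ω) {x u : ℂ} {θ : ℝ}
    (hu : u ∈ frontier (minkowski Ω x θ)) :
    ∃ c ≠ 0, (∀ w ∈ minkowski Ω x θ, 0 ≤ cross c (w - u)) ∧
      ∃ v ∈ Ω, ∃ k, corner x v k θ ≠ u ∧ cross c (corner x v k θ - u) = 0 := by
  obtain ⟨V, hV⟩ := h.1
  rw [mem_frontier_minkowski h] at hu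
  set N : Set ℝ := {φ | ∀ w ∈ minkowski Ω x θ, 0 ≤ cross (rot φ) (w - u)} with hN
  have hNc : IsClosed N := by
    have : N = ⋂ w ∈ minkowski Ω x θ, {φ | 0 ≤ cross (rot φ) (w - u)} := by
      ext φ; simp only [hN, mem_ofPred_eq, mem_iInter]
    rw [this]
    exact isClosed_biInter fun w _ => isClosed_le continuous_const (by fun_prop)
  have hne : N.Nonempty := by
    obtain ⟨c, hc, hs⟩ := exists_support (convex_minkowski h x θ)
      (interior_minkowski_nonempty h x θ) hu.2
    refine ⟨c.arg, fun w hw => ?_⟩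
    have := hs w hw
    rw [← norm_mul_cross_rot_arg] at this
    exact nonneg_of_mul_nonneg_right this (norm_pos_iff.2 hc)
  have huniv : N ≠ univ := by
    intro hall
    have hw : ∃ w ∈ minkowski Ω x θ, w ≠ u := by
      by_contra hcon
      push Not at hcon
      have hsub : minkowski Ω x θ ⊆ {u} := fun w hw => hcon w hw
      obtain ⟨w, hw⟩ := interior_minkowski_nonempty h x θ
      have := interior_mono hsub hw
      rw [interior_singleton] at this
      exact this
    obtain ⟨w, hw, hwu⟩ := hw
    have hd : w - u ≠ 0 := sub_ne_zero.2 hwu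
    have h1 : (Complex.I * (w - u)).arg ∈ N := hall ▸ mem_univ _
    have h2 := h1 w hw
    have h3 : _ = -cross (w - u) (Complex.I * (w - u)) :=
      (norm_mul_cross_rot_arg (Complex.I * (w - u)) (w - u)).trans (cross_comm _ _)
    have h4 := cross_I_mul_pos hd
    have h5 : 0 ≤ ‖Complex.I * (w - u)‖ := norm_nonneg _
    nlinarith [mul_nonneg h5 h2]
  obtain ⟨φ, hφ⟩ := nonempty_frontier_iff.2 ⟨hne, huniv⟩
  rw [hNc.frontier_eq] at hφ
  refine ⟨rot φ, rot_ne_zero φ, hφ.1, ?_⟩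
  by_contra hcon
  push Not at hcon
  apply hφ.2
  rw [mem_interior_iff_mem_nhds]
  have hev : ∀ᶠ ψ in nhds φ, ∀ v ∈ (V : Set ℂ), ∀ y ∈ range hexVertex,
      0 ≤ cross (rot ψ) (x + y - rot θ * v - u) := by
    rw [Filter.eventually_all_finite V.finite_toSet]
    intro v hv
    rw [Filter.eventually_all_finite finite_range_hexVertex]
    rintro _ ⟨k, rfl⟩
    have hvΩ : v ∈ Ω := hV ▸ subset_convexHull ℝ _ hv
    rcases eq_or_ne (corner x v k θ) u with heq | hneq
    · refine Filter.Eventually.of_forall fun ψ => ?_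
      rw [← corner, heq, sub_self, cross_zero_right]
    · have hpos : 0 < cross (rot φ) (corner x v k θ - u) :=
        lt_of_le_of_ne (hφ.1 _ (corner_mem_minkowski hvΩ k θ)) (hcon v hvΩ k hneq).symm
      have hc : Continuous fun ψ => cross (rot ψ) (x + hexVertex k - rot θ * v - u) := by fun_prop
      exact (hc.continuousAt.eventually (lt_mem_nhds hpos)).mono fun ψ hψ => le_of_lt hψ
  filter_upwards [hev] with ψ hψ
  exact (forall_minkowski_cross_iff hV).2 fun v hv k => hψ v hv _ (mem_range_self k)

/-- The linear form `cross c` in the frame of the polygon that is rotated by `π + θ`. -/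
lemma exists_cross_neg_rot_mul {c : ℂ} (hc : c ≠ 0) (θ : ℝ) :
    ∃ c' ≠ 0, ∀ d, cross c (-rot θ * d) = cross c' d := by
  have h0 := rot_ne_zero θ
  refine ⟨-((rot θ)⁻¹ * c), neg_ne_zero.2 (mul_ne_zero (inv_ne_zero h0) hc), fun d => ?_⟩
  have := cross_mul_left_mul_left (-rot θ) (-((rot θ)⁻¹ * c)) d
  rwa [show -rot θ * -((rot θ)⁻¹ * c) = c by field_simp, Complex.normSq_neg, normSq_rot,
    one_mul] at this

/-- The walls of a body cover its lateral boundary. A support line through the point that contains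
a further corner cuts out a face of the polygon and a face of the cell, not both single points. If
one of them is a vertex then their sum is a slice of a wall; if both are edges then they are
parallel, and their sum is composed of two such slices. -/
lemma exists_wall_of_mem_frontier (h : IsConvexPolygon Ω) {x u : ℂ} {θ : ℝ} (hθ : θ ∈ angles)
    (hu : u ∈ frontier (minkowski Ω x θ)) : ∃ S, IsWall Ω x S ∧ (u, θ) ∈ S := by
  obtain ⟨c, hc, hsupp, v, hv, k, hne, h0⟩ := exists_support_through_corner h hu
  rw [mem_frontier_minkowski h] at hu
  obtain ⟨z, hz, hy⟩ := mem_minkowski.1 hu.1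
  rw [mem_hexCell] at hy
  set ρ := rot θ with hρ
  have hρ0 : ρ ≠ 0 := rot_ne_zero θ
  set y := ρ * z + u - x with hydef
  have hu' : u = x + y - ρ * z := by rw [hydef]; ring
  obtain ⟨c', hc'0, hcc⟩ := exists_cross_neg_rot_mul hc θ
  have hsum : ∀ z' y', cross c (x + y' - ρ * z' - u) = cross c' (z' - z) + cross c (y' - y) :=
    fun z' y' => by rw [← hcc, ← cross_add_right, hu']; congr 1; ring
  have hmem : ∀ z' ∈ Ω, ∀ y' ∈ hexagon, x + y' - ρ * z' ∈ minkowski Ω x θ := fun z' hz' y' hy' => by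
    refine mem_minkowski.2 ⟨z', hz', ?_⟩
    rw [mem_hexCell]; convert hy' using 1; rw [hρ]; ring
  have hzΩ : ∀ z' ∈ Ω, 0 ≤ cross c' (z' - z) := fun z' hz' => by
    have := hsupp _ (hmem z' hz' y hy)
    rwa [hsum, sub_self, cross_zero_right, add_zero] at this
  have hyH : ∀ y' ∈ hexagon, 0 ≤ cross c (y' - y) := fun y' hy' => by
    have := hsupp _ (hmem z hz y' hy')
    rwa [hsum, sub_self, cross_zero_right, zero_add] at this
  obtain ⟨a, ha, b, hb, hexp, hF⟩ := exists_face_eq_segment h.isCompact h.convex h.nonempty hc'0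
  obtain ⟨i, j, hij, hG⟩ := exists_hexagon_face hc
  have hzF := (hF z).2 ⟨hz, hzΩ⟩
  have hyG := (hG y).2 ⟨hy, hyH⟩
  have hvk : cross c' (v - z) = 0 ∧ cross c (hexVertex k - y) = 0 := by
    rw [corner, hsum] at h0
    have h1 := hzΩ v hv
    have h2 := hyH _ (hexVertex_mem_hexagon k)
    exact ⟨by linarith, by linarith⟩
  have hvF : v ∈ segment ℝ a b := (hF v).2 ⟨hv, fun w hw => by
    have h1 := hzΩ w hw
    have h2 := hvk.1
    simp only [cross_sub_right] at *
    linarith⟩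
  have hkG : hexVertex k ∈ segment ℝ (hexVertex i) (hexVertex j) :=
    (hG _).2 ⟨hexVertex_mem_hexagon k, fun w hw => by
      have h1 := hyH w hw
      have h2 := hvk.2
      simp only [cross_sub_right] at *
      linarith⟩
  -- all sums of points of the two faces are boundary points
  set K := {w ∈ minkowski Ω x θ | cross c (w - u) = 0} with hK
  have hKconv : Convex ℝ K := by
    intro w hw w' hw' s t hs ht hst
    refine ⟨convex_minkowski h x θ hw.1 hw'.1 hs ht hst, ?_⟩
    have e : s • w + t • w' - u = s • (w - u) + t • (w' - u) := by
      have : (s : ℂ) = 1 - t := by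
        rw [eq_sub_iff_add_eq]; exact_mod_cast hst
      simp only [Complex.real_smul, this]; ring
    rw [e, cross_add_right, cross_smul_right, cross_smul_right, hw.2, hw'.2]
    simp
  have hKfr : K ⊆ frontier (minkowski Ω x θ) := fun w hw =>
    (mem_frontier_minkowski h).2 ⟨hw.1, notMem_interior_of_support hc hsupp hw.2.le⟩
  have hcorner : ∀ e ∈ segment ℝ a b, ∀ l, hexVertex l ∈ segment ℝ (hexVertex i) (hexVertex j) →
      corner x e l θ ∈ K := fun e he l hl => by
    have he' := (hF e).1 he
    have hl' := (hG _).1 hl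
    refine ⟨corner_mem_minkowski he'.1 l θ, ?_⟩
    rw [corner, hsum]
    have h1 := he'.2 z hz
    have h2 := hzΩ e he'.1
    have h3 := hl'.2 y hy
    have h4 := hyH _ hl'.1
    simp only [cross_sub_right] at *
    linarith
  have hwall : ∀ a' b' i' j', IsWallIndex Ω a' b' i' j' → a' ∈ segment ℝ a b → b' ∈ segment ℝ a b →
      hexVertex i' ∈ segment ℝ (hexVertex i) (hexVertex j) →
      hexVertex j' ∈ segment ℝ (hexVertex i) (hexVertex j) →
      u ∈ segment ℝ (corner x a' i' θ) (corner x b' j' θ) → ∃ S, IsWall Ω x S ∧ (u, θ) ∈ S :=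
    fun a' b' i' j' hI ha' hb' hi' hj' hmem =>
      ⟨_, ⟨a', b', i', j', hI, rfl⟩, hθ, hmem,
        (hKconv.segment_subset (hcorner _ ha' _ hi') (hcorner _ hb' _ hj')).trans hKfr⟩
  have haF := left_mem_segment ℝ a b
  have hbF := right_mem_segment ℝ a b
  have hiG := left_mem_segment ℝ (hexVertex i) (hexVertex j)
  have hjG := right_mem_segment ℝ (hexVertex i) (hexVertex j)
  rcases hij with rfl | rfl
  · -- the face of the cell is a vertex
    rw [segment_same, mem_singleton_iff] at hyG hkG
    have hab : a ≠ b := by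
      rintro rfl
      rw [segment_same, mem_singleton_iff] at hzF hvF
      apply hne
      rw [corner, hkG, hvF, hu', hyG, hzF]
    refine hwall a b j j (Or.inl ⟨⟨hab, ha, hb, hexp⟩, rfl⟩) haF hbF hiG hjG ?_
    rw [← segment_edgeVertex, hu', hyG]
    refine mem_add.2 ⟨_, ⟨z, hzF, rfl⟩, _, rfl, ?_⟩
    simp only [rot_pi_add]; ring
  · rcases eq_or_ne a b with rfl | hab
    · -- the face of the polygon is a vertex
      rw [segment_same, mem_singleton_iff] at hzF
      refine hwall a a i (i + 1) (Or.inr ⟨rfl, ha, rfl⟩) haF haF hiG hjG ?_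
      rw [← segment_vertexEdge, hu', hzF]
      refine mem_add.2 ⟨_, rfl, _, mem_add.2 ⟨_, rfl, _, hyG, rfl⟩, ?_⟩
      simp only [rot_pi_add]; ring
    · -- two parallel edges: follow first one, then the other
      have main : ∀ a b, IsEdge Ω a b → a ∈ segment ℝ a b → z ∈ segment ℝ a b →
          (∀ a' b' i' j', IsWallIndex Ω a' b' i' j' → a' ∈ segment ℝ a b → b' ∈ segment ℝ a b →
            hexVertex i' ∈ segment ℝ (hexVertex i) (hexVertex (i + 1)) →
            hexVertex j' ∈ segment ℝ (hexVertex i) (hexVertex (i + 1)) →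
            u ∈ segment ℝ (corner x a' i' θ) (corner x b' j' θ) → ∃ S, IsWall Ω x S ∧ (u, θ) ∈ S) →
          ∀ l : ℝ, 0 < l → -ρ * (b - a) = l • (hexVertex (i + 1) - hexVertex i) →
          ∃ S, IsWall Ω x S ∧ (u, θ) ∈ S := by
        intro a b hE haF hzF hwall l hl hle
        have hbF := right_mem_segment ℝ a b
        obtain ⟨s, hs0, hs1, hs⟩ := mem_segment_iff_smul.1 hzF
        obtain ⟨t, ht0, ht1, ht⟩ := mem_segment_iff_smul.1 hyG
        have hua : u = corner x a i θ + (l * s + t) • (hexVertex (i + 1) - hexVertex i) := by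
          rw [add_smul, mul_comm l s, mul_smul, ← hle, hu', ht, hs, corner]
          simp only [Complex.real_smul]; ring
        by_cases hlt : l * s + t ≤ l
        · refine hwall a b i i (Or.inl ⟨hE, rfl⟩) haF hbF hiG hiG (mem_segment_iff_smul.2
            ⟨(l * s + t) / l, by positivity, (div_le_one hl).2 hlt, ?_⟩)
          rw [corner_sub_corner_point, ← hρ, hle, smul_smul, div_mul_cancel₀ _ hl.ne']
          exact hua
        · push Not at hlt
          refine hwall b b i (i + 1) (Or.inr ⟨rfl, hE.2.2.1, rfl⟩) hbF hbF hiG hjG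
            (mem_segment_iff_smul.2 ⟨l * s + t - l, by linarith, by nlinarith, ?_⟩)
          have hab' : corner x b i θ = corner x a i θ + l • (hexVertex (i + 1) - hexVertex i) := by
            rw [← hle, hρ, ← corner_sub_corner_point x]; ring
          rw [corner_sub_corner_vertex, hab', hua]
          module
      have hE : IsEdge Ω a b := ⟨hab, ha, hb, hexp⟩
      have he0 : hexVertex (i + 1) - hexVertex i ≠ 0 := sub_ne_zero.2 (hexVertex_ne_succ i).symm
      have hce : cross c (hexVertex (i + 1) - hexVertex i) = 0 := by
        have h1 := ((hG _).1 hiG).2 _ (hexVertex_mem_hexagon (i + 1))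
        have h2 := ((hG _).1 hjG).2 _ (hexVertex_mem_hexagon i)
        simp only [cross_sub_right] at *
        linarith
      have hcab : cross c (-ρ * (b - a)) = 0 := by
        rw [hcc]
        have h1 := ((hF _).1 haF).2 b hb.1
        have h2 := ((hF _).1 hbF).2 a ha.1
        simp only [cross_sub_right] at *
        linarith
      obtain ⟨m, hm⟩ := eq_smul_of_cross_eq_zero he0 hce
      have hm0 : m ≠ 0 := by rintro rfl; rw [zero_smul] at hm; exact hc hm
      obtain ⟨l, hl⟩ := eq_smul_of_cross_eq_zero (c := -ρ * (b - a)) he0 (by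
        rw [hm, cross_smul_left] at hcab
        rw [cross_comm, (mul_eq_zero.1 hcab).resolve_left hm0, neg_zero])
      have hl0 : l ≠ 0 := by
        rintro rfl
        rw [zero_smul] at hl
        exact (mul_ne_zero (neg_ne_zero.2 hρ0) (sub_ne_zero.2 hab.symm)) hl
      rcases lt_or_gt_of_ne hl0 with hlneg | hlpos
      · refine main b a hE.symm (left_mem_segment ℝ b a) (segment_symm ℝ a b ▸ hzF) ?_ (-l)
          (by linarith) ?_
        · rw [segment_symm ℝ b a]; exact hwall
        · rw [neg_smul, ← hl]; ring
      · exact main a b hE haF hzF hwall l hlpos hl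

/-! ### Polyhedra that depend analytically on the angle -/

/-- A real function that is analytic on the whole line. -/
def IsAnalytic (f : ℝ → ℝ) : Prop := ∀ θ, AnalyticAt ℝ f θ

lemma IsAnalytic.add {f g : ℝ → ℝ} (hf : IsAnalytic f) (hg : IsAnalytic g) :
    IsAnalytic fun θ => f θ + g θ := fun θ => (hf θ).add (hg θ)

lemma IsAnalytic.sub {f g : ℝ → ℝ} (hf : IsAnalytic f) (hg : IsAnalytic g) :
    IsAnalytic fun θ => f θ - g θ := fun θ => (hf θ).sub (hg θ)

lemma IsAnalytic.mul {f g : ℝ → ℝ} (hf : IsAnalytic f) (hg : IsAnalytic g) :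
    IsAnalytic fun θ => f θ * g θ := fun θ => (hf θ).mul (hg θ)

lemma IsAnalytic.neg {f : ℝ → ℝ} (hf : IsAnalytic f) : IsAnalytic fun θ => -f θ :=
  fun θ => (hf θ).neg

lemma isAnalytic_const (c : ℝ) : IsAnalytic fun _ => c := fun _ => analyticAt_const

lemma IsAnalytic.continuous {f : ℝ → ℝ} (hf : IsAnalytic f) : Continuous f :=
  continuous_iff_continuousAt.2 fun θ => (hf θ).continuousAt

/-- An analytic function has only finitely many zeros in a bounded interval at which it does not
vanish identically. -/
lemma IsAnalytic.finite_isolated_zeros {f : ℝ → ℝ} (hf : IsAnalytic f) :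
    {θ ∈ angles | f θ = 0 ∧ ¬ ∀ᶠ φ in nhds θ, f φ = 0}.Finite := by
  by_contra hinf
  obtain ⟨θ, -, hacc⟩ := (isCompact_Icc (a := (0 : ℝ)) (b := Real.pi / 3)).isCountablyCompact
    |>.exists_accPt_of_infinite (B := {θ ∈ angles | f θ = 0 ∧ ¬ ∀ᶠ φ in nhds θ, f φ = 0})
      (fun θ hθ => hθ.1) hinf
  rw [accPt_iff_frequently_nhdsNE] at hacc
  rcases (hf θ).eventually_eq_zero_or_eventually_ne_zero with h | h
  · apply hacc
    have h2 := (eventually_eventually_nhds.2 h).filter_mono (nhdsWithin_le_nhds (s := {θ}ᶜ))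
    exact h2.mono fun φ hφ hc => hc.2.2 hφ
  · exact hacc (h.mono fun φ hφ hc => hφ hc.2.1)

/-- A set whose points have their angle in a set `A` of angles, all but finitely many of which are
interior to `A`, and whose slice at each such angle is described by finitely many linear
inequalities, with coefficients that depend analytically on the angle. -/
def IsAnalyticPolyhedral (X : Set (ℂ × ℝ)) : Prop :=
  ∃ (ι : Type) (_ : Finite ι) (a b c : ι → ℝ → ℝ) (A : Set ℝ),
    (∀ i, IsAnalytic (a i)) ∧ (∀ i, IsAnalytic (b i)) ∧ (∀ i, IsAnalytic (c i)) ∧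
    A ⊆ angles ∧ (A \ interior A).Finite ∧
    ∀ p, p ∈ X ↔ p.2 ∈ A ∧ ∀ i, a i p.2 * p.1.re + b i p.2 * p.1.im ≤ c i p.2

lemma IsAnalyticPolyhedral.inter {X Y : Set (ℂ × ℝ)} (hX : IsAnalyticPolyhedral X)
    (hY : IsAnalyticPolyhedral Y) : IsAnalyticPolyhedral (X ∩ Y) := by
  obtain ⟨ι, _, a, b, c, A, ha, hb, hc, hA, hAf, hX⟩ := hX
  obtain ⟨κ, _, a', b', c', A', ha', hb', hc', hA', hAf', hY⟩ := hY
  refine ⟨ι ⊕ κ, inferInstance, Sum.elim a a', Sum.elim b b', Sum.elim c c', A ∩ A', ?_, ?_, ?_,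
    inter_subset_left.trans hA, (hAf.union hAf').subset ?_, fun p => ?_⟩
  · rintro (i | i)
    exacts [ha i, ha' i]
  · rintro (i | i)
    exacts [hb i, hb' i]
  · rintro (i | i)
    exacts [hc i, hc' i]
  · rintro θ ⟨⟨h1, h2⟩, h3⟩
    rw [interior_inter] at h3
    by_cases h4 : θ ∈ interior A
    · exact Or.inr ⟨h2, fun h5 => h3 ⟨h4, h5⟩⟩
    · exact Or.inl ⟨h1, h4⟩
  · simp only [mem_inter_iff, hX, hY, Sum.forall, Sum.elim_inl, Sum.elim_inr]
    tauto

/-- If a linear system with analytic coefficients is solvable at `θ`, and no minor of the extended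
matrix has an isolated zero at `θ`, then every solution at `θ` extends to a continuous family of
solutions near `θ`. -/
lemma exists_continuous_solution {ι : Type} {a b c : ι → ℝ → ℝ} (ha : ∀ i, IsAnalytic (a i))
    (hb : ∀ i, IsAnalytic (b i)) (hc : ∀ i, IsAnalytic (c i)) {J : Set ι} {θ : ℝ} {u : ℂ}
    (hJ : ∀ i ∈ J, a i θ * u.re + b i θ * u.im = c i θ)
    (ga : ∀ i, a i θ = 0 → ∀ᶠ φ in nhds θ, a i φ = 0)
    (gb : ∀ i, b i θ = 0 → ∀ᶠ φ in nhds θ, b i φ = 0)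
    (gc : ∀ i, c i θ = 0 → ∀ᶠ φ in nhds θ, c i φ = 0)
    (gD : ∀ i j, a i θ * b j θ - a j θ * b i θ = 0 →
      ∀ᶠ φ in nhds θ, a i φ * b j φ - a j φ * b i φ = 0)
    (gE : ∀ i j, (a i θ * a i θ + b i θ * b i θ) * c j θ -
        (a j θ * a i θ + b j θ * b i θ) * c i θ = 0 →
      ∀ᶠ φ in nhds θ, (a i φ * a i φ + b i φ * b i φ) * c j φ -
        (a j φ * a i φ + b j φ * b i φ) * c i φ = 0)
    (gF : ∀ i j k, a k θ * (c i θ * b j θ - c j θ * b i θ) + b k θ * (a i θ * c j θ - a j θ * c i θ)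
        - c k θ * (a i θ * b j θ - a j θ * b i θ) = 0 →
      ∀ᶠ φ in nhds θ, a k φ * (c i φ * b j φ - c j φ * b i φ) +
        b k φ * (a i φ * c j φ - a j φ * c i φ) - c k φ * (a i φ * b j φ - a j φ * b i φ) = 0) :
    ∃ g : ℝ → ℂ, g θ = u ∧ (∀ᶠ φ in nhds θ, ContinuousAt g φ) ∧
      ∀ i ∈ J, ∀ᶠ φ in nhds θ, a i φ * (g φ).re + b i φ * (g φ).im = c i φ := by
  have hca := fun i => (ha i).continuous
  have hcb := fun i => (hb i).continuous
  have hcc := fun i => (hc i).continuous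
  by_cases h2 : ∃ i ∈ J, ∃ j ∈ J, a i θ * b j θ - a j θ * b i θ ≠ 0
  · -- rank two: Cramer's rule
    obtain ⟨i, hi, j, hj, hD⟩ := h2
    have hDc : Continuous fun φ => a i φ * b j φ - a j φ * b i φ :=
      ((hca i).mul (hcb j)).sub ((hca j).mul (hcb i))
    have hev : ∀ᶠ φ in nhds θ, a i φ * b j φ - a j φ * b i φ ≠ 0 :=
      hDc.continuousAt.eventually_ne hD
    refine ⟨fun φ => (((c i φ * b j φ - c j φ * b i φ) / (a i φ * b j φ - a j φ * b i φ) : ℝ) : ℂ) +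
      (((a i φ * c j φ - a j φ * c i φ) / (a i φ * b j φ - a j φ * b i φ) : ℝ) : ℂ) * Complex.I,
      ?_, ?_, ?_⟩
    · have e1 := hJ i hi
      have e2 := hJ j hj
      apply Complex.ext
      · simp only [Complex.add_re, Complex.ofReal_re, Complex.re_ofReal_mul, Complex.I_re, mul_zero,
          add_zero]
        rw [div_eq_iff hD, ← e1, ← e2]; ring
      · simp only [Complex.add_im, Complex.ofReal_im, Complex.im_ofReal_mul, Complex.I_im, mul_one,
          zero_add]
        rw [div_eq_iff hD, ← e1, ← e2]; ring
    · filter_upwards [hev] with φ hφ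
      have e1 : ContinuousAt (fun φ => (c i φ * b j φ - c j φ * b i φ) /
          (a i φ * b j φ - a j φ * b i φ)) φ :=
        (((hcc i).mul (hcb j)).sub ((hcc j).mul (hcb i))).continuousAt.div hDc.continuousAt hφ
      have e2 : ContinuousAt (fun φ => (a i φ * c j φ - a j φ * c i φ) /
          (a i φ * b j φ - a j φ * b i φ)) φ :=
        (((hca i).mul (hcc j)).sub ((hca j).mul (hcc i))).continuousAt.div hDc.continuousAt hφ
      exact (Complex.continuous_ofReal.continuousAt.comp e1).add
        ((Complex.continuous_ofReal.continuousAt.comp e2).mul continuousAt_const)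
    · intro k hk
      have e1 := hJ i hi
      have e2 := hJ j hj
      have e3 := hJ k hk
      filter_upwards [hev, gF i j k (by rw [← e1, ← e2, ← e3]; ring)] with φ hφ hF
      simp only [Complex.add_re, Complex.ofReal_re, Complex.re_ofReal_mul, Complex.I_re, mul_zero,
        add_zero, Complex.add_im, Complex.ofReal_im, Complex.im_ofReal_mul, Complex.I_im, mul_one,
        zero_add]
      rw [← mul_div_assoc, ← mul_div_assoc, ← add_div, div_eq_iff hφ]
      linarith
  push Not at h2
  by_cases h1 : ∃ i ∈ J, a i θ * a i θ + b i θ * b i θ ≠ 0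
  · -- rank one: correct `u` along the normal vector of one of the equations
    obtain ⟨i, hi, hN⟩ := h1
    have hNc : Continuous fun φ => a i φ * a i φ + b i φ * b i φ :=
      ((hca i).mul (hca i)).add ((hcb i).mul (hcb i))
    have hev : ∀ᶠ φ in nhds θ, a i φ * a i φ + b i φ * b i φ ≠ 0 :=
      hNc.continuousAt.eventually_ne hN
    set m : ℝ → ℝ := fun φ => (c i φ - a i φ * u.re - b i φ * u.im) /
      (a i φ * a i φ + b i φ * b i φ) with hm
    refine ⟨fun φ => u + (((m φ * a i φ : ℝ) : ℂ) + ((m φ * b i φ : ℝ) : ℂ) * Complex.I), ?_, ?_, ?_⟩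
    · have : m θ = 0 := by
        rw [hm]; simp only [← hJ i hi]; ring
      simp [this]
    · filter_upwards [hev] with φ hφ
      have e0 : ContinuousAt m φ :=
        (((hcc i).sub ((hca i).mul continuous_const)).sub
          ((hcb i).mul continuous_const)).continuousAt.div hNc.continuousAt hφ
      exact continuousAt_const.add ((Complex.continuous_ofReal.continuousAt.comp
        (e0.mul (hca i).continuousAt)).add ((Complex.continuous_ofReal.continuousAt.comp
        (e0.mul (hcb i).continuousAt)).mul continuousAt_const))
    · intro k hk
      have e1 := hJ i hi
      have e3 := hJ k hk
      have e4 := h2 i hi k hk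
      filter_upwards [hev, gD i k e4, gE i k (by
        rw [← e1, ← e3]
        linear_combination (a i θ * u.im - b i θ * u.re) * e4)] with φ hφ hD hE
      simp only [Complex.add_re, Complex.ofReal_re, Complex.re_ofReal_mul, Complex.I_re, mul_zero,
        add_zero, Complex.add_im, Complex.ofReal_im, Complex.im_ofReal_mul, Complex.I_im, mul_one,
        zero_add]
      have hmφ : m φ * (a i φ * a i φ + b i φ * b i φ) = c i φ - a i φ * u.re - b i φ * u.im :=
        div_mul_cancel₀ _ hφ
      apply mul_left_cancel₀ hφ
      linear_combination (a i φ * a k φ + b i φ * b k φ) * hmφ - hE -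
        (b i φ * u.re - a i φ * u.im) * hD
  · -- rank zero
    push Not at h1
    have h0 : ∀ i ∈ J, a i θ = 0 ∧ b i θ = 0 := fun i hi => by
      have := h1 i hi
      constructor <;> nlinarith [mul_self_nonneg (a i θ), mul_self_nonneg (b i θ)]
    refine ⟨fun _ => u, rfl, Filter.Eventually.of_forall fun φ => continuousAt_const, fun i hi => ?_⟩
    obtain ⟨h3, h4⟩ := h0 i hi
    have h5 := hJ i hi
    rw [h3, h4, zero_mul, zero_mul, add_zero] at h5
    filter_upwards [ga i h3, gb i h4, gc i h5.symm] with φ e1 e2 e3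
    rw [e1, e2, e3]; ring

/-- All but finitely many points of an analytically varying polyhedron are inner points of arcs.
At all but finitely many angles no minor of the system has an isolated zero, and an arc is obtained
by keeping the active inequalities active. In each of the other slices a point that lies on no arc
is determined by the set of its active inequalities. -/
lemma IsAnalyticPolyhedral.finite_not_inner {X : Set (ℂ × ℝ)} (hX : IsAnalyticPolyhedral X) :
    {p ∈ X | ¬ IsInnerPointOfArc X p}.Finite := by
  obtain ⟨ι, _, a, b, c, A, ha, hb, hc, hA, hAf, hX⟩ := hX
  set Z : (ℝ → ℝ) → Set ℝ := fun f => {θ ∈ angles | f θ = 0 ∧ ¬ ∀ᶠ φ in nhds θ, f φ = 0} with hZ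
  set D : ι → ι → ℝ → ℝ := fun i j φ => a i φ * b j φ - a j φ * b i φ
  set E : ι → ι → ℝ → ℝ := fun i j φ => (a i φ * a i φ + b i φ * b i φ) * c j φ -
    (a j φ * a i φ + b j φ * b i φ) * c i φ
  set F : ι → ι → ι → ℝ → ℝ := fun i j k φ => a k φ * (c i φ * b j φ - c j φ * b i φ) +
    b k φ * (a i φ * c j φ - a j φ * c i φ) - c k φ * (a i φ * b j φ - a j φ * b i φ)
  have hD : ∀ i j, IsAnalytic (D i j) := fun i j => ((ha i).mul (hb j)).sub ((ha j).mul (hb i))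
  have hE : ∀ i j, IsAnalytic (E i j) := fun i j =>
    ((((ha i).mul (ha i)).add ((hb i).mul (hb i))).mul (hc j)).sub
      ((((ha j).mul (ha i)).add ((hb j).mul (hb i))).mul (hc i))
  have hF : ∀ i j k, IsAnalytic (F i j k) := fun i j k =>
    (((ha k).mul (((hc i).mul (hb j)).sub ((hc j).mul (hb i)))).add
      ((hb k).mul (((ha i).mul (hc j)).sub ((ha j).mul (hc i))))).sub
      ((hc k).mul (((ha i).mul (hb j)).sub ((ha j).mul (hb i))))
  set B : Set ℝ := (A \ interior A) ∪ ((⋃ i, Z (a i)) ∪ (⋃ i, Z (b i)) ∪ (⋃ i, Z (c i)) ∪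
    (⋃ i, ⋃ j, Z (D i j)) ∪ (⋃ i, ⋃ j, Z (E i j)) ∪ ⋃ i, ⋃ j, ⋃ k, Z (F i j k)) with hB
  have hBf : B.Finite := by
    refine hAf.union (((((Set.Finite.union ?_ ?_).union ?_).union ?_).union ?_).union ?_)
    · exact finite_iUnion fun i => (ha i).finite_isolated_zeros
    · exact finite_iUnion fun i => (hb i).finite_isolated_zeros
    · exact finite_iUnion fun i => (hc i).finite_isolated_zeros
    · exact finite_iUnion fun i => finite_iUnion fun j => (hD i j).finite_isolated_zeros
    · exact finite_iUnion fun i => finite_iUnion fun j => (hE i j).finite_isolated_zeros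
    · exact finite_iUnion fun i => finite_iUnion fun j => finite_iUnion fun k =>
        (hF i j k).finite_isolated_zeros
  set act : ℂ × ℝ → Set ι := fun p => {i | a i p.2 * p.1.re + b i p.2 * p.1.im = c i p.2} with hact
  have hslice : ∀ p ∈ X, ¬ IsInnerPointOfArc X p → p.2 ∈ B := by
    rintro ⟨u, θ⟩ hp hn
    by_contra hcon
    apply hn
    obtain ⟨hθ, hineq⟩ := (hX _).1 hp
    simp only at hθ hineq hcon
    simp only [hB, mem_union, mem_iUnion, not_or, not_exists] at hcon
    obtain ⟨hint, ⟨⟨⟨⟨ka, kb⟩, kc⟩, kD⟩, kE⟩, kF⟩ := hcon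
    have good : ∀ f, θ ∉ Z f → f θ = 0 → ∀ᶠ φ in nhds θ, f φ = 0 := fun f hf h0 => by
      by_contra hc
      exact hf ⟨hA hθ, h0, hc⟩
    have hθint : θ ∈ interior A := by
      by_contra hc
      exact hint ⟨hθ, hc⟩
    obtain ⟨g, hg0, hgc, hg⟩ := exists_continuous_solution ha hb hc (J := act (u, θ)) (θ := θ) (u := u)
      (fun i hi => hi) (fun i => good _ (ka i)) (fun i => good _ (kb i)) (fun i => good _ (kc i))
      (fun i j => good _ (kD i j)) (fun i j => good _ (kE i j)) (fun i j k => good _ (kF i j k))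
    have hall : ∀ᶠ φ in nhds θ, ∀ i, a i φ * (g φ).re + b i φ * (g φ).im ≤ c i φ := by
      rw [Filter.eventually_all]
      intro i
      by_cases hi : i ∈ act (u, θ)
      · exact (hg i hi).mono fun φ hφ => hφ.le
      · have hlt : a i θ * u.re + b i θ * u.im < c i θ := lt_of_le_of_ne (hineq i) hi
        have hgθ : ContinuousAt g θ := hgc.self_of_nhds
        have h1 : ContinuousAt (fun φ => a i φ * (g φ).re + b i φ * (g φ).im) θ :=
          ((ha i).continuous.continuousAt.mul (Complex.continuous_re.continuousAt.comp hgθ)).add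
            ((hb i).continuous.continuousAt.mul (Complex.continuous_im.continuousAt.comp hgθ))
        have h2 := h1.eventually_lt (hc i).continuous.continuousAt (by simpa only [hg0] using hlt)
        exact h2.mono fun φ hφ => hφ.le
    obtain ⟨ε, hε, hball⟩ := Metric.eventually_nhds_iff.1
      ((hgc.and hall).and (mem_interior_iff_mem_nhds.1 hθint))
    have hin : ∀ t ∈ Ioo (-1 : ℝ) 1, dist (θ + ε * t) θ < ε := fun t ht => by
      rw [Real.dist_eq, add_sub_cancel_left, abs_mul, abs_of_pos hε]
      have : |t| < 1 := abs_lt.2 ht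
      nlinarith
    refine ⟨fun t => (g (θ + ε * t), θ + ε * t), ?_, ?_, ?_, ?_⟩
    · intro t ht
      have h1 := (hball (hin t ht)).1.1
      have h2 : ContinuousAt (fun t : ℝ => θ + ε * t) t := by fun_prop
      exact ((ContinuousAt.comp (f := fun t : ℝ => θ + ε * t) h1 h2).prodMk h2).continuousWithinAt
    · intro s _ t _ hst
      have := congrArg Prod.snd hst
      simp only [add_right_inj] at this
      exact mul_left_cancel₀ hε.ne' this
    · intro t ht
      have h1 := hball (hin t ht)
      exact (hX _).2 ⟨h1.2, h1.1.2⟩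
    · simp [hg0]
  have hinj : InjOn (fun p : ℂ × ℝ => (p.2, act p)) {p ∈ X | ¬ IsInnerPointOfArc X p} := by
    rintro ⟨u, θ⟩ ⟨hp, hn⟩ ⟨v, θ'⟩ ⟨hq, -⟩ heq
    obtain ⟨rfl, hactEq⟩ := Prod.mk.inj heq
    by_contra hne
    have huv : v - u ≠ 0 := fun h => hne (by rw [sub_eq_zero.1 h])
    apply hn
    obtain ⟨hθ, hineq⟩ := (hX _).1 hp
    simp only at hθ hineq
    have hline : ∀ᶠ s : ℝ in nhds 0, ∀ i,
        a i θ * (u + s • (v - u)).re + b i θ * (u + s • (v - u)).im ≤ c i θ := by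
      rw [Filter.eventually_all]
      intro i
      by_cases hi : i ∈ act (u, θ)
      · have hi' : i ∈ act (v, θ) := by rw [← hactEq]; exact hi
        refine Filter.Eventually.of_forall fun s => le_of_eq ?_
        simp only [hact, mem_ofPred_eq] at hi hi'
        simp only [Complex.add_re, Complex.add_im, Complex.real_smul, Complex.re_ofReal_mul,
          Complex.im_ofReal_mul, Complex.sub_re, Complex.sub_im]
        linear_combination (1 - s) * hi + s * hi'
      · have hlt : a i θ * u.re + b i θ * u.im < c i θ := lt_of_le_of_ne (hineq i) hi
        have h1 : Continuous fun s : ℝ => a i θ * (u + s • (v - u)).re + b i θ * (u + s • (v - u)).im := by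
          fun_prop
        have h2 := (h1.continuousAt (x := 0)).eventually_lt (continuousAt_const (y := c i θ)) (by simpa using hlt)
        exact h2.mono fun s hs => le_of_lt hs
    obtain ⟨ε, hε, hball⟩ := Metric.eventually_nhds_iff.1 hline
    refine ⟨fun t => (u + (ε * t) • (v - u), θ), ?_, ?_, ?_, ?_⟩
    · apply Continuous.continuousOn; fun_prop
    · intro s _ t _ hst
      have h1 := congrArg Prod.fst hst
      simp only [add_right_inj] at h1
      exact mul_left_cancel₀ hε.ne' (smul_left_injective ℝ huv h1)
    · intro t ht
      refine (hX _).2 ⟨hθ, hball ?_⟩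
      rw [Real.dist_eq, sub_zero, abs_mul, abs_of_pos hε]
      have : |t| < 1 := abs_lt.2 ht
      nlinarith
    · simp
  exact Set.Finite.of_injOn (t := B ×ˢ (univ : Set (Set ι)))
    (fun p hp => ⟨hslice p hp.1 hp.2, mem_univ _⟩) hinj (hBf.prod finite_univ)

/-! ### The surfaces are analytically varying polyhedra -/

/-- At a boundary point of a set of angles that is defined by finitely many analytic inequalities,
one of the functions has an isolated zero. -/
lemma finite_diff_interior_of_nonneg {κ : Type*} [Finite κ] {f : κ → ℝ → ℝ}
    (hf : ∀ i, IsAnalytic (f i)) :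
    ({θ ∈ angles | ∀ i, 0 ≤ f i θ} \ interior {θ ∈ angles | ∀ i, 0 ≤ f i θ}).Finite := by
  refine (((finite_singleton (0 : ℝ)).union (finite_singleton (Real.pi / 3))).union
    (finite_iUnion fun i => (hf i).finite_isolated_zeros)).subset ?_
  rintro θ ⟨⟨hθ, h0⟩, hint⟩
  by_contra hcon
  simp only [mem_union, mem_singleton_iff, mem_iUnion, not_or, not_exists] at hcon
  obtain ⟨⟨h1, h2⟩, h3⟩ := hcon
  apply hint
  rw [mem_interior_iff_mem_nhds]
  have h4 : ∀ᶠ φ in nhds θ, φ ∈ angles :=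
    Icc_mem_nhds (lt_of_le_of_ne hθ.1 (Ne.symm h1)) (lt_of_le_of_ne hθ.2 h2)
  have h5 : ∀ᶠ φ in nhds θ, ∀ i, 0 ≤ f i φ := by
    rw [Filter.eventually_all]
    intro i
    rcases eq_or_lt_of_le (h0 i) with h | h
    · have : ∀ᶠ φ in nhds θ, f i φ = 0 := by
        by_contra hc
        exact h3 i ⟨hθ, h.symm, hc⟩
      exact this.mono fun φ hφ => hφ.ge
    · exact ((hf i).continuous.continuousAt.eventually (lt_mem_nhds h)).mono fun φ hφ => le_of_lt hφ
  exact h4.and h5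

/-- A plane curve with analytic coordinates. -/
def IsAnalyticCurve (P : ℝ → ℂ) : Prop :=
  IsAnalytic (fun θ => (P θ).re) ∧ IsAnalytic fun θ => (P θ).im

lemma IsAnalyticCurve.sub {P Q : ℝ → ℂ} (hP : IsAnalyticCurve P) (hQ : IsAnalyticCurve Q) :
    IsAnalyticCurve fun θ => P θ - Q θ := ⟨hP.1.sub hQ.1, hP.2.sub hQ.2⟩

lemma isAnalyticCurve_const (z : ℂ) : IsAnalyticCurve fun _ => z :=
  ⟨isAnalytic_const _, isAnalytic_const _⟩

lemma isAnalyticCurve_rot_mul (a : ℂ) : IsAnalyticCurve fun θ => rot θ * a := by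
  have hcos : IsAnalytic Real.cos := fun θ => Real.analyticAt_cos
  have hsin : IsAnalytic Real.sin := fun θ => Real.analyticAt_sin
  constructor
  · simp only [Complex.mul_re, rot_re, rot_im]
    exact (hcos.mul (isAnalytic_const _)).sub (hsin.mul (isAnalytic_const _))
  · simp only [Complex.mul_im, rot_re, rot_im]
    exact (hcos.mul (isAnalytic_const _)).add (hsin.mul (isAnalytic_const _))

lemma isAnalyticCurve_corner (x a : ℂ) (i : ℤ) : IsAnalyticCurve (corner x a i) :=
  (isAnalyticCurve_const _).sub (isAnalyticCurve_rot_mul a)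

lemma IsAnalyticCurve.cross {P Q : ℝ → ℂ} (hP : IsAnalyticCurve P) (hQ : IsAnalyticCurve Q) :
    IsAnalytic fun θ => cross (P θ) (Q θ) := (hP.1.mul hQ.2).sub (hP.2.mul hQ.1)

lemma isAnalyticPolyhedral_segment {P Q : ℝ → ℂ} (hP : IsAnalyticCurve P) (hQ : IsAnalyticCurve Q)
    (hPQ : ∀ θ, P θ ≠ Q θ) {A : Set ℝ} (hA : A ⊆ angles) (hAf : (A \ interior A).Finite) :
    IsAnalyticPolyhedral {p : ℂ × ℝ | p.2 ∈ A ∧ p.1 ∈ segment ℝ (P p.2) (Q p.2)} := by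
  obtain ⟨hdx, hdy⟩ := hQ.sub hP
  obtain ⟨hx, hy⟩ := hP
  set dx : ℝ → ℝ := fun θ => (Q θ - P θ).re
  set dy : ℝ → ℝ := fun θ => (Q θ - P θ).im
  set x : ℝ → ℝ := fun θ => (P θ).re
  set y : ℝ → ℝ := fun θ => (P θ).im
  refine ⟨Fin 4, inferInstance,
    ![fun θ => -dy θ, dy, fun θ => -dx θ, dx],
    ![dx, fun θ => -dx θ, fun θ => -dy θ, dy],
    ![fun θ => dx θ * y θ - dy θ * x θ, fun θ => -(dx θ * y θ - dy θ * x θ),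
      fun θ => -(dx θ * x θ + dy θ * y θ),
      fun θ => (dx θ * x θ + dy θ * y θ) + (dx θ * dx θ + dy θ * dy θ)], A, ?_, ?_, ?_, hA, hAf, ?_⟩
  · intro i; fin_cases i
    exacts [hdy.neg, hdy, hdx.neg, hdx]
  · intro i; fin_cases i
    exacts [hdx, hdx.neg, hdy.neg, hdy]
  · intro i; fin_cases i
    · exact (hdx.mul hy).sub (hdy.mul hx)
    · exact ((hdx.mul hy).sub (hdy.mul hx)).neg
    · exact ((hdx.mul hx).add (hdy.mul hy)).neg
    · exact ((hdx.mul hx).add (hdy.mul hy)).add ((hdx.mul hdx).add (hdy.mul hdy))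
  · rintro ⟨u, θ⟩
    simp only [mem_ofPred_eq, mem_segment_iff_ineq (hPQ θ)]
    refine and_congr_right fun _ => ?_
    have e1 : (u - P θ).re = u.re - x θ := rfl
    have e2 : (u - P θ).im = u.im - y θ := rfl
    have e3 : (Q θ - P θ).re = dx θ := rfl
    have e4 : (Q θ - P θ).im = dy θ := rfl
    rw [HexCover.cross, e1, e2, e3, e4]
    constructor
    · rintro ⟨h1, h2, h3⟩ i
      fin_cases i <;> simp <;> linarith
    · intro h
      have h0 := h 0
      have h1 := h 1
      have h2 := h 2
      have h3 := h 3
      simp at h0 h1 h2 h3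
      exact ⟨by linarith, by linarith, by linarith⟩

lemma isAnalyticPolyhedral_hexagon_prod {A : Set ℝ} (hA : A ⊆ angles)
    (hAf : (A \ interior A).Finite) : IsAnalyticPolyhedral (hexagon ×ˢ A) := by
  refine ⟨Fin 6, inferInstance,
    fun i _ => (![1, -1, 1, -1, 1, -1] : Fin 6 → ℝ) i,
    fun i _ => (![0, 0, Real.sqrt 3, -Real.sqrt 3, -Real.sqrt 3, Real.sqrt 3] : Fin 6 → ℝ) i,
    fun i _ => (![Real.sqrt 3 / 2, Real.sqrt 3 / 2, Real.sqrt 3, Real.sqrt 3, Real.sqrt 3,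
      Real.sqrt 3] : Fin 6 → ℝ) i, A, fun i => isAnalytic_const _, fun i => isAnalytic_const _,
      fun i => isAnalytic_const _, hA, hAf, ?_⟩
  rintro ⟨u, θ⟩
  simp only [mem_prod, mem_hexagon_iff, abs_le]
  rw [and_comm]
  refine and_congr_right fun _ => ?_
  constructor
  · rintro ⟨⟨h1, h2⟩, ⟨h3, h4⟩, h5, h6⟩ i
    fin_cases i <;> simp <;> linarith
  · intro h
    have h0 := h 0
    have h1 := h 1
    have h2 := h 2
    have h3 := h 3
    have h4 := h 4
    have h5 := h 5
    simp at h0 h1 h2 h3 h4 h5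
    refine ⟨⟨?_, ?_⟩, ⟨?_, ?_⟩, ?_, ?_⟩ <;> linarith

lemma finite_angles_diff_interior : (angles \ interior angles).Finite := by
  have h : ((Icc 0 (Real.pi / 3) : Set ℝ) \ Ioo 0 (Real.pi / 3)).Finite := by
    rw [Icc_sdiff_Ioo_same (by positivity)]
    exact toFinite _
  rwa [← interior_Icc] at h

/-- At a given angle the segment of a wall is on the boundary of the body iff all corners are on the
same side of its line; for each side these are finitely many analytic conditions on the angle. -/
lemma IsWall.isAnalyticPolyhedral (h : IsConvexPolygon Ω) {x : ℂ} {S : Set (ℂ × ℝ)}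
    (hS : IsWall Ω x S) : IsAnalyticPolyhedral S := by
  obtain ⟨a, b, i, j, hI, rfl⟩ := hS
  obtain ⟨V, hV⟩ := h.1
  have hP := isAnalyticCurve_corner x a i
  have hQ := isAnalyticCurve_corner x b j
  have hne := hI.corner_ne x
  have haT := fun θ => corner_mem_minkowski hI.left_mem (x := x) i θ
  have hbT := fun θ => corner_mem_minkowski hI.right_mem (x := x) j θ
  set P := corner x a i
  set Q := corner x b j
  have hsegT : ∀ θ, segment ℝ (P θ) (Q θ) ⊆ minkowski Ω x θ := fun θ =>
    (convex_minkowski h x θ).segment_subset (haT θ) (hbT θ)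
  set A : Set ℝ := {θ ∈ angles | segment ℝ (P θ) (Q θ) ⊆ frontier (minkowski Ω x θ)} with hA
  set κ := ↥V × ↥(range hexVertex)
  have : Finite (range hexVertex) := finite_range_hexVertex
  set f : κ → ℝ → ℝ := fun k θ => cross (Q θ - P θ) ((x + (k.2 : ℂ) - rot θ * (k.1 : ℂ)) - P θ) with hf
  have hfa : ∀ k, IsAnalytic (f k) := fun k => (hQ.sub hP).cross
    (((isAnalyticCurve_const _).sub (isAnalyticCurve_rot_mul _)).sub hP)
  have hAeq : A = {θ ∈ angles | ∀ k, 0 ≤ f k θ} ∪ {θ ∈ angles | ∀ k, 0 ≤ -f k θ} := by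
    have key : ∀ (c : ℂ) θ, (∀ w ∈ minkowski Ω x θ, 0 ≤ cross c (w - P θ)) ↔
        ∀ k : κ, 0 ≤ cross c ((x + (k.2 : ℂ) - rot θ * (k.1 : ℂ)) - P θ) := fun c θ => by
      rw [forall_minkowski_cross_iff hV]
      constructor
      · rintro hall ⟨⟨v, hv⟩, _, l, rfl⟩
        exact hall v hv l
      · exact fun hall v hv l => hall (⟨v, hv⟩, ⟨_, l, rfl⟩)
    have hfront : ∀ θ, segment ℝ (P θ) (Q θ) ⊆ frontier (minkowski Ω x θ) ↔
        (∀ w ∈ minkowski Ω x θ, 0 ≤ cross (Q θ - P θ) (w - P θ)) ∨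
        ∀ w ∈ minkowski Ω x θ, 0 ≤ cross (-(Q θ - P θ)) (w - P θ) := fun θ => by
      have hd : Q θ - P θ ≠ 0 := sub_ne_zero.2 (hne θ).symm
      have hl := left_mem_segment ℝ (P θ) (Q θ)
      constructor
      · intro hs
        rcases side_of_segment (convex_minkowski h x θ) (interior_minkowski_nonempty h x θ) (hne θ)
          (hsegT θ) (fun v hv => ((mem_frontier_minkowski h).1 (hs hv)).2) hl with h1 | h1
        · exact Or.inl h1
        · right
          intro w hw
          rw [cross_neg_left]
          linarith [h1 w hw]
      · intro hs v hv
        have h0 := cross_eq_zero_of_mem_segment hv hl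
        refine (mem_frontier_minkowski h).2 ⟨hsegT θ hv, ?_⟩
        rcases hs with h1 | h1
        · exact notMem_interior_of_support hd h1 h0.le
        · exact notMem_interior_of_support (neg_ne_zero.2 hd) h1 (by rw [cross_neg_left, h0, neg_zero])
    ext θ
    simp only [hA, mem_ofPred_eq, mem_union, hfront, key]
    simp only [cross_neg_left, hf]
    tauto
  have hAf : (A \ interior A).Finite := by
    rw [hAeq]
    refine ((finite_diff_interior_of_nonneg hfa).union
      (finite_diff_interior_of_nonneg fun k => (hfa k).neg)).subset ?_
    rintro θ ⟨h1 | h1, h2⟩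
    · exact Or.inl ⟨h1, fun h3 => h2 (interior_mono subset_union_left h3)⟩
    · exact Or.inr ⟨h1, fun h3 => h2 (interior_mono subset_union_right h3)⟩
  have := isAnalyticPolyhedral_segment hP hQ hne (A := A) (fun θ hθ => hθ.1) hAf
  convert this using 1
  ext q
  rw [mem_wall]
  simp only [hA, mem_ofPred_eq]
  tauto

lemma isAnalyticPolyhedral_prism : IsAnalyticPolyhedral prism :=
  isAnalyticPolyhedral_hexagon_prod Subset.rfl finite_angles_diff_interior

lemma zero_mem_angles : (0 : ℝ) ∈ angles := ⟨le_rfl, by positivity⟩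

lemma pi_div_three_mem_angles : Real.pi / 3 ∈ angles := ⟨by positivity, le_rfl⟩

lemma IsSurface.isAnalyticPolyhedral (h : IsConvexPolygon Ω) {S : Set (ℂ × ℝ)}
    (hS : IsSurface Ω S) : IsAnalyticPolyhedral S := by
  rcases hS.cases with ⟨x, -, hS⟩ | ⟨k, rfl⟩ | rfl | rfl
  · exact hS.isAnalyticPolyhedral h
  · have := isAnalyticPolyhedral_segment (isAnalyticCurve_const (hexVertex k))
      (isAnalyticCurve_const (hexVertex (k + 1))) (fun _ => hexVertex_ne_succ k) Subset.rfl
      finite_angles_diff_interior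
    convert this using 1
    ext q
    exact and_comm
  · exact isAnalyticPolyhedral_hexagon_prod (singleton_subset_iff.2 zero_mem_angles)
      ((finite_singleton _).subset sdiff_subset)
  · exact isAnalyticPolyhedral_hexagon_prod (singleton_subset_iff.2 pi_div_three_mem_angles)
      ((finite_singleton _).subset sdiff_subset)

lemma finite_gridPoints (Ω : Set ℂ) : (gridPoints Ω).Finite := finite_lattice_inter _

lemma finite_setOf_isWall (h : IsConvexPolygon Ω) (x : ℂ) : {S | IsWall Ω x S}.Finite := by
  have hfin := h.finite_extremePoints
  have hZ : (Icc (0 : ℤ) 6).Finite := finite_Icc _ _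
  refine ((((hfin.prod hfin).prod (hZ.prod hZ)).image
    (fun q : (ℂ × ℂ) × ℤ × ℤ => wall Ω x q.1.1 q.1.2 q.2.1 q.2.2))).subset ?_
  rintro _ ⟨a, b, i, j, hI, rfl⟩
  have ha : a ∈ extremePoints ℝ Ω := by
    rcases hI with ⟨h, -⟩ | ⟨-, h, -⟩
    exacts [h.2.1, h]
  have hb : b ∈ extremePoints ℝ Ω := by
    rcases hI with ⟨h, -⟩ | ⟨rfl, h, -⟩
    exacts [h.2.2.1, h]
  have hmod : ∀ k : ℤ, k % 6 ∈ Icc (0 : ℤ) 6 := fun k =>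
    ⟨Int.emod_nonneg k (by norm_num), (Int.emod_lt_of_pos k (by norm_num)).le⟩
  refine ⟨((a, b), (i % 6, j % 6)), ⟨⟨ha, hb⟩, hmod i, hmod j⟩, ?_⟩
  have hcorner : ∀ c k, corner x c (k % 6) = corner x c k := fun c k => by
    funext θ; rw [corner, corner, hexVertex_emod_six]
  simp only [wall, hcorner]

lemma hexEdge_emod_six (k : ℤ) : hexEdge (k % 6) = hexEdge k := by
  have : hexVertex (k % 6 + 1) = hexVertex (k + 1) := by
    rw [hexVertex_succ, hexVertex_succ, hexVertex_emod_six]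
  rw [hexEdge, hexEdge, this, hexVertex_emod_six]

lemma finite_setOf_isSurface (h : IsConvexPolygon Ω) : {S | IsSurface Ω S}.Finite := by
  refine ((((finite_gridPoints Ω).biUnion fun x _ => finite_setOf_isWall h x).union
    ((finite_Icc (0 : ℤ) 6).image fun k => hexEdge k ×ˢ angles)).union
    (toFinite {hexagon ×ˢ {0}, hexagon ×ˢ {Real.pi / 3}})).subset ?_
  intro S hS
  rcases IsSurface.cases hS with ⟨x, hx, hS⟩ | ⟨k, rfl⟩ | rfl | rfl
  · exact Or.inl (Or.inl (mem_biUnion hx hS))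
  · exact Or.inl (Or.inr ⟨k % 6, ⟨Int.emod_nonneg k (by norm_num),
      (Int.emod_lt_of_pos k (by norm_num)).le⟩, by simp only [hexEdge_emod_six]⟩)
  · exact Or.inr (Or.inl rfl)
  · exact Or.inr (Or.inr rfl)

theorem finite_vertexPoints (h : IsConvexPolygon Ω) : (vertexPoints Ω).Finite := by
  have hf := finite_setOf_isSurface h
  have hT : {X | IsTripleIntersection Ω X}.Finite := by
    refine (((hf.prod (hf.prod hf))).image (fun q => q.1 ∩ q.2.1 ∩ q.2.2 ∩ prism)).subset ?_
    rintro X ⟨S₁, S₂, S₃, h1, h2, h3, -, -, -, rfl⟩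
    exact ⟨(S₁, S₂, S₃), ⟨h1, h2, h3⟩, rfl⟩
  refine (hT.biUnion (t := fun X => {p ∈ X | ¬ IsInnerPointOfArc X p}) ?_).subset ?_
  · rintro X ⟨S₁, S₂, S₃, h1, h2, h3, -, -, -, rfl⟩
    exact (((h1.isAnalyticPolyhedral h).inter (h2.isAnalyticPolyhedral h)).inter
      (h3.isAnalyticPolyhedral h)).inter isAnalyticPolyhedral_prism |>.finite_not_inner
  · rintro p ⟨X, hX, hp, hn⟩
    exact mem_biUnion (show X ∈ {X | IsTripleIntersection Ω X} from hX) ⟨hp, hn⟩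

/-! ### Lateral surfaces through a point -/

/-- `S` is a wall of one of the bodies or a lateral face of the prism. -/
def IsLateral (Ω : Set ℂ) (S : Set (ℂ × ℝ)) : Prop :=
  (∃ x ∈ gridPoints Ω, IsWall Ω x S) ∨ ∃ k, S = hexEdge k ×ˢ angles

lemma IsLateral.isSurface {S : Set (ℂ × ℝ)} (h : IsLateral Ω S) : IsSurface Ω S := by
  rcases h with ⟨x, hx, h⟩ | ⟨k, rfl⟩
  · exact h.isSurface hx
  · exact IsSurface.prismSide k

/-- The nonempty slices of `S` are the segments `[P θ, Q θ]`, which never degenerate. -/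
def IsSwept (S : Set (ℂ × ℝ)) (P Q : ℝ → ℂ) : Prop :=
  Continuous P ∧ Continuous Q ∧ (∀ θ, P θ ≠ Q θ) ∧
    ∀ q ∈ S, ∀ v, (v, q.2) ∈ S ↔ v ∈ segment ℝ (P q.2) (Q q.2)

lemma IsSwept.mem {S : Set (ℂ × ℝ)} {P Q : ℝ → ℂ} (h : IsSwept S P Q) {q : ℂ × ℝ} (hq : q ∈ S) :
    q.1 ∈ segment ℝ (P q.2) (Q q.2) := (h.2.2.2 q hq q.1).1 hq

lemma isSwept_wall {a b x : ℂ} {i j : ℤ} (hI : IsWallIndex Ω a b i j) :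
    IsSwept (wall Ω x a b i j) (corner x a i) (corner x b j) := by
  refine ⟨continuous_corner _ _ _, continuous_corner _ _ _, hI.corner_ne x, fun q hq v => ?_⟩
  rw [mem_wall] at *
  exact ⟨fun h => h.2.1, fun h => ⟨hq.1, h, hq.2.2⟩⟩

lemma isSwept_side (k : ℤ) :
    IsSwept (hexEdge k ×ˢ angles) (fun _ => hexVertex k) (fun _ => hexVertex (k + 1)) :=
  ⟨continuous_const, continuous_const, fun _ => hexVertex_ne_succ k,
    fun _ hq _ => ⟨fun h => h.1, fun h => ⟨h, hq.2⟩⟩⟩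

lemma IsLateral.exists_isSwept {S : Set (ℂ × ℝ)} (h : IsLateral Ω S) : ∃ P Q, IsSwept S P Q := by
  rcases h with ⟨x, hx, a, b, i, j, hI, rfl⟩ | ⟨k, rfl⟩
  · exact ⟨_, _, isSwept_wall hI⟩
  · exact ⟨_, _, isSwept_side k⟩

lemma IsSwept.segment_eq {S : Set (ℂ × ℝ)} {P Q P' Q' : ℝ → ℂ} (h : IsSwept S P Q)
    (h' : IsSwept S P' Q') {q : ℂ × ℝ} (hq : q ∈ S) :
    segment ℝ (P q.2) (Q q.2) = segment ℝ (P' q.2) (Q' q.2) := by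
  ext v; rw [← h.2.2.2 q hq, ← h'.2.2.2 q hq]

lemma IsSwept.cross_eq_zero {S : Set (ℂ × ℝ)} {P Q P' Q' : ℝ → ℂ} (h : IsSwept S P Q)
    (h' : IsSwept S P' Q') {q : ℂ × ℝ} (hq : q ∈ S) :
    cross (Q q.2 - P q.2) (Q' q.2 - P' q.2) = 0 := by
  have he := h.segment_eq h' hq
  exact cross_eq_zero_of_mem_segment (he ▸ right_mem_segment ℝ _ _) (he ▸ left_mem_segment ℝ _ _)

lemma IsWall.subset_frontier {x : ℂ} {S : Set (ℂ × ℝ)} (hS : IsWall Ω x S) {q : ℂ × ℝ}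
    (hq : q ∈ S) : q.1 ∈ frontier (minkowski Ω x q.2) := by
  obtain ⟨a, b, i, j, hI, rfl⟩ := hS
  exact hq.2.2 hq.2.1

lemma IsWall.notMem_interior (h : IsConvexPolygon Ω) {x : ℂ} {S : Set (ℂ × ℝ)} (hS : IsWall Ω x S)
    {q : ℂ × ℝ} (hq : q ∈ S) : q.1 ∉ interior (minkowski Ω x q.2) :=
  ((mem_frontier_minkowski h).1 (hS.subset_frontier hq)).2

/-- A slice of a body lies on one side of each of its walls. -/
lemma IsWall.side (h : IsConvexPolygon Ω) {x : ℂ} {S : Set (ℂ × ℝ)} (hS : IsWall Ω x S)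
    {P Q : ℝ → ℂ} (hPQ : IsSwept S P Q) {p : ℂ × ℝ} (hp : p ∈ S) :
    (∀ w ∈ minkowski Ω x p.2, 0 ≤ cross (Q p.2 - P p.2) (w - p.1)) ∨
      ∀ w ∈ minkowski Ω x p.2, cross (Q p.2 - P p.2) (w - p.1) ≤ 0 := by
  have hfr : ∀ v ∈ segment ℝ (P p.2) (Q p.2), v ∈ frontier (minkowski Ω x p.2) := fun v hv =>
    hS.subset_frontier ((hPQ.2.2.2 p hp v).2 hv)
  exact side_of_segment (convex_minkowski h x p.2) (interior_minkowski_nonempty h x p.2)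
    (hPQ.2.2.1 p.2) (fun v hv => ((mem_frontier_minkowski h).1 (hfr v hv)).1)
    (fun v hv => ((mem_frontier_minkowski h).1 (hfr v hv)).2) (hPQ.mem hp)

/-- The lateral surfaces that contain `p` and, unless `p` is on the bottom of the prism, reach `p`
from below. -/
def surfacesAt (Ω : Set ℂ) (p : ℂ × ℝ) : Set (Set (ℂ × ℝ)) :=
  {S | IsLateral Ω S ∧ p ∈ S ∧ (0 < p.2 → p ∈ closure (S ∩ {q | q.2 < p.2}))}

lemma finite_surfacesAt (h : IsConvexPolygon Ω) (p : ℂ × ℝ) : (surfacesAt Ω p).Finite :=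
  (finite_setOf_isSurface h).subset fun _ hS => hS.1.isSurface

lemma eventually_mem_angles {θ : ℝ} (hθ : θ ∈ angles) (h0 : 0 < θ) :
    ∀ᶠ φ in nhdsWithin θ (Iio θ), φ ∈ angles := by
  filter_upwards [nhdsWithin_le_nhds (lt_mem_nhds h0), self_mem_nhdsWithin] with φ h1 h2
  exact ⟨le_of_lt h1, (le_of_lt h2).trans hθ.2⟩

lemma side_mem_surfacesAt {p : ℂ × ℝ} {k : ℤ} (hk : p.1 ∈ hexEdge k) (hp : p.2 ∈ angles) :
    hexEdge k ×ˢ angles ∈ surfacesAt Ω p := by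
  refine ⟨Or.inr ⟨k, rfl⟩, ⟨hk, hp⟩, fun h0 => ?_⟩
  have hlim : Filter.Tendsto (fun φ : ℝ => (p.1, φ)) (nhdsWithin p.2 (Iio p.2)) (nhds p) := by
    have : Continuous fun φ : ℝ => (p.1, φ) := by fun_prop
    exact (this.tendsto p.2).mono_left nhdsWithin_le_nhds
  refine mem_closure_of_tendsto hlim ?_
  filter_upwards [eventually_mem_angles hp h0, self_mem_nhdsWithin] with φ h1 h2
  exact ⟨⟨hk, h1⟩, h2⟩

/-- The boundary points of a body are limits of boundary points at lower angles. -/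
lemma mem_closure_frontier (h : IsConvexPolygon Ω) {x : ℂ} {p : ℂ × ℝ} (hp : p.2 ∈ angles)
    (h0 : 0 < p.2) (hfr : p.1 ∈ frontier (minkowski Ω x p.2)) :
    p ∈ closure {q : ℂ × ℝ | q.2 ∈ angles ∧ q.1 ∈ frontier (minkowski Ω x q.2) ∧ q.2 < p.2} := by
  obtain ⟨u, θ⟩ := p
  simp only at hp h0 hfr
  rw [Metric.mem_closure_iff]
  intro r hr
  have hball : Metric.ball u r ∈ nhds u := Metric.ball_mem_nhds u hr
  have h1 : u ∈ closure (interior (minkowski Ω x θ)) := by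
    rw [(convex_minkowski h x θ).closure_interior_eq_closure_of_nonempty_interior
      (interior_minkowski_nonempty h x θ)]
    exact frontier_subset_closure hfr
  have h2 : u ∈ closure (minkowski Ω x θ)ᶜ := by
    rw [frontier_eq_closure_inter_closure] at hfr
    exact hfr.2
  obtain ⟨w₁, hw₁b, hw₁⟩ := mem_closure_iff_nhds.1 h1 _ hball
  obtain ⟨w₂, hw₂b, hw₂⟩ := mem_closure_iff_nhds.1 h2 _ hball
  have e1 : ∀ᶠ φ in nhds θ, w₁ ∈ interior (minkowski Ω x φ) :=
    ((isOpen_setOf_mem_interior_minkowski h x).preimage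
      (f := fun φ : ℝ => (w₁, φ)) (by fun_prop)).mem_nhds hw₁
  have e2 : ∀ᶠ φ in nhds θ, w₂ ∉ minkowski Ω x φ :=
    ((isClosed_setOf_mem_minkowski h x).isOpen_compl.preimage
      (f := fun φ : ℝ => (w₂, φ)) (by fun_prop)).mem_nhds hw₂
  have e3 : ∀ᶠ φ in nhds θ, dist θ φ < r := by
    filter_upwards [Metric.ball_mem_nhds θ hr] with φ hφ
    rw [dist_comm]; exact hφ
  obtain ⟨φ, ⟨⟨⟨k1, k2⟩, k3⟩, k4⟩, k5⟩ :=
    (((((e1.and e2).and e3).filter_mono nhdsWithin_le_nhds).and (eventually_mem_angles hp h0)).and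
      self_mem_nhdsWithin).exists
  have hseg : (segment ℝ w₁ w₂ ∩ frontier (minkowski Ω x φ)).Nonempty := by
    by_contra hcon
    rw [not_nonempty_iff_eq_empty] at hcon
    have hcov : segment ℝ w₁ w₂ ⊆ interior (minkowski Ω x φ) ∪ (minkowski Ω x φ)ᶜ := by
      intro w hw
      by_contra hc
      simp only [mem_union, mem_compl_iff, not_or, not_not] at hc
      exact hcon.subset ⟨hw, (mem_frontier_minkowski h).2 ⟨hc.2, hc.1⟩⟩
    obtain ⟨w, -, hw1, hw2⟩ := (convex_segment w₁ w₂).isPreconnected _ _ isOpen_interior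
      (isClosed_minkowski h x φ).isOpen_compl hcov ⟨w₁, left_mem_segment ℝ _ _, k1⟩
      ⟨w₂, right_mem_segment ℝ _ _, k2⟩
    exact hw2 (interior_subset hw1)
  obtain ⟨w, hw, hwf⟩ := hseg
  refine ⟨(w, φ), ⟨k4, hwf, k5⟩, ?_⟩
  have hwb : w ∈ Metric.ball u r := (convex_ball u r).segment_subset hw₁b hw₂b hw
  rw [Prod.dist_eq, max_lt_iff]
  exact ⟨by rw [dist_comm]; exact hwb, k3⟩

/-- As the walls are finitely many and closed, one of them contains boundary points at lower angles
that tend to `p`. -/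
lemma exists_wall_mem_surfacesAt (h : IsConvexPolygon Ω) {x : ℂ} (hx : x ∈ gridPoints Ω)
    {p : ℂ × ℝ} (hp : p.2 ∈ angles) (hfr : p.1 ∈ frontier (minkowski Ω x p.2)) :
    ∃ S ∈ surfacesAt Ω p, IsWall Ω x S := by
  rcases eq_or_lt_of_le hp.1 with h0 | h0
  · obtain ⟨S, hS, hpS⟩ := exists_wall_of_mem_frontier h hp hfr
    exact ⟨S, ⟨Or.inl ⟨x, hx, hS⟩, hpS, fun h1 => absurd h0 h1.ne⟩, hS⟩
  · have hsub : {q : ℂ × ℝ | q.2 ∈ angles ∧ q.1 ∈ frontier (minkowski Ω x q.2) ∧ q.2 < p.2} ⊆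
        ⋃ S ∈ {S | IsWall Ω x S}, S ∩ {q | q.2 < p.2} := by
      rintro ⟨u, θ⟩ ⟨h1, h2, h3⟩
      obtain ⟨S, hS, hpS⟩ := exists_wall_of_mem_frontier h h1 h2
      exact mem_biUnion (show S ∈ {S | IsWall Ω x S} from hS) ⟨hpS, h3⟩
    have hcl := closure_mono hsub (mem_closure_frontier h hp h0 hfr)
    rw [(finite_setOf_isWall h x).closure_biUnion] at hcl
    obtain ⟨S, hS, hpS⟩ := mem_iUnion₂.1 hcl
    have hS : IsWall Ω x S := hS
    have hmem : p ∈ S := by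
      have := closure_mono inter_subset_left hpS
      rwa [(hS.isClosed h).closure_eq] at this
    exact ⟨S, ⟨Or.inl ⟨x, hx, hS⟩, hmem, fun _ => hpS⟩, hS⟩

/-- Two corners that agree at two angles come from the same vertex of the tiling. -/
lemma corner_eq_of_two {x y a a' : ℂ} {i i' : ℤ} {θ φ : ℝ} (hθ : θ ∈ angles) (hφ : φ ∈ angles)
    (hne : θ ≠ φ) (h1 : corner x a i θ = corner y a' i' θ)
    (h2 : corner x a i φ = corner y a' i' φ) : x + hexVertex i = y + hexVertex i' := by
  have hrot : rot θ ≠ rot φ := by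
    intro he
    have hre := congrArg Complex.re he
    rw [rot_re, rot_re] at hre
    have hpi := Real.pi_pos
    exact hne (Real.injOn_cos ⟨hθ.1, by linarith [hθ.2]⟩ ⟨hφ.1, by linarith [hφ.2]⟩ hre)
  simp only [corner] at h1 h2
  have h3 : (rot θ - rot φ) * (a - a') = 0 := by linear_combination h2 - h1
  have h4 : a = a' := sub_eq_zero.1 ((mul_eq_zero.1 h3).resolve_left (sub_ne_zero.2 hrot))
  subst h4
  linear_combination h1

/-- If two bodies have a wall in common, at infinitely many angles, then they lie on the same side
of it. An end of the common segment determines a vertex of the cell of `x` which is also a vertex of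
the cell of `y`; hence, for every point `z` of the polygon, the corner given by `z` and this vertex
belongs to both bodies. If they were on opposite sides of the wall then all these corners, and with
them the polygon, would lie on a line. -/
lemma not_opposite_sides (h : IsConvexPolygon Ω) {x y : ℂ} {S : Set (ℂ × ℝ)} (hx : IsWall Ω x S)
    (hy : IsWall Ω y S) {p : ℂ × ℝ} (hp : p ∈ closure (S ∩ {q | q.2 < p.2})) {d : ℂ} (hd : d ≠ 0)
    (h1 : ∀ w ∈ minkowski Ω x p.2, 0 ≤ cross d (w - p.1))
    (h2 : ∀ w ∈ minkowski Ω y p.2, cross d (w - p.1) ≤ 0) : False := by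
  obtain ⟨a, b, i, j, hI, rfl⟩ := hx
  obtain ⟨a', b', i', j', hI', heq⟩ := hy
  set Θ : Set ℝ := Prod.snd '' (wall Ω x a b i j ∩ {q | q.2 < p.2}) with hΘ
  have hinf : Θ.Infinite := by
    intro hfin
    have h3 : p.2 ∈ closure Θ := image_closure_subset_closure_image continuous_snd ⟨p, hp, rfl⟩
    rw [hfin.isClosed.closure_eq] at h3
    obtain ⟨q, ⟨-, hq⟩, hqp⟩ := h3
    exact absurd hqp (ne_of_lt hq)
  have hang : ∀ θ ∈ Θ, θ ∈ angles := by
    rintro _ ⟨q, ⟨hq, -⟩, rfl⟩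
    exact (mem_wall.1 hq).1
  have hends : ∀ θ ∈ Θ, corner x a i θ = corner y a' i' θ ∨ corner x a i θ = corner y b' j' θ := by
    rintro _ ⟨q, ⟨hq, -⟩, rfl⟩
    exact eq_or_eq_of_segment_eq ((isSwept_wall hI).segment_eq (heq ▸ isSwept_wall hI') hq)
  have hmatch : ∃ l, x + hexVertex i = y + hexVertex l := by
    have hun : Θ = {θ ∈ Θ | corner x a i θ = corner y a' i' θ} ∪
        {θ ∈ Θ | corner x a i θ = corner y b' j' θ} := by
      ext θ
      constructor
      · intro hθ
        exact (hends θ hθ).imp (fun h => ⟨hθ, h⟩) (fun h => ⟨hθ, h⟩)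
      · rintro (h | h) <;> exact h.1
    rw [hun, infinite_union] at hinf
    rcases hinf with hinf | hinf
    · obtain ⟨θ, hθ, φ, hφ, hne⟩ := hinf.nontrivial
      exact ⟨i', corner_eq_of_two (hang θ hθ.1) (hang φ hφ.1) hne hθ.2 hφ.2⟩
    · obtain ⟨θ, hθ, φ, hφ, hne⟩ := hinf.nontrivial
      exact ⟨j', corner_eq_of_two (hang θ hθ.1) (hang φ hφ.1) hne hθ.2 hφ.2⟩
  obtain ⟨l, hl⟩ := hmatch
  have hzero : ∀ z ∈ Ω, cross d (corner x z i p.2 - p.1) = 0 := fun z hz => by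
    have hxy : corner x z i p.2 = corner y z l p.2 := by rw [corner, corner, hl]
    exact le_antisymm (hxy ▸ h2 _ (corner_mem_minkowski hz l p.2)) (h1 _ (corner_mem_minkowski hz i p.2))
  obtain ⟨d', hd', hdd⟩ := exists_cross_neg_rot_mul hd p.2
  obtain ⟨z, hz⟩ := h.2
  have hline : ∀ w ∈ Ω, cross d' (w - z) = 0 := fun w hw => by
    rw [← hdd, ← corner_sub_corner_point x z w i, show corner x w i p.2 - corner x z i p.2 =
      (corner x w i p.2 - p.1) - (corner x z i p.2 - p.1) by ring, cross_sub_right, hzero w hw,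
      hzero z (interior_subset hz), sub_zero]
  exact notMem_interior_of_support hd' (fun w hw => (hline w hw).ge) (by simp [cross]) hz

/-- All the bodies that have the surface `S` as a wall lie on the same side of it. -/
lemma exists_common_side (h : IsConvexPolygon Ω) {p : ℂ × ℝ} (h0 : 0 < p.2) {S : Set (ℂ × ℝ)}
    (hS : S ∈ surfacesAt Ω p) {P Q : ℝ → ℂ} (hPQ : IsSwept S P Q) :
    ∃ e : ℂ, (e = Q p.2 - P p.2 ∨ e = -(Q p.2 - P p.2)) ∧
      ∀ x, IsWall Ω x S → ∀ w ∈ minkowski Ω x p.2, 0 ≤ cross e (w - p.1) := by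
  by_cases hall : ∀ x, IsWall Ω x S → ∀ w ∈ minkowski Ω x p.2, 0 ≤ cross (Q p.2 - P p.2) (w - p.1)
  · exact ⟨_, Or.inl rfl, hall⟩
  · refine ⟨_, Or.inr rfl, fun x hx w hw => ?_⟩
    rw [cross_neg_left]
    push Not at hall
    obtain ⟨y, hy, w', hw', hneg⟩ := hall
    have hd : Q p.2 - P p.2 ≠ 0 := sub_ne_zero.2 (hPQ.2.2.1 p.2).symm
    have hyside := (hy.side h hPQ hS.2.1).resolve_left fun hc => absurd (hc w' hw') (not_le.2 hneg)
    have hxside := (hx.side h hPQ hS.2.1).resolve_left fun hc =>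
      not_opposite_sides h hx hy (hS.2.2 h0) hd hc hyside
    linarith [hxside w hw]

/-! ### Arcs in triple intersections -/

/-- Where two surfaces cross transversally, they have only one point in common at each angle. -/
lemma not_inner_of_subset_slice {S₁ S₂ X : Set (ℂ × ℝ)} {P₁ Q₁ P₂ Q₂ : ℝ → ℂ} {p : ℂ × ℝ}
    (h₁ : IsSwept S₁ P₁ Q₁) (h₂ : IsSwept S₂ P₂ Q₂)
    (hc : cross (Q₁ p.2 - P₁ p.2) (Q₂ p.2 - P₂ p.2) ≠ 0) (hX₁ : X ⊆ S₁) (hX₂ : X ⊆ S₂)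
    (hX : ∀ q ∈ X, q.2 = p.2) : ¬ IsInnerPointOfArc X p := by
  rintro ⟨γ, -, hinj, hmaps, -⟩
  have h0 : (0 : ℝ) ∈ Ioo (-1 : ℝ) 1 := by constructor <;> norm_num
  have h1 : (1 / 2 : ℝ) ∈ Ioo (-1 : ℝ) 1 := by constructor <;> norm_num
  have k0 := hmaps h0
  have k1 := hmaps h1
  have e0 := hX _ k0
  have e1 := hX _ k1
  have heq : γ 0 = γ (1 / 2) := by
    refine Prod.ext ?_ (e0.trans e1.symm)
    have a0 := h₁.mem (hX₁ k0)
    have a1 := h₁.mem (hX₁ k1)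
    have b0 := h₂.mem (hX₂ k0)
    have b1 := h₂.mem (hX₂ k1)
    rw [e0] at a0 b0
    rw [e1] at a1 b1
    exact eq_of_mem_segments hc a0 a1 b0 b1
  have := hinj h0 h1 heq
  norm_num at this

/-- Where two surfaces cross transversally, an arc contained in both passes from lower to higher
angles. -/
lemma eventually_exists_of_inner {S₁ S₂ X : Set (ℂ × ℝ)} {P₁ Q₁ P₂ Q₂ : ℝ → ℂ} {p : ℂ × ℝ}
    (h₁ : IsSwept S₁ P₁ Q₁) (h₂ : IsSwept S₂ P₂ Q₂)
    (hc : cross (Q₁ p.2 - P₁ p.2) (Q₂ p.2 - P₂ p.2) ≠ 0) (hX₁ : X ⊆ S₁) (hX₂ : X ⊆ S₂)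
    (hin : IsInnerPointOfArc X p) {W : Set (ℂ × ℝ)} (hW : W ∈ nhds p) :
    ∀ᶠ φ in nhdsWithin p.2 (Iio p.2), ∃ u, (u, φ) ∈ X ∧ (u, φ) ∈ W := by
  obtain ⟨γ, hcont, hinj, hmaps, hγ0⟩ := hin
  have hIoo : Ioo (-1 : ℝ) 1 ∈ nhds (0 : ℝ) := Ioo_mem_nhds (by norm_num) (by norm_num)
  have hat : ContinuousAt γ 0 := hcont.continuousAt hIoo
  have hcc : Continuous fun q : ℂ × ℝ => cross (Q₁ q.2 - P₁ q.2) (Q₂ q.2 - P₂ q.2) := by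
    have := h₁.1
    have := h₁.2.1
    have := h₂.1
    have := h₂.2.1
    fun_prop
  have hev : ∀ᶠ q in nhds (γ 0), q ∈ W ∧ cross (Q₁ q.2 - P₁ q.2) (Q₂ q.2 - P₂ q.2) ≠ 0 := by
    rw [hγ0]
    exact (Filter.Eventually.and hW (hcc.continuousAt.eventually_ne hc))
  obtain ⟨ε, hε, hball⟩ := Metric.eventually_nhds_iff.1 ((hat.eventually hev).and hIoo)
  set δ := ε / 2 with hδ
  have hδ0 : 0 < δ := by positivity
  have hloc : ∀ t ∈ Icc (-δ) δ, (γ t ∈ W ∧ cross (Q₁ (γ t).2 - P₁ (γ t).2)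
      (Q₂ (γ t).2 - P₂ (γ t).2) ≠ 0) ∧ t ∈ Ioo (-1 : ℝ) 1 := fun t ht => by
    apply hball
    rw [Real.dist_eq, sub_zero]
    exact (abs_le.2 ht).trans_lt (by linarith)
  have hfc : ContinuousOn (fun t => (γ t).2) (Icc (-δ) δ) :=
    continuous_snd.comp_continuousOn (hcont.mono fun t ht => (hloc t ht).2)
  have hfi : InjOn (fun t => (γ t).2) (Icc (-δ) δ) := by
    intro s hs t ht hst
    simp only at hst
    have ks := hmaps (hloc s hs).2
    have kt := hmaps (hloc t ht).2
    apply hinj (hloc s hs).2 (hloc t ht).2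
    refine Prod.ext ?_ hst
    have a0 := h₁.mem (hX₁ ks)
    have a1 := h₁.mem (hX₁ kt)
    have b0 := h₂.mem (hX₂ ks)
    have b1 := h₂.mem (hX₂ kt)
    rw [← hst] at a1 b1
    exact eq_of_mem_segments (hloc s hs).1.2 a0 a1 b0 b1
  have hl : -δ ∈ Icc (-δ) δ := ⟨le_rfl, by linarith⟩
  have hr : δ ∈ Icc (-δ) δ := ⟨by linarith, le_rfl⟩
  have hz : (0 : ℝ) ∈ Icc (-δ) δ := ⟨by linarith, by linarith⟩
  -- one of the two halves of the arc descends from `p`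
  have hdesc : ∃ m < p.2, ∀ φ ∈ Icc m p.2, ∃ t ∈ Icc (-δ) δ, (γ t).2 = φ := by
    rcases hfc.strictMonoOn_of_injOn_Icc' (by linarith) hfi with hm | hm
    · refine ⟨(γ (-δ)).2, ?_, fun φ hφ => ?_⟩
      · have := hm hl hz (by linarith)
        simpa only [hγ0] using this
      · have hsub : Icc (-δ) 0 ⊆ Icc (-δ) δ := Icc_subset_Icc_right hδ0.le
        obtain ⟨t, ht, hφt⟩ := intermediate_value_Icc (by linarith : -δ ≤ 0) (hfc.mono hsub)
          (by simpa only [hγ0] using hφ)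
        exact ⟨t, hsub ht, hφt⟩
    · refine ⟨(γ δ).2, ?_, fun φ hφ => ?_⟩
      · have := hm hz hr hδ0
        simpa only [hγ0] using this
      · have hsub : Icc 0 δ ⊆ Icc (-δ) δ := Icc_subset_Icc_left (by linarith)
        obtain ⟨t, ht, hφt⟩ := intermediate_value_Icc' hδ0.le (hfc.mono hsub)
          (by simpa only [hγ0] using hφ)
        exact ⟨t, hsub ht, hφt⟩
  obtain ⟨m, hm, hall⟩ := hdesc
  filter_upwards [nhdsWithin_le_nhds (lt_mem_nhds hm), self_mem_nhdsWithin] with φ h3 h4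
  obtain ⟨t, ht, rfl⟩ := hall φ ⟨le_of_lt h3, le_of_lt h4⟩
  exact ⟨(γ t).1, hmaps (hloc t ht).2, (hloc t ht).1.1⟩

/-! ### The lowest points of a free region -/

/-- The points of the prism that are not in the interior of a body, except possibly of those with
centres in `H`. -/
def freeRegion (Ω : Set ℂ) (H : Set ℂ) : Set (ℂ × ℝ) :=
  {q ∈ prism | ∀ x ∈ gridPoints Ω \ H, q.1 ∉ interior (minkowski Ω x q.2)}

/-- `p` has the least angle in the free region and, among the points with this angle, the greatest
distance from the axis of the prism. -/
structure IsLowest (Ω H : Set ℂ) (p : ℂ × ℝ) : Prop where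
  mem : p ∈ freeRegion Ω H
  low : ∀ q ∈ freeRegion Ω H, p.2 ≤ q.2
  far : ∀ q ∈ freeRegion Ω H, q.2 = p.2 → ‖q.1‖ ≤ ‖p.1‖

lemma isCompact_freeRegion (h : IsConvexPolygon Ω) (H : Set ℂ) : IsCompact (freeRegion Ω H) := by
  have h1 : IsCompact prism := isCompact_hexagon.prod isCompact_Icc
  have h2 : freeRegion Ω H = prism ∩
      ⋂ x ∈ gridPoints Ω \ H, {q | q.1 ∈ interior (minkowski Ω x q.2)}ᶜ := by
    ext q
    simp only [freeRegion, mem_ofPred_eq, mem_inter_iff, mem_iInter, mem_compl_iff]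
  rw [h2]
  exact h1.inter_right (isClosed_biInter fun x _ =>
    (isOpen_setOf_mem_interior_minkowski h x).isClosed_compl)

lemma exists_isLowest (h : IsConvexPolygon Ω) {H : Set ℂ} (hne : (freeRegion Ω H).Nonempty) :
    ∃ p, IsLowest Ω H p := by
  have hc := isCompact_freeRegion h H
  obtain ⟨p, hp, hmin⟩ := hc.exists_isMinOn hne continuous_snd.continuousOn
  have hc' : IsCompact (freeRegion Ω H ∩ {q | q.2 = p.2}) :=
    hc.inter_right (isClosed_eq continuous_snd continuous_const)
  obtain ⟨q, hq, hmax⟩ := hc'.exists_isMaxOn ⟨p, hp, rfl⟩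
    (continuous_fst.norm (E := ℂ)).continuousOn
  have hqp : q.2 = p.2 := hq.2
  exact ⟨q, hq.1, fun r hr => hqp ▸ hmin hr, fun r hr hrq => hmax ⟨hr, hrq.trans hqp⟩⟩

variable {H : Set ℂ} {p : ℂ × ℝ}

lemma IsLowest.mem_angles (hp : IsLowest Ω H p) : p.2 ∈ angles := hp.mem.1.2

lemma IsLowest.mem_hexagon (hp : IsLowest Ω H p) : p.1 ∈ hexagon := hp.mem.1.1

/-- Near `p`, only the bodies that have `p` on a wall matter. -/
lemma IsLowest.notMem_or_exists_wall (h : IsConvexPolygon Ω) (hp : IsLowest Ω H p) {x : ℂ}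
    (hx : x ∈ gridPoints Ω \ H) :
    p.1 ∉ minkowski Ω x p.2 ∨ ∃ S ∈ surfacesAt Ω p, IsWall Ω x S := by
  by_cases hmem : p.1 ∈ minkowski Ω x p.2
  · exact Or.inr (exists_wall_mem_surfacesAt h hx.1 hp.mem_angles
      ((mem_frontier_minkowski h).2 ⟨hmem, hp.mem.2 x hx⟩))
  · exact Or.inl hmem

lemma eventually_notMem_minkowski (h : IsConvexPolygon Ω) (p : ℂ × ℝ) :
    ∀ᶠ q in nhds p, ∀ x ∈ gridPoints Ω, p.1 ∉ minkowski Ω x p.2 → q.1 ∉ minkowski Ω x q.2 := by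
  rw [Filter.eventually_all_finite (finite_gridPoints Ω)]
  intro x hx
  by_cases hmem : p.1 ∈ minkowski Ω x p.2
  · exact Filter.Eventually.of_forall fun q hq => absurd hmem hq
  · filter_upwards [(isClosed_setOf_mem_minkowski h x).isOpen_compl.mem_nhds hmem] with q hq _
    exact hq

lemma eventually_line_notMem_minkowski (h : IsConvexPolygon Ω) (p : ℂ × ℝ) (t : ℂ) :
    ∀ᶠ s : ℝ in nhds 0, ∀ x ∈ gridPoints Ω, p.1 ∉ minkowski Ω x p.2 →
      p.1 + s • t ∉ minkowski Ω x p.2 := by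
  have hc : Continuous fun s : ℝ => (p.1 + s • t, p.2) := by fun_prop
  have ht := hc.tendsto 0
  simp only [zero_smul, add_zero] at ht
  exact ht.eventually (eventually_notMem_minkowski h p)

lemma eventually_line_mem_hexagon {u : ℂ} (hu : u ∈ interior hexagon) (t : ℂ) :
    ∀ᶠ s : ℝ in nhds 0, u + s • t ∈ hexagon := by
  have hc : Continuous fun s : ℝ => u + s • t := by fun_prop
  have ht := hc.tendsto 0
  simp only [zero_smul, add_zero] at ht
  exact ht.eventually (mem_interior_iff_mem_nhds.1 hu)

lemma eventually_line_mem_segment {P Q u : ℂ} (hu : u ∈ segment ℝ P Q) (hP : u ≠ P) (hQ : u ≠ Q)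
    (l : ℝ) : ∀ᶠ s : ℝ in nhds 0, u + s • (l • (Q - P)) ∈ segment ℝ P Q := by
  obtain ⟨r, h0, h1, rfl⟩ := mem_segment_iff_smul.1 hu
  have h0' : 0 < r := lt_of_le_of_ne h0 fun he => hP (by simp [← he])
  have h1' : r < 1 := lt_of_le_of_ne h1 fun he => hQ (by simp [he])
  have hc : Continuous fun s : ℝ => r + s * l := by fun_prop
  have ht := hc.tendsto 0
  simp only [zero_mul, add_zero] at ht
  filter_upwards [ht.eventually (Icc_mem_nhds h0' h1')] with s hs
  exact mem_segment_iff_smul.2 ⟨r + s * l, hs.1, hs.2, by module⟩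

/-- No point of the hexagon is free just below the lowest angle. -/
lemma IsLowest.no_escape (h : IsConvexPolygon Ω) (hp : IsLowest Ω H p) (h0 : 0 < p.2) {v : ℂ}
    (hv : v ∈ hexagon) (hfree : ∀ x ∈ gridPoints Ω \ H, v ∉ minkowski Ω x p.2 ∨
      ∀ φ ∈ angles, v ∉ interior (minkowski Ω x φ)) : False := by
  have hev : ∀ᶠ φ in nhdsWithin p.2 (Iio p.2), ∀ x ∈ gridPoints Ω,
      v ∉ minkowski Ω x p.2 → v ∉ minkowski Ω x φ := by
    have hc : Continuous fun φ : ℝ => (v, φ) := by fun_prop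
    exact ((hc.tendsto p.2).eventually
      (eventually_notMem_minkowski h (v, p.2))).filter_mono nhdsWithin_le_nhds
  obtain ⟨φ, ⟨h1, h2⟩, h3⟩ := ((hev.and (eventually_mem_angles hp.mem_angles h0)).and
    self_mem_nhdsWithin).exists
  have h3 : φ < p.2 := h3
  refine absurd (hp.low (v, φ) ⟨⟨hv, h2⟩, fun x hx => ?_⟩) (not_le.2 h3)
  rcases hfree x hx with h4 | h4
  · exact fun h5 => h1 x hx.1 h4 (interior_subset h5)
  · exact h4 φ h2

/-- Two edges of the hexagon, which are not parallel, meet at each vertex. -/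
lemma ne_hexVertex_of_forall_cross {u : ℂ} {k : ℤ} {D : ℂ → Prop}
    (hD : ∀ l, u ∈ hexEdge l → D (hexVertex (l + 1) - hexVertex l))
    (hpar : ∀ d e, D d → D e → cross d e = 0) : u ≠ hexVertex k := by
  rintro rfl
  have h1 := hD k (left_mem_segment ℝ _ _)
  have h2 := hD (k - 1) (by
    have := right_mem_segment ℝ (hexVertex (k - 1)) (hexVertex (k - 1 + 1))
    rw [sub_add_cancel] at this
    rw [hexEdge, sub_add_cancel]
    exact this)
  refine cross_hexEdge_ne_zero (k - 1) ?_
  rw [sub_add_cancel] at *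
  exact hpar _ _ h2 h1

/-- Through a lowest point there are two surfaces with different directions: otherwise the point
could be moved to both sides within its slice of the free region, but it is farthest from the axis.
-/
lemma IsLowest.exists_transversal (h : IsConvexPolygon Ω) (hp : IsLowest Ω H p) :
    ∃ S₁ ∈ surfacesAt Ω p, ∃ S₂ ∈ surfacesAt Ω p, ∃ P₁ Q₁ P₂ Q₂, IsSwept S₁ P₁ Q₁ ∧
      IsSwept S₂ P₂ Q₂ ∧ cross (Q₁ p.2 - P₁ p.2) (Q₂ p.2 - P₂ p.2) ≠ 0 := by
  by_contra hcon
  push Not at hcon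
  have hdir : ∃ t : ℂ, t ≠ 0 ∧ ∀ S ∈ surfacesAt Ω p, ∀ P Q, IsSwept S P Q →
      cross (Q p.2 - P p.2) t = 0 := by
    by_cases hne : (surfacesAt Ω p).Nonempty
    · obtain ⟨S, hS⟩ := hne
      obtain ⟨P, Q, hPQ⟩ := hS.1.exists_isSwept
      exact ⟨Q p.2 - P p.2, sub_ne_zero.2 (hPQ.2.2.1 p.2).symm, fun S' hS' P' Q' hPQ' =>
        hcon S' hS' S hS P' Q' P Q hPQ' hPQ⟩
    · rw [not_nonempty_iff_eq_empty] at hne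
      exact ⟨1, one_ne_zero, fun S hS => by rw [hne] at hS; exact hS.elim⟩
  obtain ⟨t, ht, hpar⟩ := hdir
  have hhex : ∀ᶠ s : ℝ in nhds 0, p.1 + s • t ∈ hexagon := by
    by_cases hint : p.1 ∈ interior hexagon
    · exact eventually_line_mem_hexagon hint t
    · obtain ⟨k, hk⟩ := exists_mem_hexEdge hp.mem_hexagon hint
      have hside := fun l (hl : p.1 ∈ hexEdge l) =>
        hpar _ (side_mem_surfacesAt hl hp.mem_angles) _ _ (isSwept_side l)
      have hvert : ∀ l, p.1 ≠ hexVertex l := fun l =>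
        ne_hexVertex_of_forall_cross (D := fun d => ∃ l, p.1 ∈ hexEdge l ∧
          d = hexVertex (l + 1) - hexVertex l) (fun l hl => ⟨l, hl, rfl⟩) (by
            rintro _ _ ⟨l, hl, rfl⟩ ⟨m, hm, rfl⟩
            exact hcon _ (side_mem_surfacesAt hl hp.mem_angles) _
              (side_mem_surfacesAt hm hp.mem_angles) _ _ _ _ (isSwept_side l) (isSwept_side m))
      obtain ⟨l, rfl⟩ := eq_smul_of_cross_eq_zero (sub_ne_zero.2 (hexVertex_ne_succ k).symm)
        (by rw [cross_comm, hside k hk, neg_zero])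
      exact (eventually_line_mem_segment hk (hvert _) (hvert _) l).mono fun s hs =>
        hexEdge_subset_hexagon k hs
  have hfree : ∀ᶠ s : ℝ in nhds 0, (p.1 + s • t, p.2) ∈ freeRegion Ω H := by
    filter_upwards [hhex, eventually_line_notMem_minkowski h p t] with s h1 h2
    refine ⟨⟨h1, hp.mem_angles⟩, fun x hx => ?_⟩
    rcases hp.notMem_or_exists_wall h hx with h3 | ⟨S, hS, hSx⟩
    · exact fun h4 => h2 x hx.1 h3 (interior_subset h4)
    · obtain ⟨P, Q, hPQ⟩ := hS.1.exists_isSwept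
      have hd : Q p.2 - P p.2 ≠ 0 := sub_ne_zero.2 (hPQ.2.2.1 p.2).symm
      have hz : cross (Q p.2 - P p.2) (p.1 + s • t - p.1) = 0 := by
        rw [add_sub_cancel_left, cross_smul_right, hpar S hS P Q hPQ, mul_zero]
      rcases hSx.side h hPQ hS.2.1 with hs | hs
      · exact notMem_interior_of_support hd hs hz.le
      · refine notMem_interior_of_support (u := p.1) (neg_ne_zero.2 hd) (fun w hw => ?_)
          (by rw [cross_neg_left, hz, neg_zero])
        rw [cross_neg_left]
        linarith [hs w hw]
  -- by the parallelogram law, one of two opposite shifts increases the norm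
  obtain ⟨ε, hε, hball⟩ := Metric.eventually_nhds_iff.1 hfree
  have k1 := hp.far _ (hball (y := ε / 2) (by
    rw [Real.dist_eq, sub_zero, abs_of_pos (by positivity)]; linarith)) rfl
  have k2 := hp.far _ (hball (y := -(ε / 2)) (by
    rw [Real.dist_eq, sub_zero, abs_neg, abs_of_pos (by positivity)]; linarith)) rfl
  have k3 := parallelogram_law_with_norm ℝ p.1 ((ε / 2) • t)
  simp only [neg_smul, ← sub_eq_add_neg] at k1 k2
  have k4 : 0 < ‖(ε / 2) • t‖ := norm_pos_iff.2 (smul_ne_zero (by positivity) ht)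
  nlinarith [norm_nonneg (p.1 + (ε / 2) • t), norm_nonneg (p.1 - (ε / 2) • t)]

/-! ### Lowest points are vertex points -/

lemma ne_of_transversal {S₁ S₂ : Set (ℂ × ℝ)} {P₁ Q₁ P₂ Q₂ : ℝ → ℂ} (h₁ : IsSwept S₁ P₁ Q₁)
    (h₂ : IsSwept S₂ P₂ Q₂) (hp : p ∈ S₁)
    (hc : cross (Q₁ p.2 - P₁ p.2) (Q₂ p.2 - P₂ p.2) ≠ 0) : S₁ ≠ S₂ := by
  rintro rfl
  exact hc (h₁.cross_eq_zero h₂ hp)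

/-- At a lowest point with angle `0` the bottom of the prism is the third surface. -/
lemma IsLowest.mem_vertexPoints_of_bottom (h : IsConvexPolygon Ω) (hp : IsLowest Ω H p)
    (h0 : p.2 = 0) : p ∈ vertexPoints Ω := by
  obtain ⟨S₁, hS₁, S₂, hS₂, P₁, Q₁, P₂, Q₂, h₁, h₂, hc⟩ := hp.exists_transversal h
  have hbot : p ∈ hexagon ×ˢ ({0} : Set ℝ) := ⟨hp.mem_hexagon, h0⟩
  -- the hexagon is not contained in a line
  have hne : ∀ (S : Set (ℂ × ℝ)) (P Q : ℝ → ℂ), IsSwept S P Q → p ∈ S → S ≠ hexagon ×ˢ {0} := by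
    rintro S P Q hPQ hpS rfl
    have hd : Q p.2 - P p.2 ≠ 0 := sub_ne_zero.2 (hPQ.2.2.1 p.2).symm
    have hseg : ∀ w ∈ hexagon, w ∈ segment ℝ (P p.2) (Q p.2) := fun w hw =>
      (hPQ.2.2.2 p hpS w).1 ⟨hw, h0⟩
    refine notMem_interior_of_support (T := hexagon) (u := 0) (v := 0) hd (fun w hw => ?_)
      (by simp [cross]) zero_mem_interior_hexagon
    exact (cross_eq_zero_of_mem_segment (hseg w hw) (hseg 0 zero_mem_hexagon)).ge
  refine ⟨S₁ ∩ S₂ ∩ hexagon ×ˢ {0} ∩ prism, ⟨S₁, S₂, _, hS₁.1.isSurface, hS₂.1.isSurface,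
    IsSurface.prismBottom, ne_of_transversal h₁ h₂ hS₁.2.1 hc, hne S₁ P₁ Q₁ h₁ hS₁.2.1,
    hne S₂ P₂ Q₂ h₂ hS₂.2.1, rfl⟩, ⟨⟨⟨hS₁.2.1, hS₂.2.1⟩, hbot⟩, hp.mem.1⟩, ?_⟩
  exact not_inner_of_subset_slice h₁ h₂ hc (fun q hq => hq.1.1.1) (fun q hq => hq.1.1.2)
    (fun q hq => (hq.1.2.2 : q.2 = 0).trans h0.symm)

/-- If a third surface passes through a lowest point then this point is a vertex point. Otherwise
every third surface contains an arc of the curve in which the first two meet; the points of this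
curve just below are on the boundary of all the bodies near by, hence free. -/
lemma IsLowest.mem_vertexPoints_of_third (h : IsConvexPolygon Ω) (hp : IsLowest Ω H p)
    {S₁ S₂ S₃ : Set (ℂ × ℝ)} (hS₁ : S₁ ∈ surfacesAt Ω p) (hS₂ : S₂ ∈ surfacesAt Ω p)
    (hS₃ : S₃ ∈ surfacesAt Ω p) {P₁ Q₁ P₂ Q₂ : ℝ → ℂ} (h₁ : IsSwept S₁ P₁ Q₁)
    (h₂ : IsSwept S₂ P₂ Q₂) (hc : cross (Q₁ p.2 - P₁ p.2) (Q₂ p.2 - P₂ p.2) ≠ 0)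
    (h31 : S₃ ≠ S₁) (h32 : S₃ ≠ S₂) : p ∈ vertexPoints Ω := by
  by_contra hnot
  have harc : ∀ S ∈ surfacesAt Ω p, S ≠ S₁ → S ≠ S₂ →
      IsInnerPointOfArc (S₁ ∩ S₂ ∩ S ∩ prism) p := fun S hS hne1 hne2 => by
    by_contra hin
    exact hnot ⟨_, ⟨S₁, S₂, S, hS₁.1.isSurface, hS₂.1.isSurface, hS.1.isSurface,
      ne_of_transversal h₁ h₂ hS₁.2.1 hc, hne1.symm, hne2.symm, rfl⟩,
      ⟨⟨⟨hS₁.2.1, hS₂.2.1⟩, hS.2.1⟩, hp.mem.1⟩, hin⟩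
  have hev : ∀ᶠ φ in nhdsWithin p.2 (Iio p.2), ∀ S ∈ surfacesAt Ω p, S ≠ S₁ → S ≠ S₂ →
      ∃ u, (u, φ) ∈ S₁ ∩ S₂ ∩ S ∩ prism ∧ ∀ x ∈ gridPoints Ω, p.1 ∉ minkowski Ω x p.2 →
        u ∉ minkowski Ω x φ := by
    rw [Filter.eventually_all_finite (finite_surfacesAt h p)]
    intro S hS
    by_cases hne : S = S₁ ∨ S = S₂
    · exact Filter.Eventually.of_forall fun φ hne1 hne2 => absurd hne (not_or.2 ⟨hne1, hne2⟩)
    · obtain ⟨hne1, hne2⟩ := not_or.1 hne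
      exact (eventually_exists_of_inner h₁ h₂ hc (fun q hq => hq.1.1.1) (fun q hq => hq.1.1.2)
        (harc S hS hne1 hne2) (eventually_notMem_minkowski h p)).mono fun φ hφ _ _ => hφ
  have hcc : Continuous fun φ => cross (Q₁ φ - P₁ φ) (Q₂ φ - P₂ φ) := by
    have := h₁.1
    have := h₁.2.1
    have := h₂.1
    have := h₂.2.1
    fun_prop
  obtain ⟨φ, ⟨hφ, hcφ⟩, hlt⟩ := ((hev.and ((hcc.continuousAt.eventually_ne hc).filter_mono
    nhdsWithin_le_nhds)).and self_mem_nhdsWithin).exists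
  have hlt : φ < p.2 := hlt
  obtain ⟨u, hu, huW⟩ := hφ S₃ hS₃ h31 h32
  refine absurd (hp.low (u, φ) ⟨hu.2, fun x hx => ?_⟩) (not_le.2 hlt)
  rcases hp.notMem_or_exists_wall h hx with h3 | ⟨S, hS, hSx⟩
  · exact fun h4 => huW x hx.1 h3 (interior_subset h4)
  · have huS : (u, φ) ∈ S := by
      by_cases hne1 : S = S₁
      · rw [hne1]; exact hu.1.1.1
      by_cases hne2 : S = S₂
      · rw [hne2]; exact hu.1.1.2
      obtain ⟨v, hv, -⟩ := hφ S hS hne1 hne2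
      have huv : u = v := eq_of_mem_segments hcφ (h₁.mem hu.1.1.1) (h₁.mem hv.1.1.1)
        (h₂.mem hu.1.1.2) (h₂.mem hv.1.1.2)
      rw [huv]; exact hv.1.2
    exact hSx.notMem_interior h huS

/-- The case of two surfaces, one of which is a face of the prism: slide along its edge, away from
the bodies on the other surface. -/
lemma IsLowest.false_of_two_of_side (h : IsConvexPolygon Ω) (hp : IsLowest Ω H p) (h0 : 0 < p.2)
    {k : ℤ} (hk : p.1 ∈ hexEdge k) {S₂ : Set (ℂ × ℝ)} (hS₂ : S₂ ∈ surfacesAt Ω p) {P₂ Q₂ : ℝ → ℂ}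
    (h₂ : IsSwept S₂ P₂ Q₂)
    (hc : cross (hexVertex (k + 1) - hexVertex k) (Q₂ p.2 - P₂ p.2) ≠ 0)
    (hall : ∀ S ∈ surfacesAt Ω p, S = hexEdge k ×ˢ angles ∨ S = S₂) : False := by
  have hwall₁ : ∀ v ∈ hexEdge k, ∀ x, IsWall Ω x (hexEdge k ×ˢ angles) →
      ∀ φ ∈ angles, v ∉ interior (minkowski Ω x φ) := fun v hv x hx φ hφ =>
    hx.notMem_interior h (q := (v, φ)) ⟨hv, hφ⟩
  by_cases hside : ∃ l, S₂ = hexEdge l ×ˢ angles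
  · -- `p` is on an edge of the prism
    obtain ⟨l, rfl⟩ := hside
    refine hp.no_escape h h0 hp.mem_hexagon fun x hx => ?_
    rcases hp.notMem_or_exists_wall h hx with h3 | ⟨S, hS, hSx⟩
    · exact Or.inl h3
    · right
      rcases hall S hS with rfl | rfl
      · exact hwall₁ _ hk x hSx
      · exact fun φ hφ => hSx.notMem_interior h (q := (p.1, φ)) ⟨hS.2.1.1, hφ⟩
  · push Not at hside
    have hvert : ∀ l, p.1 ≠ hexVertex l := fun l =>
      ne_hexVertex_of_forall_cross (D := fun d =>
        cross d (hexVertex (k + 1) - hexVertex k) = 0) (fun l hl => by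
          have hmem := side_mem_surfacesAt (Ω := Ω) hl hp.mem_angles
          have heq := (hall _ hmem).resolve_right (hside l).symm
          exact (isSwept_side l).cross_eq_zero (heq ▸ isSwept_side k) hmem.2.1) (by
            have hd : hexVertex (k + 1) - hexVertex k ≠ 0 :=
              sub_ne_zero.2 (hexVertex_ne_succ k).symm
            intro d e hd' he'
            obtain ⟨l, rfl⟩ := eq_smul_of_cross_eq_zero hd hd'
            obtain ⟨m, rfl⟩ := eq_smul_of_cross_eq_zero hd he'
            rw [cross_smul_left, cross_smul_right, cross_self, mul_zero, mul_zero])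
    obtain ⟨e, he, hes⟩ := exists_common_side h h0 hS₂ h₂
    have hed : cross e (hexVertex (k + 1) - hexVertex k) ≠ 0 := by
      rw [cross_comm, neg_ne_zero]
      rcases he with rfl | rfl
      · exact hc
      · rw [cross_neg_right, neg_ne_zero]; exact hc
    obtain ⟨s, ⟨hs1, hs2⟩, hs0⟩ := ((((eventually_line_mem_segment hk (hvert _) (hvert _)
      (-cross e (hexVertex (k + 1) - hexVertex k))).and
      (eventually_line_notMem_minkowski h p _)).filter_mono nhdsWithin_le_nhds).and
      (self_mem_nhdsWithin (s := Ioi (0 : ℝ)))).exists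
    have hs0 : 0 < s := hs0
    refine hp.no_escape h h0 (hexEdge_subset_hexagon k hs1) fun x hx => ?_
    rcases hp.notMem_or_exists_wall h hx with h3 | ⟨S, hS, hSx⟩
    · exact Or.inl (hs2 x hx.1 h3)
    · rcases hall S hS with rfl | rfl
      · exact Or.inr (hwall₁ _ hs1 x hSx)
      · left
        intro hmem
        have h5 := hes x hSx _ hmem
        rw [add_sub_cancel_left, cross_smul_right, cross_smul_right] at h5
        nlinarith [mul_pos hs0 (mul_self_pos.2 hed)]

/-- There is always a third surface: two half-planes with different directions do not cover a
neighbourhood of `p`, so that some point near `p` would be free just below. -/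
lemma IsLowest.exists_third (h : IsConvexPolygon Ω) (hp : IsLowest Ω H p) (h0 : 0 < p.2)
    {S₁ S₂ : Set (ℂ × ℝ)} (hS₁ : S₁ ∈ surfacesAt Ω p) (hS₂ : S₂ ∈ surfacesAt Ω p)
    {P₁ Q₁ P₂ Q₂ : ℝ → ℂ} (h₁ : IsSwept S₁ P₁ Q₁) (h₂ : IsSwept S₂ P₂ Q₂)
    (hc : cross (Q₁ p.2 - P₁ p.2) (Q₂ p.2 - P₂ p.2) ≠ 0) :
    ∃ S₃ ∈ surfacesAt Ω p, S₃ ≠ S₁ ∧ S₃ ≠ S₂ := by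
  by_contra hcon
  have hall : ∀ S ∈ surfacesAt Ω p, S = S₁ ∨ S = S₂ := fun S hS => by
    by_contra hne
    exact hcon ⟨S, hS, not_or.1 hne⟩
  by_cases hint : p.1 ∈ interior hexagon
  · obtain ⟨e₁, he₁, hs₁⟩ := exists_common_side h h0 hS₁ h₁
    obtain ⟨e₂, he₂, hs₂⟩ := exists_common_side h h0 hS₂ h₂
    have hκ : cross e₁ e₂ ≠ 0 := by
      rcases he₁ with rfl | rfl <;> rcases he₂ with rfl | rfl <;>
        simpa only [cross_neg_left, cross_neg_right, neg_neg, neg_ne_zero] using hc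
    -- `κ • (e₁ - e₂)`, with `κ = cross e₁ e₂`, points out of both half-planes
    obtain ⟨s, ⟨hs1, hs2⟩, hs0⟩ := ((((eventually_line_mem_hexagon hint
      (cross e₁ e₂ • (e₁ - e₂))).and
      (eventually_line_notMem_minkowski h p _)).filter_mono nhdsWithin_le_nhds).and
      (self_mem_nhdsWithin (s := Ioi (0 : ℝ)))).exists
    have hs0 : 0 < s := hs0
    refine hp.no_escape h h0 hs1 fun x hx => Or.inl ?_
    rcases hp.notMem_or_exists_wall h hx with h3 | ⟨S, hS, hSx⟩
    · exact hs2 x hx.1 h3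
    · intro hmem
      have hpos := mul_pos hs0 (mul_self_pos.2 hκ)
      rcases hall S hS with rfl | rfl
      · have h5 := hs₁ x hSx _ hmem
        rw [add_sub_cancel_left, cross_smul_right, cross_smul_right, cross_sub_right, cross_self] at h5
        nlinarith
      · have h5 := hs₂ x hSx _ hmem
        rw [add_sub_cancel_left, cross_smul_right, cross_smul_right, cross_sub_right, cross_self,
          cross_comm e₁] at h5
        nlinarith
  · obtain ⟨k, hk⟩ := exists_mem_hexEdge hp.mem_hexagon hint
    have hside := isSwept_side k
    have hmem := side_mem_surfacesAt (Ω := Ω) hk hp.mem_angles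
    have hd : hexVertex (k + 1) - hexVertex k ≠ 0 := sub_ne_zero.2 (hexVertex_ne_succ k).symm
    rcases hall _ hmem with heq | heq
    · refine hp.false_of_two_of_side h h0 hk hS₂ h₂ ?_ (by rwa [heq])
      obtain ⟨l, hl⟩ := eq_smul_of_cross_eq_zero hd (h₁.cross_eq_zero (heq ▸ hside) hS₁.2.1)
      rw [hl, cross_smul_left] at hc
      exact right_ne_zero_of_mul hc
    · refine hp.false_of_two_of_side h h0 hk hS₁ h₁ ?_ (fun S hS => ?_)
      · obtain ⟨l, hl⟩ := eq_smul_of_cross_eq_zero hd (h₂.cross_eq_zero (heq ▸ hside) hS₂.2.1)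
        rw [hl, cross_comm, neg_ne_zero, cross_smul_left] at hc
        exact right_ne_zero_of_mul hc
      · rw [heq]; exact (hall S hS).symm

lemma IsLowest.mem_vertexPoints (h : IsConvexPolygon Ω) (hp : IsLowest Ω H p) :
    p ∈ vertexPoints Ω := by
  rcases eq_or_lt_of_le hp.mem_angles.1 with h0 | h0
  · exact hp.mem_vertexPoints_of_bottom h h0.symm
  · obtain ⟨S₁, hS₁, S₂, hS₂, P₁, Q₁, P₂, Q₂, h₁, h₂, hc⟩ := hp.exists_transversal h
    obtain ⟨S₃, hS₃, h31, h32⟩ := hp.exists_third h h0 hS₁ hS₂ h₁ h₂ hc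
    exact hp.mem_vertexPoints_of_third h hS₁ hS₂ hS₃ h₁ h₂ hc h31 h32

/-- Every point of the prism is matched by a vertex point that hits no further bodies. -/
theorem exists_vertexPoint_hitPoints_subset (h : IsConvexPolygon Ω) {q : ℂ × ℝ} (hq : q ∈ prism) :
    ∃ p ∈ vertexPoints Ω, hitPoints Ω p ⊆ hitPoints Ω q := by
  obtain ⟨p, hp⟩ := exists_isLowest h (H := hitPoints Ω q)
    ⟨q, hq, fun x hx hc => hx.2 ⟨hx.1, hc⟩⟩
  refine ⟨p, hp.mem_vertexPoints h, fun x hx => ?_⟩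
  by_contra hcon
  exact hp.mem.2 x ⟨hx.1, hcon⟩ hx.2

/-! ### Optimality -/

lemma image_place_eq (p : ℂ × ℝ) (Ω : Set ℂ) :
    place p '' Ω = (Homeomorph.addRight p.1) '' ((Homeomorph.mulLeft₀ (rot p.2) (rot_ne_zero _)) '' Ω) := by
  rw [image_image]; rfl

lemma finite_metCells (h : IsConvexPolygon Ω) (p : ℂ × ℝ) : (metCells Ω p).Finite := by
  have hc : IsCompact (place p '' Ω) := h.isCompact.image (by unfold place; fun_prop)
  obtain ⟨C, hC⟩ := hc.isBounded.exists_norm_le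
  refine (finite_lattice_inter (C + 1)).subset ?_
  rintro x ⟨hx, y, hy, hyx⟩
  have h1 := hC y hy
  have h2 := hexagon_subset_closedBall (interior_subset (mem_interior_hexCell.1 hyx))
  rw [mem_closedBall_zero_iff] at h2
  have h3 : ‖x‖ ≤ C + 1 := by
    calc ‖x‖ = ‖y - (y - x)‖ := by rw [sub_sub_cancel]
      _ ≤ ‖y‖ + ‖y - x‖ := norm_sub_le _ _
      _ ≤ C + 1 := add_le_add h1 h2
  exact ⟨hx, (Complex.abs_re_le_norm x).trans h3, (Complex.abs_im_le_norm x).trans h3⟩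

/-- The cells that are met by a placed polygon cover it. -/
lemma image_place_subset (h : IsConvexPolygon Ω) (p : ℂ × ℝ) :
    place p '' Ω ⊆ ⋃ x ∈ metCells Ω p, hexCell x := by
  have hclosed : IsClosed (⋃ x ∈ metCells Ω p, hexCell x) :=
    (finite_metCells h p).isClosed_biUnion fun x _ => isClosed_hexCell x
  have hcl : place p '' Ω ⊆ closure (interior (place p '' Ω)) := by
    have h1 : Ω ⊆ closure (interior Ω) := by
      rw [h.convex.closure_interior_eq_closure_of_nonempty_interior h.2]
      exact subset_closure
    rw [image_place_eq, ← Homeomorph.image_interior, ← Homeomorph.image_interior,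
      ← Homeomorph.image_closure, ← Homeomorph.image_closure]
    exact image_mono (image_mono h1)
  refine hcl.trans (closure_minimal (fun w hw => ?_) hclosed)
  obtain ⟨x, hx, hwx⟩ := exists_lattice_sub_mem_hexagon w
  have hwx : w ∈ hexCell x := mem_hexCell.2 hwx
  have hwcl : w ∈ closure (interior (hexCell x)) := by
    rw [(convex_hexCell x).closure_interior_eq_closure_of_nonempty_interior
      (interior_hexCell_nonempty x)]
    exact subset_closure hwx
  obtain ⟨v, hv, hvx⟩ := mem_closure_iff_nhds.1 hwcl _ (mem_interior_iff_mem_nhds.1 hw)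
  exact mem_biUnion (show x ∈ metCells Ω p from ⟨hx, v, hv, hvx⟩) hwx

lemma metCells_nonempty (h : IsConvexPolygon Ω) (p : ℂ × ℝ) : (metCells Ω p).Nonempty := by
  obtain ⟨z, hz⟩ := h.nonempty
  obtain ⟨x, hx, -⟩ := mem_iUnion₂.1 (image_place_subset h p ⟨z, hz, rfl⟩)
  exact ⟨x, hx⟩

/-- A covering by cells contains all the cells that are met. -/
lemma metCells_subset_of_cover {q : ℂ × ℝ} {C : Set ℂ} (hC : C ⊆ lattice)
    (hcov : place q '' Ω ⊆ ⋃ x ∈ C, hexCell x) : metCells Ω q ⊆ C := by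
  rintro x ⟨hx, y, hy, hyx⟩
  obtain ⟨x', hx', hyx'⟩ := mem_iUnion₂.1 (hcov hy)
  rwa [eq_of_mem_hexCell hx (hC hx') hyx hyx']

/-- By the symmetry of the tiling, it suffices to consider the placements in the prism. -/
lemma exists_mem_prism_encard_le (q : ℂ × ℝ) :
    ∃ q' ∈ prism, (metCells Ω q').encard ≤ (metCells Ω q).encard := by
  have hpos : 0 < Real.pi / 3 := by positivity
  set j : ℤ := -⌊q.2 / (Real.pi / 3)⌋ with hj
  set ρ := rot (j * (Real.pi / 3)) with hρ
  have hρ0 : ρ ≠ 0 := rot_ne_zero _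
  have hinv := rot_int_mul_invariance j
  obtain ⟨y, hy, hyu⟩ := exists_lattice_sub_mem_hexagon (ρ * q.1)
  have hplace : ∀ z, place (ρ * q.1 - y, j * (Real.pi / 3) + q.2) z = ρ * place q z - y := fun z => by
    simp only [place, rot_add]
    rw [← hρ]; ring
  refine ⟨(ρ * q.1 - y, j * (Real.pi / 3) + q.2), ⟨hyu, ?_, ?_⟩, ?_⟩
  · have := Int.floor_le (q.2 / (Real.pi / 3))
    rw [le_div_iff₀ hpos] at this
    simp only [hj]; push_cast; linarith
  · have := Int.lt_floor_add_one (q.2 / (Real.pi / 3))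
    rw [div_lt_iff₀ hpos] at this
    simp only [hj]; push_cast; linarith
  · have hsub : metCells Ω (ρ * q.1 - y, j * (Real.pi / 3) + q.2) ⊆
        (fun x => ρ * x - y) '' metCells Ω q := by
      rintro x ⟨hx, _, ⟨z, hz, rfl⟩, hzx⟩
      have hxx : ρ * (ρ⁻¹ * (x + y)) = x + y := mul_inv_cancel_left₀ hρ0 _
      refine ⟨ρ⁻¹ * (x + y), ⟨?_, place q z, ⟨z, hz, rfl⟩, ?_⟩, by simp only [hxx]; ring⟩
      · rw [← (hinv _).1, hxx]
        exact add_mem_lattice hx hy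
      · rw [mem_interior_hexCell, ← (hinv _).2, mul_sub, hxx]
        rw [mem_interior_hexCell, hplace] at hzx
        convert hzx using 1
        ring
    exact (encard_le_encard hsub).trans (encard_image_le _ _)

/-- In the prism, the index counts the cells that are met. -/
lemma hitPoints_eq_metCells (h : IsConvexPolygon Ω) (h0 : (0 : ℂ) ∈ Ω) {p : ℂ × ℝ}
    (hp : p ∈ prism) : hitPoints Ω p = metCells Ω p := by
  ext x
  constructor
  · rintro ⟨hx, hmem⟩
    exact ⟨hx.1, (mem_interior_minkowski_iff_meets h).1 hmem⟩
  · rintro ⟨hx, hmeet⟩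
    refine ⟨⟨hx, ?_⟩, (mem_interior_minkowski_iff_meets h).2 hmeet⟩
    obtain ⟨_, ⟨z, hz, rfl⟩, hzx⟩ := hmeet
    have h1 : ‖z‖ ≤ Metric.diam Ω := by
      have := Metric.dist_le_diam_of_mem h.isCompact.isBounded hz h0
      rwa [dist_zero_right] at this
    have h2 := hexagon_subset_closedBall (interior_subset (mem_interior_hexCell.1 hzx))
    have h3 := hexagon_subset_closedBall hp.1
    rw [mem_closedBall_zero_iff] at h2 h3
    have h4 : ‖x‖ ≤ Metric.diam Ω + 3 := by
      calc ‖x‖ = ‖rot p.2 * z + p.1 - (place p z - x)‖ := by rw [place]; congr 1; ring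
        _ ≤ ‖rot p.2 * z + p.1‖ + ‖place p z - x‖ := norm_sub_le _ _
        _ ≤ ‖rot p.2 * z‖ + ‖p.1‖ + ‖place p z - x‖ := by gcongr; exact norm_add_le _ _
        _ ≤ Metric.diam Ω + 3 := by rw [norm_mul, norm_rot, one_mul]; linarith
    exact ⟨(Complex.abs_re_le_norm x).trans h4, (Complex.abs_im_le_norm x).trans h4⟩

lemma commonPoints_subset_prism : commonPoints Ω ⊆ prism := by
  rintro p ⟨X, ⟨S₁, S₂, S₃, -, -, -, -, -, -, rfl⟩, hp⟩
  exact hp.2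

lemma hexCell_subset_closedBall (x : ℂ) : hexCell x ⊆ Metric.closedBall x 1 := by
  intro z hz
  have := hexagon_subset_closedBall (mem_hexCell.1 hz)
  rwa [mem_closedBall_zero_iff, ← dist_eq_norm] at this

/-- A polygon in a disc of diameter at most `1` about the origin meets only the cell at the
origin. -/
lemma metCells_of_isSmallWith (h : IsConvexPolygon Ω) {c : ℂ} (hc : IsSmallWith Ω c) :
    metCells Ω (-c, 0) = {0} := by
  obtain ⟨r, ⟨hr, -⟩, hr1⟩ := hc
  have hsub : metCells Ω (-c, 0) ⊆ {0} := by
    apply metCells_subset_of_cover (singleton_subset_iff.2 zero_mem_lattice)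
    rintro _ ⟨z, hz, rfl⟩
    have hz' := hr hz
    rw [Metric.mem_closedBall, dist_eq_norm] at hz'
    simp only [mem_singleton_iff, iUnion_iUnion_eq_left, mem_hexCell, place, rot_zero, one_mul,
      sub_zero]
    exact interior_subset (mem_interior_hexagon_of_norm (by rw [← sub_eq_add_neg]; linarith))
  exact (subset_singleton_iff_eq.1 hsub).resolve_left (metCells_nonempty h _).ne_empty

lemma encard_metCells_le_of_forall (h : IsConvexPolygon Ω) (h0 : (0 : ℂ) ∈ Ω)
    {points : Set (ℂ × ℝ)} (hV : vertexPoints Ω ⊆ points) {p : ℂ × ℝ} (hp : p ∈ prism)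
    (hmin : ∀ q ∈ points, index Ω p ≤ index Ω q) (q : ℂ × ℝ) :
    (metCells Ω p).encard ≤ (metCells Ω q).encard := by
  obtain ⟨q', hq', hle⟩ := exists_mem_prism_encard_le (Ω := Ω) q
  obtain ⟨v, hv, hvq⟩ := exists_vertexPoint_hitPoints_subset h hq'
  rw [← hitPoints_eq_metCells h h0 hp]
  refine ((hmin v (hV hv)).trans (encard_le_encard hvq)).trans ?_
  rwa [hitPoints_eq_metCells h h0 hq']

end HexCover

theorem mainTheorem8 (Ω : Set ℂ) (hΩ : HexCover.IsConvexPolygon Ω) (h0 : (0 : ℂ) ∈ Ω) :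
    -- the list of points to be inspected is finite
    (HexCover.vertexPoints Ω).Finite ∧
    -- the algorithm may inspect further points of the curves that three surfaces have in common
    ∀ points : Set (ℂ × ℝ),
      HexCover.vertexPoints Ω ⊆ points → points ⊆ HexCover.commonPoints Ω →
      -- the algorithm returns something
      (∃ out, HexCover.IsOutput Ω points out) ∧
      ∀ out, HexCover.IsOutput Ω points out →
        -- the centres are those of the finitely many cells met by the placed polygon,
        out.centres.Finite ∧
        out.centres = HexCover.metCells Ω out.placement ∧
        -- these cells, and the unit discs about the centres, cover the placed polygon,
        HexCover.place out.placement '' Ω ⊆ ⋃ x ∈ out.centres, HexCover.hexCell x ∧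
        HexCover.place out.placement '' Ω ⊆ ⋃ x ∈ out.centres, Metric.closedBall x 1 ∧
        -- no placement of the polygon meets fewer cells,
        (∀ q : ℂ × ℝ,
          (HexCover.metCells Ω out.placement).encard ≤ (HexCover.metCells Ω q).encard) ∧
        -- and no placement of the polygon can be covered with fewer cells
        (∀ (q : ℂ × ℝ) (C : Set ℂ), C ⊆ HexCover.lattice →
          HexCover.place q '' Ω ⊆ ⋃ x ∈ C, HexCover.hexCell x →
          out.centres.encard ≤ C.encard) := by
  open HexCover in
  refine ⟨finite_vertexPoints hΩ, fun points hV hpts => ⟨?_, fun out hout => ?_⟩⟩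
  · by_cases hsmall : ∃ c, IsSmallWith Ω c
    · obtain ⟨c, hc⟩ := hsmall
      exact ⟨_, IsOutput.small c hc⟩
    · obtain ⟨v, hv, -⟩ := exists_vertexPoint_hitPoints_subset hΩ
        (show ((0 : ℂ), (0 : ℝ)) ∈ prism from ⟨zero_mem_hexagon, zero_mem_angles⟩)
      have hne : (index Ω '' points).Nonempty := ⟨_, v, hV hv, rfl⟩
      obtain ⟨p, hp, hpi⟩ := csInf_mem hne
      exact ⟨_, IsOutput.search hsmall p hp fun q hq => hpi ▸ csInf_le (OrderBot.bddBelow _) ⟨q, hq, rfl⟩⟩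
  · -- it is enough to identify the centres and to prove that the placement is optimal
    suffices hkey : out.centres = metCells Ω out.placement ∧
        ∀ q, (metCells Ω out.placement).encard ≤ (metCells Ω q).encard by
      obtain ⟨hcen, hopt⟩ := hkey
      have hcov := image_place_subset hΩ out.placement
      rw [← hcen] at hcov
      exact ⟨hcen ▸ finite_metCells hΩ _, hcen, hcov,
        hcov.trans (iUnion₂_mono fun x _ => hexCell_subset_closedBall x), hopt,
        fun q C hC hqC => hcen ▸ (hopt q).trans (encard_le_encard (metCells_subset_of_cover hC hqC))⟩
    rcases hout with ⟨c, hc⟩ | ⟨-, p, hp, hmin⟩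
    · have hmet := metCells_of_isSmallWith hΩ hc
      refine ⟨?_, fun q => ?_⟩
      · simp only [hmet, place, rot_zero, one_mul, add_neg_cancel]
      · simp only [hmet, encard_singleton]
        exact one_le_encard_iff_nonempty.2 (metCells_nonempty hΩ q)
    · have hpp := commonPoints_subset_prism (hpts hp)
      exact ⟨hitPoints_eq_metCells hΩ h0 hpp, encard_metCells_le_of_forall hΩ h0 hV hpp hmin⟩
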